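/- Let $V$ be a complex vector space of dimension $6$. Call a subspace $A\subset\wedge^3V$ Lagrangian if it equals its own orthogonal for the symplectic form $\omega(x,y)=x\wedge y\in\wedge^6V\cong\mathbb C$. Let $\mathbb{LG}(\wedge^3V)^0$ be the set of Lagrangian $A$ that contain no nonzero decomposable tensor $v_1\wedge v_2\wedge v_3$ and satisfy $\dim\big((v\wedge\wedge^2V)\cap A\big)\le 2$ for all $v\in V$. Let $\sigma$ be a linear involution of $V$ with eigenspaces $V^{+}$ (eigenvalue $1$) and $V^-$ (eigenvalue $-1$), $\dim V^+=4$, and for $A\subset\wedge^3V$ put $A^+=A\cap\big(\wedge^3V^+\oplus(V^+\otimes\wedge^2V^-)\big)$, $A^-=A\cap\big((V^-\otimes\wedge^2V^+)\oplus\wedge^3V^-\big)$. Let $\mathbb{LG}(\wedge^3V)^*$ be the set of Lagrangian subspaces $A=A^+\oplus A^-$ such that $A^+\cap\wedge^3V^+=0$, $A^+\cap(\wedge^2V^-\otimes V^+)=0$, and for some basis $f_1,f_2$ of $V^-$ one has $A^-\cap(\mathbb Cf_i\otimes\wedge^2V^+)=0$ $(i=1,2)$ and $A^-=\{f_1\wedge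 x+f_2\wedge u(x): x\in\wedge^2V^+\}$ for a linear operator $u$ on $\wedge^2V^+$ with six distinct eigenvalues and no decomposable eigenvector. For such an $A$ one has $A^+=\{f_1\wedge f_2\wedge v+\varphi(v): v\in V^+\}$ for a linear map $\varphi:V^+\to\wedge^3V^+$; let $q_A(v)=v\wedge\varphi(v)\in\wedge^4V^+\cong\mathbb C$, a quadratic form on $V^+$ well defined up to a nonzero scalar, and let $Q=\{q_A=0\}\subset\mathbb P(V^+)$. For a Lagrangian $A$ let $\lambda_A:F\to(\wedge^3V/A)\otimes\mathcal O_{\mathbb P(V)}$ be the natural map on the bundle $F$ with fibres $F_v=v\wedge\wedge^2V$, let $Y_A=\{\det\lambda_A=0\}$, and let $X_A=\operatorname{Spec}(\mathcal O_{Y_A}\oplus\xi_A)\to Y_A$ be the double cover given by $\xi_A=\operatorname{coker}(\lambda_A)\otimes\mathcal O_{Y_A}(-3)$, with multiplication given locally by $[a]\cdot[b]=\omega(a,\operatorname{adj}(\lambda_A)b)$ modulo $\det\lambda_A$. Proposition. If $A=A^+\oplus A^-\in\mathbb{LG}(\wedge^3V)^*$ and the quadric $Q$ is general with respect to $A^-$,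 then $A\in\mathbb{LG}(\wedge^3V)^0$ and $X_A$ is smooth. Precisely: for every $A_0\in\mathbb{LG}(\wedge^3V)^*$ there is a nonempty Zariski-open subset $U$ of the space of quadratic forms on $V^+$ such that every $A\in\mathbb{LG}(\wedge^3V)^*$ with $A^-=A_0^-$ for which some equation $q$ of its quadric $Q$ lies in $U$ belongs to $\mathbb{LG}(\wedge^3V)^0$ and has smooth $X_A$. -/

import Mathlib

noncomputable section

/-! ### Subspaces of the exterior algebra

All exterior powers of `V` and of subspaces of `V` are regarded as subspaces of `⋀ V`, so that the
wedge product is the product of `ExteriorAlgebra ℂ V`. -/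

/-- `⋀ⁿ P ⊆ ⋀ V`, for a subspace `P ⊆ V`. -/
def wedgePow {V : Type*} [AddCommGroup V] [Module ℂ V] (P : Submodule ℂ V) (n : ℕ) :
    Submodule ℂ (ExteriorAlgebra ℂ V) :=
  (P.map (ExteriorAlgebra.ι ℂ)) ^ n

/-- The subspace `F_v = v ∧ ⋀² V` of `⋀³ V`. -/
def wedgeFiber {V : Type*} [AddCommGroup V] [Module ℂ V] (v : V) :
    Submodule ℂ (ExteriorAlgebra ℂ V) :=
  (Submodule.span ℂ {ExteriorAlgebra.ι ℂ v}) * (⋀[ℂ]^2 V)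

/-- `A` is a Lagrangian subspace of `⋀³ V` (with `dim V = 6`): it is equal to its own orthogonal
for the symplectic form `(x, y) ↦ x ∧ y ∈ ⋀⁶ V ≅ ℂ`. -/
def IsLagrangian {V : Type*} [AddCommGroup V] [Module ℂ V]
    (A : Submodule ℂ (ExteriorAlgebra ℂ V)) : Prop :=
  A ≤ ⋀[ℂ]^3 V ∧ ∀ x ∈ ⋀[ℂ]^3 V, (x ∈ A ↔ ∀ y ∈ A, x * y = 0)

/-- `LG⁰(⋀³ V)`: Lagrangian subspaces containing no nonzero decomposable tensor and with
`dim (v ∧ ⋀² V) ∩ A ≤ 2` for all `v`. -/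
def LGZero (V : Type*) [AddCommGroup V] [Module ℂ V] :
    Set (Submodule ℂ (ExteriorAlgebra ℂ V)) :=
  {A | IsLagrangian A ∧
    (∀ v₁ v₂ v₃ : V,
      ExteriorAlgebra.ι ℂ v₁ * ExteriorAlgebra.ι ℂ v₂ * ExteriorAlgebra.ι ℂ v₃ ∈ A →
      ExteriorAlgebra.ι ℂ v₁ * ExteriorAlgebra.ι ℂ v₂ * ExteriorAlgebra.ι ℂ v₃ = 0) ∧
    ∀ v : V, Module.finrank ℂ ↥(wedgeFiber v ⊓ A) ≤ 2}

/-! ### The decomposition given by an involution -/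

/-- `V⁺`. -/
abbrev plusSpace {V : Type*} [AddCommGroup V] [Module ℂ V] (σ : V →ₗ[ℂ] V) : Submodule ℂ V :=
  Module.End.eigenspace σ 1

/-- `V⁻`. -/
abbrev minusSpace {V : Type*} [AddCommGroup V] [Module ℂ V] (σ : V →ₗ[ℂ] V) : Submodule ℂ V :=
  Module.End.eigenspace σ (-1)

/-- `A⁺ = A ∩ (⋀³ V⁺ ⊕ (V⁺ ⊗ ⋀² V⁻))`. -/
def plusPart {V : Type*} [AddCommGroup V] [Module ℂ V] (σ : V →ₗ[ℂ] V)
    (A : Submodule ℂ (ExteriorAlgebra ℂ V)) : Submodule ℂ (ExteriorAlgebra ℂ V) :=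
  A ⊓ (wedgePow (plusSpace σ) 3 ⊔ wedgePow (plusSpace σ) 1 * wedgePow (minusSpace σ) 2)

/-- `A⁻ = A ∩ ((V⁻ ⊗ ⋀² V⁺) ⊕ ⋀³ V⁻)`. -/
def minusPart {V : Type*} [AddCommGroup V] [Module ℂ V] (σ : V →ₗ[ℂ] V)
    (A : Submodule ℂ (ExteriorAlgebra ℂ V)) : Submodule ℂ (ExteriorAlgebra ℂ V) :=
  A ⊓ (wedgePow (minusSpace σ) 1 * wedgePow (plusSpace σ) 2 ⊔ wedgePow (minusSpace σ) 3)

/-- `LG(⋀³ V)^*`: the Lagrangian subspaces `A = A⁺ ⊕ A⁻` with `A⁺ ∩ ⋀³ V⁺ = 0`,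
`A⁺ ∩ (⋀² V⁻ ⊗ V⁺) = 0` for which there are a basis `f₁, f₂` of `V⁻` with
`A⁻ ∩ (ℂ fᵢ ⊗ ⋀² V⁺) = 0` and an operator `u` on `⋀² V⁺` with six distinct eigenvalues and no
decomposable eigenvector such that `A⁻ = {f₁ ∧ x + f₂ ∧ u x}`.  (That `u` is self-adjoint is
automatic, as `A` is Lagrangian.) -/
def LGStar {V : Type*} [AddCommGroup V] [Module ℂ V] (σ : V →ₗ[ℂ] V) :
    Set (Submodule ℂ (ExteriorAlgebra ℂ V)) :=
  {A | IsLagrangian A ∧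
    A = plusPart σ A ⊔ minusPart σ A ∧
    plusPart σ A ⊓ wedgePow (plusSpace σ) 3 = ⊥ ∧
    plusPart σ A ⊓ (wedgePow (minusSpace σ) 2 * wedgePow (plusSpace σ) 1) = ⊥ ∧
    ∃ (f : Module.Basis (Fin 2) ℂ (minusSpace σ))
      (u : Module.End ℂ ↥(wedgePow (plusSpace σ) 2)),
      (∀ i : Fin 2, minusPart σ A ⊓
        (Submodule.span ℂ {ExteriorAlgebra.ι ℂ (f i : V)} * wedgePow (plusSpace σ) 2) = ⊥) ∧
      (∀ a, a ∈ minusPart σ A ↔ ∃ x : ↥(wedgePow (plusSpace σ) 2),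
        a = ExteriorAlgebra.ι ℂ (f 0 : V) * (x : ExteriorAlgebra ℂ V)
          + ExteriorAlgebra.ι ℂ (f 1 : V) * (u x : ExteriorAlgebra ℂ V)) ∧
      {μ : ℂ | u.HasEigenvalue μ}.ncard = 6 ∧
      ∀ (μ : ℂ) (x : ↥(wedgePow (plusSpace σ) 2)), u.HasEigenvector μ x →
        ∀ v ∈ plusSpace σ, ∀ w ∈ plusSpace σ,
          (x : ExteriorAlgebra ℂ V) ≠ ExteriorAlgebra.ι ℂ v * ExteriorAlgebra.ι ℂ w}

/-- The quadratic form `q` on `V⁺` is an equation of the quadric `Q = {v ∧ φ(v) = 0} ⊆ ℙ(V⁺)`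
attached to `A`, where `φ : V⁺ → ⋀³ V⁺` is the linear map with
`A⁺ = {f₁ ∧ f₂ ∧ v + φ(v) | v ∈ V⁺}` for a basis `f₁, f₂` of `V⁻`; here `⋀⁴ V⁺` is identified with
`ℂ` by means of a generator `η`. -/
def IsQuadricEquation {V : Type*} [AddCommGroup V] [Module ℂ V] (σ : V →ₗ[ℂ] V)
    (A : Submodule ℂ (ExteriorAlgebra ℂ V)) (q : QuadraticForm ℂ (plusSpace σ)) : Prop :=
  ∃ (f : Module.Basis (Fin 2) ℂ (minusSpace σ))
    (φ : plusSpace σ →ₗ[ℂ] ↥(wedgePow (plusSpace σ) 3))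
    (η : ExteriorAlgebra ℂ V),
    (∀ a, a ∈ plusPart σ A ↔ ∃ v : plusSpace σ,
      a = ExteriorAlgebra.ι ℂ (f 0 : V) * ExteriorAlgebra.ι ℂ (f 1 : V)
          * ExteriorAlgebra.ι ℂ (v : V) + (φ v : ExteriorAlgebra ℂ V)) ∧
    η ∈ wedgePow (plusSpace σ) 4 ∧ η ≠ 0 ∧
    ∀ v : plusSpace σ,
      ExteriorAlgebra.ι ℂ (v : V) * (φ v : ExteriorAlgebra ℂ V) = q v • η

/-! ### The Zariski topology of a vector space -/

/-- Zariski open subsets of a finite-dimensional complex vector space `M`: complements of common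
zero loci of polynomial functions (polynomials in the linear forms on `M`). -/
def IsZariskiOpen {M : Type*} [AddCommGroup M] [Module ℂ M] (U : Set M) : Prop :=
  ∃ T : Set (MvPolynomial (Module.Dual ℂ M) ℂ),
    Uᶜ = {m | ∀ p ∈ T, MvPolynomial.eval (fun l : Module.Dual ℂ M => l m) p = 0}

/-! ### The double cover `X_A`

`X_A = Spec (𝒪_{Y_A} ⊕ ξ_A)` is affine over `ℙ(V)`, so it is described by its coordinate algebras
over the standard affine charts of `ℙ(V)`.  A basis `e₀, …, e₅` of `V` gives the chart of the points
`[v]`, `v = e₀ + x₁ e₁ + ⋯ + x₅ e₅`, with coordinate ring `R = ℂ[x₁, …, x₅]`. -/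

/-- Indices for the basis `v ∧ e_p ∧ e_q` (`1 ≤ p < q ≤ 5`) of `F_v`. -/
abbrev PairIdx : Type := {p : Fin 5 × Fin 5 // p.1 < p.2}

/-- `⋀³ V / A`. -/
abbrev WedgeQuot {V : Type*} [AddCommGroup V] [Module ℂ V]
    (A : Submodule ℂ (ExteriorAlgebra ℂ V)) : Type _ :=
  ↥(⋀[ℂ]^3 V) ⧸ A.submoduleOf (⋀[ℂ]^3 V)

/-- The identification `⋀⁶ V ≅ ℂ` sending `e₀ ∧ ⋯ ∧ e₅` to `1` (extended by `0` to the other degrees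
of `⋀ V`). -/
def volForm {V : Type*} [AddCommGroup V] [Module ℂ V] (e : Module.Basis (Fin 6) ℂ V) :
    ExteriorAlgebra ℂ V →ₗ[ℂ] ℂ :=
  ExteriorAlgebra.liftAlternating (Pi.single 6 e.det)

/-- The element `e_i ∧ e_p ∧ e_q` of `⋀³ V`, with `0 ≤ i ≤ 5` and `1 ≤ p < q ≤ 5`. -/
def tripleWedge {V : Type*} [AddCommGroup V] [Module ℂ V] (e : Module.Basis (Fin 6) ℂ V)
    (i : Fin 6) (j : PairIdx) : ↥(⋀[ℂ]^3 V) :=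
  exteriorPower.ιMulti ℂ 3 ![e i, e j.1.1.succ, e j.1.2.succ]

/-- The coordinates `(1, x₁, …, x₅)` of the tautological vector `v` on the chart. -/
def chartCoord : Fin 6 → MvPolynomial (Fin 5) ℂ :=
  Fin.cons 1 MvPolynomial.X

/-- The matrix of `λ_A : F → (⋀³ V / A) ⊗ 𝒪` on the chart, in the basis `v ∧ e_p ∧ e_q` of `F` and
a basis `c` of `⋀³ V / A`. -/
def lambdaMatrix {V : Type*} [AddCommGroup V] [Module ℂ V]
    (A : Submodule ℂ (ExteriorAlgebra ℂ V)) (e : Module.Basis (Fin 6) ℂ V)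
    (c : Module.Basis PairIdx ℂ (WedgeQuot A)) :
    Matrix PairIdx PairIdx (MvPolynomial (Fin 5) ℂ) :=
  Matrix.of fun k j => ∑ i : Fin 6, chartCoord i *
    MvPolynomial.C (c.repr (Submodule.Quotient.mk (tripleWedge e i j)) k)

/-- A representative in `⋀³ V` of the basis vector `c_k` of `⋀³ V / A`. -/
def quotLift {V : Type*} [AddCommGroup V] [Module ℂ V]
    (A : Submodule ℂ (ExteriorAlgebra ℂ V)) (c : Module.Basis PairIdx ℂ (WedgeQuot A))
    (k : PairIdx) : ↥(⋀[ℂ]^3 V) :=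
  Function.surjInv (Submodule.Quotient.mk_surjective (A.submoduleOf (⋀[ℂ]^3 V))) (c k)

/-- The matrix of the pairings `ω(c_k, v ∧ e_p ∧ e_q)` of the chosen representatives with the basis
of `F`, where `ω(x, y) = x ∧ y`. -/
def omegaMatrix {V : Type*} [AddCommGroup V] [Module ℂ V]
    (A : Submodule ℂ (ExteriorAlgebra ℂ V)) (e : Module.Basis (Fin 6) ℂ V)
    (c : Module.Basis PairIdx ℂ (WedgeQuot A)) :
    Matrix PairIdx PairIdx (MvPolynomial (Fin 5) ℂ) :=
  Matrix.of fun k j => ∑ i : Fin 6, chartCoord i *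
    MvPolynomial.C (volForm e ((quotLift A c k : ExteriorAlgebra ℂ V)
      * (tripleWedge e i j : ExteriorAlgebra ℂ V)))

/-- The ideal of relations of the coordinate algebra of `X_A` over the chart, inside the polynomial
ring over `R` in variables `t_k` standing for the classes of the `c_k` in
`ζ_A = coker λ_A`:
* `det λ_A = 0`, the equation of `Y_A`;
* `∑_k (λ_A)_{k j} t_k = 0`, the relations defining `ζ_A`;
* `t_k t_l = ω(c_k, adj(λ_A) c_l)`, the multiplication `ζ_A × ζ_A → 𝒪_{Y_A}`.
The last formula is the one given by `β_A : ζ_A → Ext¹(ζ_A, 𝒪) = Hom(ζ_A, 𝒪_{Y_A})`: modulo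
`det λ_A` it depends only on the classes of `c_k` and `c_l` in `ζ_A`, and it is symmetric. -/
def chartIdeal {V : Type*} [AddCommGroup V] [Module ℂ V]
    (A : Submodule ℂ (ExteriorAlgebra ℂ V)) (e : Module.Basis (Fin 6) ℂ V)
    (c : Module.Basis PairIdx ℂ (WedgeQuot A)) :
    Ideal (MvPolynomial PairIdx (MvPolynomial (Fin 5) ℂ)) :=
  Ideal.span
    ({MvPolynomial.C (lambdaMatrix A e c).det} ∪
      Set.range (fun j : PairIdx =>
        ∑ k, MvPolynomial.C (lambdaMatrix A e c k j) * MvPolynomial.X k) ∪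
      Set.range (fun kl : PairIdx × PairIdx =>
        MvPolynomial.X kl.1 * MvPolynomial.X kl.2 -
          MvPolynomial.C ((omegaMatrix A e c * (lambdaMatrix A e c).adjugate) kl.1 kl.2)))

/-- The coordinate algebra of `X_A` over the chart attached to `e`, i.e. the sections of
`𝒪_{Y_A} ⊕ ξ_A` on it. -/
abbrev ChartAlgebra {V : Type*} [AddCommGroup V] [Module ℂ V]
    (A : Submodule ℂ (ExteriorAlgebra ℂ V)) (e : Module.Basis (Fin 6) ℂ V)
    (c : Module.Basis PairIdx ℂ (WedgeQuot A)) : Type :=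
  MvPolynomial PairIdx (MvPolynomial (Fin 5) ℂ) ⧸ chartIdeal A e c

/-- `X_A` is smooth over `ℂ`: its affine pieces over all the charts of `ℙ(V)` are smooth.  (The
auxiliary basis `c` changes the coordinate algebra only by an isomorphism.) -/
def DoubleCoverIsSmooth {V : Type*} [AddCommGroup V] [Module ℂ V]
    (A : Submodule ℂ (ExteriorAlgebra ℂ V)) : Prop :=
  ∀ (e : Module.Basis (Fin 6) ℂ V) (c : Module.Basis PairIdx ℂ (WedgeQuot A)),
    Algebra.Smooth ℂ (ChartAlgebra A e c)

end

noncomputable section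

open ExteriorAlgebra (ι ιMulti)

/-! ### Contraction, powers of subspaces, and bivectors -/

section ExteriorContraction

variable {V : Type*} [AddCommGroup V] [Module ℂ V]

/-- Contraction of an element of `⋀ V` with a linear form. -/
def wedgeContract (d : Module.Dual ℂ V) : ExteriorAlgebra ℂ V →ₗ[ℂ] ExteriorAlgebra ℂ V :=
  CliffordAlgebra.contractLeft (Q := (0 : QuadraticForm ℂ V)) d

lemma wedgeContract_ι_mul (d : Module.Dual ℂ V) (v : V) (z : ExteriorAlgebra ℂ V) :
    wedgeContract d (ι ℂ v * z) = d v • z - ι ℂ v * wedgeContract d z :=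
  CliffordAlgebra.contractLeft_ι_mul d v z

lemma wedgeContract_algebraMap (d : Module.Dual ℂ V) (r : ℂ) :
    wedgeContract d (algebraMap ℂ (ExteriorAlgebra ℂ V) r) = 0 :=
  CliffordAlgebra.contractLeft_algebraMap _ d r

lemma wedgeContract_ι (d : Module.Dual ℂ V) (v : V) :
    wedgeContract d (ι ℂ v) = algebraMap ℂ (ExteriorAlgebra ℂ V) (d v) :=
  CliffordAlgebra.contractLeft_ι _ d v

lemma ι_mul_self (v : V) : ι ℂ v * ι ℂ v = 0 := ExteriorAlgebra.ι_sq_zero v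

lemma ι_mul_swap (v w : V) : ι ℂ v * ι ℂ w = -(ι ℂ w * ι ℂ v) :=
  eq_neg_of_add_eq_zero_left (ExteriorAlgebra.ι_add_mul_swap v w)

lemma ι_mul_self_mul (v : V) (z : ExteriorAlgebra ℂ V) : ι ℂ v * (ι ℂ v * z) = 0 := by
  rw [← mul_assoc, ι_mul_self, zero_mul]

lemma ι_mul_swap_mul (v w : V) (z : ExteriorAlgebra ℂ V) :
    ι ℂ v * (ι ℂ w * z) = -(ι ℂ w * (ι ℂ v * z)) := by
  rw [← mul_assoc, ι_mul_swap, neg_mul, mul_assoc]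

/-- Contraction is an antiderivation, so with d(v) = 1 it is a contracting homotopy for left
multiplication by v. -/
lemma eq_ι_mul_wedgeContract {d : Module.Dual ℂ V} {v : V} (hd : d v = 1)
    {z : ExteriorAlgebra ℂ V} (hz : ι ℂ v * z = 0) : z = ι ℂ v * wedgeContract d z := by
  have h := wedgeContract_ι_mul d v z
  rw [hz, map_zero, hd, one_smul] at h
  exact (sub_eq_zero.mp h.symm)

/-! #### Powers of a subspace -/

lemma wedgePow_zero (P : Submodule ℂ V) : wedgePow P 0 = 1 := pow_zero _

lemma wedgePow_top (n : ℕ) : wedgePow (⊤ : Submodule ℂ V) n = ⋀[ℂ]^n V := by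
  rw [wedgePow, Submodule.map_top]

lemma ι_mem_wedgePow {P : Submodule ℂ V} {v : V} (hv : v ∈ P) : ι ℂ v ∈ wedgePow P 1 := by
  rw [wedgePow, pow_one]; exact Submodule.mem_map_of_mem hv

lemma mem_wedgePow_one {P : Submodule ℂ V} {z : ExteriorAlgebra ℂ V} :
    z ∈ wedgePow P 1 ↔ ∃ v ∈ P, ι ℂ v = z := by
  rw [wedgePow, pow_one, Submodule.mem_map]

lemma mul_mem_wedgePow {P : Submodule ℂ V} {m n : ℕ} {x y : ExteriorAlgebra ℂ V}
    (hx : x ∈ wedgePow P m) (hy : y ∈ wedgePow P n) : x * y ∈ wedgePow P (m + n) := by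
  rw [wedgePow, pow_add]; exact Submodule.mul_mem_mul hx hy

lemma ι_mul_mem_wedgePow {P : Submodule ℂ V} {n : ℕ} {v : V} {z : ExteriorAlgebra ℂ V}
    (hv : v ∈ P) (hz : z ∈ wedgePow P n) : ι ℂ v * z ∈ wedgePow P (n + 1) := by
  rw [add_comm]; exact mul_mem_wedgePow (ι_mem_wedgePow hv) hz

lemma ι_mul_ι_mem_wedgePow {P : Submodule ℂ V} {v w : V} (hv : v ∈ P) (hw : w ∈ P) :
    ι ℂ v * ι ℂ w ∈ wedgePow P 2 :=
  ι_mul_mem_wedgePow hv (ι_mem_wedgePow hw)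

lemma wedgePow_mono {P Q : Submodule ℂ V} (h : P ≤ Q) (n : ℕ) : wedgePow P n ≤ wedgePow Q n :=
  pow_le_pow_left' (Submodule.map_mono h) n

@[elab_as_elim]
lemma wedgePow_succ_induction {P : Submodule ℂ V} {n : ℕ} {C : ExteriorAlgebra ℂ V → Prop}
    (hadd : ∀ x y, C x → C y → C (x + y))
    (hmul : ∀ v ∈ P, ∀ z ∈ wedgePow P n, C (ι ℂ v * z)) {z : ExteriorAlgebra ℂ V}
    (hz : z ∈ wedgePow P (n + 1)) : C z := by
  rw [wedgePow, pow_succ'] at hz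
  refine Submodule.mul_induction_on hz ?_ (fun x y => hadd x y)
  rintro _ ⟨v, hv, rfl⟩ z hz
  exact hmul v hv z hz

lemma mem_wedgePow_zero {P : Submodule ℂ V} {z : ExteriorAlgebra ℂ V} :
    z ∈ wedgePow P 0 ↔ ∃ r, algebraMap ℂ (ExteriorAlgebra ℂ V) r = z := by
  rw [wedgePow_zero, Submodule.mem_one]

lemma wedgeContract_wedgePow_zero {P : Submodule ℂ V} (d : Module.Dual ℂ V)
    {z : ExteriorAlgebra ℂ V} (hz : z ∈ wedgePow P 0) : wedgeContract d z = 0 := by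
  obtain ⟨r, rfl⟩ := mem_wedgePow_zero.1 hz
  exact wedgeContract_algebraMap d r

lemma wedgeContract_mem {P : Submodule ℂ V} {n : ℕ} (d : Module.Dual ℂ V)
    {z : ExteriorAlgebra ℂ V} (hz : z ∈ wedgePow P (n + 1)) : wedgeContract d z ∈ wedgePow P n := by
  induction n generalizing z with
  | zero =>
    obtain ⟨v, -, rfl⟩ := mem_wedgePow_one.1 hz
    rw [wedgeContract_ι]
    exact mem_wedgePow_zero.2 ⟨_, rfl⟩
  | succ n ih =>
    refine wedgePow_succ_induction (fun x y hx hy => ?_) (fun v hv y hy => ?_) hz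
    · rw [map_add]; exact add_mem hx hy
    · rw [wedgeContract_ι_mul]
      exact sub_mem (Submodule.smul_mem _ _ hy) (ι_mul_mem_wedgePow hv (ih hy))

lemma wedgeContract_eq_zero {P : Submodule ℂ V} {n : ℕ} {d : Module.Dual ℂ V}
    (hd : ∀ v ∈ P, d v = 0) {z : ExteriorAlgebra ℂ V} (hz : z ∈ wedgePow P n) :
    wedgeContract d z = 0 := by
  induction n generalizing z with
  | zero => exact wedgeContract_wedgePow_zero d hz
  | succ n ih =>
    refine wedgePow_succ_induction (fun x y hx hy => ?_) (fun v hv y hy => ?_) hz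
    · rw [map_add, hx, hy, add_zero]
    · rw [wedgeContract_ι_mul, hd v hv, ih hy, zero_smul, mul_zero, sub_zero]

lemma ι_mul_comm_of_mem {P : Submodule ℂ V} {n : ℕ} (v : V) {z : ExteriorAlgebra ℂ V}
    (hz : z ∈ wedgePow P n) : ι ℂ v * z = (-1 : ℂ) ^ n • (z * ι ℂ v) := by
  induction n generalizing z with
  | zero =>
    obtain ⟨r, rfl⟩ := mem_wedgePow_zero.1 hz
    rw [pow_zero, one_smul, Algebra.commutes]
  | succ n ih =>
    refine wedgePow_succ_induction (fun x y hx hy => ?_) (fun w hw y hy => ?_) hz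
    · rw [mul_add, hx, hy, add_mul, smul_add]
    · rw [← mul_assoc, ι_mul_swap v w, neg_mul, mul_assoc, ih hy, pow_succ, mul_smul_comm,
        ← smul_neg, mul_smul, neg_one_smul, mul_assoc]

lemma commute_of_mem_wedgePow_two {P : Submodule ℂ V} {x : ExteriorAlgebra ℂ V}
    (hx : x ∈ wedgePow P 2) (z : ExteriorAlgebra ℂ V) : x * z = z * x := by
  induction z using ExteriorAlgebra.induction with
  | algebraMap r => exact (Algebra.commutes r x).symm
  | ι v => rw [ι_mul_comm_of_mem v hx]; simp
  | mul a b ha hb => rw [← mul_assoc, ha, mul_assoc, hb, mul_assoc]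
  | add a b ha hb => rw [mul_add, add_mul, ha, hb]

lemma wedgeContract_mul_of_mem_two {P : Submodule ℂ V} (d : Module.Dual ℂ V)
    {x : ExteriorAlgebra ℂ V} (hx : x ∈ wedgePow P 2) (z : ExteriorAlgebra ℂ V) :
    wedgeContract d (x * z) = wedgeContract d x * z + x * wedgeContract d z := by
  refine wedgePow_succ_induction (n := 1) (C := fun x => wedgeContract d (x * z) =
    wedgeContract d x * z + x * wedgeContract d z) (fun x y hx hy => ?_) (fun v hv y hy => ?_) hx
  · simp only [add_mul, map_add, hx, hy]; abel
  · obtain ⟨w, -, rfl⟩ := mem_wedgePow_one.1 hy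
    rw [mul_assoc, wedgeContract_ι_mul, wedgeContract_ι_mul, wedgeContract_ι_mul, wedgeContract_ι,
      sub_mul, mul_sub, smul_mul_assoc, mul_smul_comm, mul_assoc, mul_assoc, ← Algebra.smul_def,
      mul_smul_comm]
    abel

lemma wedgePow_eq_map (P : Submodule ℂ V) (n : ℕ) :
    wedgePow P n = (⋀[ℂ]^n P).map (ExteriorAlgebra.map P.subtype).toLinearMap := by
  rw [wedgePow, Submodule.map_pow]
  congr 1
  rw [← Submodule.map_top, ← Submodule.map_comp, ExteriorAlgebra.map_comp_ι,
    Submodule.map_comp, Submodule.map_top, Submodule.range_subtype]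

lemma wedgePow_eq_span (P : Submodule ℂ V) (n : ℕ) :
    wedgePow P n = Submodule.span ℂ (Set.range fun v : Fin n → P => ιMulti ℂ n fun i => (v i : V)) := by
  rw [wedgePow_eq_map, ← ExteriorAlgebra.ιMulti_span_fixedDegree, Submodule.map_span, ← Set.range_comp]
  congr 2
  ext v
  simp [ExteriorAlgebra.map_apply_ιMulti, Function.comp_def]

lemma exists_eq_smul_of_mem_wedgePow {P : Submodule ℂ V} {n : ℕ} (e : Module.Basis (Fin n) ℂ P)
    {z : ExteriorAlgebra ℂ V} (hz : z ∈ wedgePow P n) :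
    ∃ s : ℂ, z = s • ιMulti ℂ n fun i => (e i : V) := by
  rw [wedgePow_eq_span] at hz
  have hle : Submodule.span ℂ (Set.range fun v : Fin n → P => ιMulti ℂ n fun i => (v i : V)) ≤
      Submodule.span ℂ {ιMulti ℂ n fun i => (e i : V)} := by
    refine Submodule.span_le.2 ?_
    rintro _ ⟨v, rfl⟩
    -- Alternating maps in n arguments on an n-dimensional space agree once they agree on
    -- permutations of a basis.
    have h : (ιMulti ℂ n (M := V)).compLinearMap P.subtype =
        (LinearMap.toSpanSingleton ℂ _ (ιMulti ℂ n fun i => (e i : V))).compAlternatingMap e.det := by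
      refine Module.Basis.ext_alternating e fun i h => ?_
      let τ : Equiv.Perm (Fin n) := Equiv.ofBijective i (Finite.injective_iff_bijective.1 h)
      change (ιMulti ℂ n (M := V)) ((fun i => (e i : V)) ∘ τ) = e.det (e ∘ τ) • _
      rw [AlternatingMap.map_perm, AlternatingMap.map_perm, Module.Basis.det_self]
      simp
    exact Submodule.mem_span_singleton.2 ⟨e.det v, (congr($h v)).symm⟩
  obtain ⟨s, hs⟩ := Submodule.mem_span_singleton.1 (hle hz)
  exact ⟨s, hs.symm⟩

lemma exists_dual_eq_one_of_notMem {Q : Submodule ℂ V} {v : V} (hv : v ∉ Q) :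
    ∃ d : Module.Dual ℂ V, d v = 1 ∧ ∀ w ∈ Q, d w = 0 := by
  obtain ⟨d, hd, hQ⟩ := Submodule.exists_dual_map_eq_bot_of_notMem hv inferInstance
  refine ⟨(d v)⁻¹ • d, by simp [hd], fun w hw => ?_⟩
  have : d w = 0 := by
    have := Submodule.mem_map_of_mem (f := d) hw
    rwa [hQ, Submodule.mem_bot] at this
  simp [this]

lemma exists_dual_eq_one {v : V} (hv : v ≠ 0) : ∃ d : Module.Dual ℂ V, d v = 1 := by
  obtain ⟨d, hd, -⟩ := exists_dual_eq_one_of_notMem (Q := ⊥) (v := v) (by simpa using hv)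
  exact ⟨d, hd⟩

lemma finrank_le_finrank_inf_ker_add_one (Q : Submodule ℂ V) [FiniteDimensional ℂ Q]
    (d : Module.Dual ℂ V) :
    Module.finrank ℂ Q ≤ Module.finrank ℂ ↥(Q ⊓ LinearMap.ker d) + 1 := by
  have h := (d.domRestrict Q).finrank_range_add_finrank_ker
  have h1 : Module.finrank ℂ (LinearMap.range (d.domRestrict Q)) ≤ 1 :=
    (Submodule.finrank_le _).trans (by simp)
  have h2 : Module.finrank ℂ (LinearMap.ker (d.domRestrict Q)) ≤
      Module.finrank ℂ ↥(Q ⊓ LinearMap.ker d) := by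
    have hfd : FiniteDimensional ℂ ↥(Q ⊓ LinearMap.ker d) :=
      Submodule.finiteDimensional_of_le inf_le_left
    refine LinearMap.finrank_le_finrank_of_injective
      (f := (Q.subtype.comp (LinearMap.ker (d.domRestrict Q)).subtype).codRestrict _ fun x =>
        ⟨x.1.2, x.2⟩) fun x y h => ?_
    exact Subtype.ext (Subtype.ext congr(($h : V)))
  omega

/-- An element of `⋀ⁿ P` killed by a subspace of dimension greater than `n` vanishes. -/
lemma eq_zero_of_forall_ι_mul_eq_zero {P : Submodule ℂ V} {n : ℕ} {z : ExteriorAlgebra ℂ V}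
    (hz : z ∈ wedgePow P n) (Q : Submodule ℂ V) [FiniteDimensional ℂ Q]
    (hn : n < Module.finrank ℂ Q) (h : ∀ w ∈ Q, ι ℂ w * z = 0) : z = 0 := by
  induction n generalizing z Q with
  | zero =>
    have hpos : 0 < Module.finrank ℂ Q := by omega
    obtain ⟨w, hw⟩ := (Module.finrank_pos_iff_exists_ne_zero (R := ℂ)).1 hpos
    obtain ⟨d, hd⟩ := exists_dual_eq_one (v := (w : V)) (by simpa using hw)
    rw [eq_ι_mul_wedgeContract hd (h w w.2), wedgeContract_wedgePow_zero d hz, mul_zero]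
  | succ n ih =>
    have hpos : 0 < Module.finrank ℂ Q := by omega
    obtain ⟨w, hw⟩ := (Module.finrank_pos_iff_exists_ne_zero (R := ℂ)).1 hpos
    obtain ⟨d, hd⟩ := exists_dual_eq_one (v := (w : V)) (by simpa using hw)
    -- In z = w ∧ (d⌟z) the contraction has degree n and is killed by the hyperplane Q ∩ ker d, so
    -- the induction hypothesis applies to it.
    have hfd : FiniteDimensional ℂ ↥(Q ⊓ LinearMap.ker d) :=
      Submodule.finiteDimensional_of_le inf_le_left
    rw [eq_ι_mul_wedgeContract hd (h w w.2), ih (wedgeContract_mem d hz) (Q ⊓ LinearMap.ker d) ?_ ?_,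
      mul_zero]
    · have := finrank_le_finrank_inf_ker_add_one Q d
      omega
    · rintro y ⟨hy, hyd⟩
      have := wedgeContract_ι_mul d y z
      rw [h y hy, map_zero, LinearMap.mem_ker.1 hyd, zero_smul, zero_sub] at this
      exact neg_eq_zero.1 this.symm

/-! #### Elements of degree two -/

/-- Both bivectors are divisible by a, so their product contains a twice: the bivectors a∧w form an
isotropic space for the wedge pairing. -/
lemma mul_self_eq_zero_of_ι_mul_eq_zero {P : Submodule ℂ V} {a : V} (ha : a ≠ 0)
    {x y : ExteriorAlgebra ℂ V} (hy : y ∈ wedgePow P 2)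
    (hax : ι ℂ a * x = 0) (hay : ι ℂ a * y = 0) : x * y = 0 := by
  obtain ⟨d, hd⟩ := exists_dual_eq_one ha
  rw [← commute_of_mem_wedgePow_two hy, eq_ι_mul_wedgeContract hd hax, ← mul_assoc,
    commute_of_mem_wedgePow_two hy, hay, zero_mul]

lemma exists_ι_mul_ι_eq {P : Submodule ℂ V} {a : V} (ha : a ≠ 0) {x : ExteriorAlgebra ℂ V}
    (hx : x ∈ wedgePow P 2) (hax : ι ℂ a * x = 0) : ∃ w ∈ P, x = ι ℂ a * ι ℂ w := by
  obtain ⟨d, hd⟩ := exists_dual_eq_one ha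
  obtain ⟨w, hw, h⟩ := mem_wedgePow_one.1 (wedgeContract_mem d hx)
  exact ⟨w, hw, h ▸ eq_ι_mul_wedgeContract hd hax⟩

lemma exists_smul_of_ι_mul_ι_eq_zero {a w : V} (ha : a ≠ 0) (h : ι ℂ a * ι ℂ w = 0) :
    ∃ r : ℂ, w = r • a := by
  obtain ⟨d, hd⟩ := exists_dual_eq_one ha
  refine ⟨d w, ExteriorAlgebra.ι_leftInverse.injective (?_ : ι ℂ w = ι ℂ (d w • a))⟩
  have h' := eq_ι_mul_wedgeContract hd h
  rwa [wedgeContract_ι, ← Algebra.commutes, ← Algebra.smul_def, ← map_smul] at h'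

/-- Write x = a∧w and choose d with d(a) = 1, d(b) = 0. Contracting b∧a∧w = 0 with d gives b∧(w −
d(w)a) = 0. -/
lemma exists_eq_smul_of_ι_mul_eq_zero {P : Submodule ℂ V} {a b : V} (ha : a ≠ 0)
    (hb : ∀ r : ℂ, b ≠ r • a) {x : ExteriorAlgebra ℂ V} (hx : x ∈ wedgePow P 2)
    (hax : ι ℂ a * x = 0) (hbx : ι ℂ b * x = 0) : ∃ r : ℂ, x = r • (ι ℂ a * ι ℂ b) := by
  obtain ⟨w, -, rfl⟩ := exists_ι_mul_ι_eq ha hx hax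
  obtain ⟨d, hd, hdw⟩ := exists_dual_eq_one_of_notMem (Q := Submodule.span ℂ {b}) (v := a) (by
    rw [Submodule.mem_span_singleton]
    rintro ⟨r, rfl⟩
    have hr : r ≠ 0 := by rintro rfl; simp at ha
    exact hb r⁻¹ (by rw [smul_smul, inv_mul_cancel₀ hr, one_smul]))
  have hdb := hdw b (Submodule.mem_span_singleton_self b)
  have hb0 : b ≠ 0 := by rintro rfl; exact hb 0 (by simp)
  have h := congr(wedgeContract d $hbx)
  rw [wedgeContract_ι_mul, hdb, zero_smul, zero_sub, map_zero, neg_eq_zero, wedgeContract_ι_mul, hd,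
    one_smul, wedgeContract_ι, mul_sub, sub_eq_zero, ← Algebra.commutes, ← Algebra.smul_def,
    mul_smul_comm] at h
  have h2 : ι ℂ b * ι ℂ (w - d w • a) = 0 := by
    rw [map_sub, mul_sub, h, map_smul, mul_smul_comm, sub_self]
  obtain ⟨r, hr⟩ := exists_smul_of_ι_mul_ι_eq_zero hb0 h2
  refine ⟨r, ?_⟩
  rw [sub_eq_iff_eq_add.1 hr, map_add, map_smul, map_smul, mul_add, mul_smul_comm, mul_smul_comm,
    ι_mul_self, smul_zero, add_zero]

lemma exists_dual_extending_coord {κ : Type*} {P : Submodule ℂ V} (e : Module.Basis κ ℂ P) :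
    ∃ d : κ → Module.Dual ℂ V, ∀ i, ∀ v : P, d i v = e.repr v i := by
  choose d hd using fun i => LinearMap.exists_extend (e.coord i)
  exact ⟨d, fun i v => by simpa using congr($(hd i) v)⟩

/-- Euler's identity in degree two. -/
lemma sum_ι_mul_wedgeContract {κ : Type*} [Fintype κ] {P : Submodule ℂ V}
    (e : Module.Basis κ ℂ P) {d : κ → Module.Dual ℂ V} (hd : ∀ i, ∀ v : P, d i v = e.repr v i)
    {x : ExteriorAlgebra ℂ V} (hx : x ∈ wedgePow P 2) :
    ∑ i, ι ℂ (e i : V) * wedgeContract (d i) x = (2 : ℂ) • x := by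
  have key : ∀ v ∈ P, ∑ i, d i v • ι ℂ (e i : V) = ι ℂ v := fun v hv => by
    have := congr((ι ℂ (($(e.sum_repr ⟨v, hv⟩) : P) : V)))
    rw [← this]
    simp only [AddSubmonoidClass.coe_finsetSum, Submodule.coe_smul, map_sum, map_smul]
    exact Finset.sum_congr rfl fun i _ => by rw [hd i ⟨v, hv⟩]
  refine wedgePow_succ_induction (n := 1) (C := fun x =>
    ∑ i, ι ℂ (e i : V) * wedgeContract (d i) x = (2 : ℂ) • x)
    (fun x y hx hy => ?_) (fun v hv y hy => ?_) hx
  · simp only [map_add, mul_add, Finset.sum_add_distrib, hx, hy, smul_add]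
  · obtain ⟨w, hw, rfl⟩ := mem_wedgePow_one.1 hy
    calc _ = (∑ i, d i v • ι ℂ (e i : V)) * ι ℂ w - (∑ i, d i w • ι ℂ (e i : V)) * ι ℂ v := by
          rw [Finset.sum_mul, Finset.sum_mul, ← Finset.sum_sub_distrib]
          refine Finset.sum_congr rfl fun i _ => ?_
          rw [wedgeContract_ι_mul, wedgeContract_ι, mul_sub, mul_smul_comm, smul_mul_assoc,
            ← Algebra.commutes, ← Algebra.smul_def, mul_smul_comm, smul_mul_assoc]
      _ = _ := by rw [key v hv, key w hw, ι_mul_swap w v, sub_neg_eq_add, two_smul]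

lemma eq_zero_of_forall_wedgeContract_eq_zero {P : Submodule ℂ V} [FiniteDimensional ℂ P]
    {x : ExteriorAlgebra ℂ V} (hx : x ∈ wedgePow P 2)
    (h : ∀ d : Module.Dual ℂ V, wedgeContract d x = 0) : x = 0 := by
  obtain ⟨d, hd⟩ := exists_dual_extending_coord (Module.finBasis ℂ P)
  have := sum_ι_mul_wedgeContract _ hd hx
  simp only [h, mul_zero, Finset.sum_const_zero] at this
  exact (smul_eq_zero.1 this.symm).resolve_left two_ne_zero

/-- The Plücker relation `x ∧ x = 0` characterizes decomposable bivectors. -/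
lemma exists_ι_mul_ι_eq_of_mul_self_eq_zero {P : Submodule ℂ V} [FiniteDimensional ℂ P]
    {x : ExteriorAlgebra ℂ V} (hx : x ∈ wedgePow P 2)
    (hxx : x * x = 0) : ∃ v ∈ P, ∃ w ∈ P, x = ι ℂ v * ι ℂ w := by
  by_cases h0 : ∀ d : Module.Dual ℂ V, wedgeContract d x = 0
  · refine ⟨0, zero_mem _, 0, zero_mem _, ?_⟩
    rw [map_zero, zero_mul]
    exact eq_zero_of_forall_wedgeContract_eq_zero hx h0
  · push Not at h0
    obtain ⟨d, hd⟩ := h0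
    obtain ⟨z, hz, hdz⟩ := mem_wedgePow_one.1 (wedgeContract_mem d hx)
    have hz0 : z ≠ 0 := by rintro rfl; rw [map_zero] at hdz; exact hd hdz.symm
    -- Contracting x∧x = 0 gives 2 (d⌟x)∧x = 0, so the vector z = d⌟x divides x.
    have h := wedgeContract_mul_of_mem_two d hx x
    rw [hxx, map_zero, ← commute_of_mem_wedgePow_two hx, ← two_smul ℂ] at h
    have h2 : ι ℂ z * x = 0 := by
      rw [hdz, ← commute_of_mem_wedgePow_two hx]
      exact (smul_eq_zero.1 h.symm).resolve_left two_ne_zero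
    obtain ⟨w, hw, h3⟩ := exists_ι_mul_ι_eq hz0 hx h2
    exact ⟨z, hz, w, hw, h3⟩

/-- A skew-symmetric matrix of odd size is singular; a kernel vector of the matrix of x gives d,
normalised to take the value 1 on P. -/
lemma exists_wedgeContract_eq_zero_of_odd {P : Submodule ℂ V} [FiniteDimensional ℂ P]
    (hP : Odd (Module.finrank ℂ P)) {x : ExteriorAlgebra ℂ V} (hx : x ∈ wedgePow P 2) :
    ∃ d : Module.Dual ℂ V, wedgeContract d x = 0 ∧ ∃ w ∈ P, d w = 1 := by
  set n := Module.finrank ℂ P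
  let e := Module.finBasis ℂ P
  obtain ⟨d, hd⟩ := exists_dual_extending_coord e
  choose y hy hyx using fun i => mem_wedgePow_one.1 (wedgeContract_mem (d i) hx)
  let M : Matrix (Fin n) (Fin n) ℂ := Matrix.of fun i j => d j (y i)
  have hM : M.transpose = -M := by
    ext i j
    have h := CliffordAlgebra.contractLeft_comm (Q := (0 : QuadraticForm ℂ V)) (d i) (d j) x
    change wedgeContract (d i) (wedgeContract (d j) x) =
      -(wedgeContract (d j) (wedgeContract (d i) x)) at h
    rw [← hyx, ← hyx, wedgeContract_ι, wedgeContract_ι, ← map_neg] at h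
    exact (algebraMap ℂ (ExteriorAlgebra ℂ V)).injective h
  have hdet : M.det = 0 := by
    have h := M.det_transpose
    rw [hM, Matrix.det_neg, Fintype.card_fin, hP.neg_one_pow] at h
    linear_combination -h / 2
  obtain ⟨c, hc0, hc⟩ := Matrix.exists_vecMul_eq_zero_iff.2 hdet
  obtain ⟨k, hk⟩ := Function.ne_iff.1 hc0
  have hsum : ∑ i, c i • y i = 0 := by
    have hmem : ∑ i, c i • y i ∈ P := sum_mem fun i _ => P.smul_mem _ (hy i)
    have : (⟨_, hmem⟩ : P) = 0 := e.repr.injective (Finsupp.ext fun j => by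
      rw [← hd j ⟨_, hmem⟩]
      simpa [Matrix.vecMul, dotProduct, M] using congr_fun hc j)
    exact congr_arg Subtype.val this
  have hlin : ∀ z, wedgeContract (∑ i, c i • d i) z = ∑ i, c i • wedgeContract (d i) z := fun z => by
    simp [wedgeContract]
  refine ⟨(c k)⁻¹ • ∑ i, c i • d i, ?_, e k, (e k).2, ?_⟩
  · have h2 : wedgeContract ((c k)⁻¹ • ∑ i, c i • d i) x =
      (c k)⁻¹ • wedgeContract (∑ i, c i • d i) x := by simp [wedgeContract]
    rw [h2, hlin]
    simp only [← hyx, ← map_smul, ← map_sum, hsum, map_zero, smul_zero]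
  · simp only [LinearMap.smul_apply, LinearMap.sum_apply, hd, e.repr_self, Finsupp.single_apply]
    simpa using inv_mul_cancel₀ hk

/-- In dimension five, a pencil of bivectors with `x ∧ y = 0` contains a decomposable member. -/
lemma exists_decomposable_of_mul_eq_zero {P : Submodule ℂ V} [FiniteDimensional ℂ P]
    (hP : Module.finrank ℂ P = 5) {x y : ExteriorAlgebra ℂ V} (hx : x ∈ wedgePow P 2)
    (hy : y ∈ wedgePow P 2) (hxy : x * y = 0)
    (hdec : ∀ r s : ℂ, (r • x + s • y) * (r • x + s • y) = 0 → r • x + s • y = 0) :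
    x = 0 ∨ y = 0 := by
  by_contra! hne
  obtain ⟨hx0, hy0⟩ := hne
  have hxx : x * x ≠ 0 := fun h => hx0 (by simpa using hdec 1 0 (by simpa using h))
  have hyx : y * x = 0 := by rw [← commute_of_mem_wedgePow_two hx, hxy]
  obtain ⟨d, hdx, w, hw, hdw⟩ := exists_wedgeContract_eq_zero_of_odd (hP ▸ by decide) hx
  -- Contracting x∧y = 0 with d leaves x∧(d⌟y) = 0; a nonzero vector d⌟y would divide x and give x∧x
  -- = 0.
  have hdy : wedgeContract d y = 0 := by
    obtain ⟨z, hz, hzy⟩ := mem_wedgePow_one.1 (wedgeContract_mem d hy)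
    have h := wedgeContract_mul_of_mem_two d hx y
    rw [hxy, hdx, map_zero, zero_mul, zero_add, ← hzy, commute_of_mem_wedgePow_two hx] at h
    by_contra hz0
    rw [← hzy] at hz0
    refine hxx (mul_self_eq_zero_of_ι_mul_eq_zero (a := z) ?_ hx h.symm h.symm)
    rintro rfl; exact hz0 (map_zero _)
  -- An element of ⋀⁴P killed by d is recovered from w∧t ∈ ⋀⁵P, which is a line. Hence x∧x and y∧y
  -- are proportional.
  have key : ∀ t ∈ wedgePow P 4, wedgeContract d t = 0 → t = wedgeContract d (ι ℂ w * t) :=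
    fun t _ h => by rw [wedgeContract_ι_mul, hdw, h, one_smul, mul_zero, sub_zero]
  let e := Module.finBasisOfFinrankEq ℂ P hP
  obtain ⟨r, hr⟩ := exists_eq_smul_of_mem_wedgePow e
    (ι_mul_mem_wedgePow hw (mul_mem_wedgePow hx hx))
  obtain ⟨s, hs⟩ := exists_eq_smul_of_mem_wedgePow e
    (ι_mul_mem_wedgePow hw (mul_mem_wedgePow hy hy))
  have hxx' := key _ (mul_mem_wedgePow hx hx) (by
    rw [wedgeContract_mul_of_mem_two d hx, hdx, zero_mul, mul_zero, add_zero])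
  have hyy' := key _ (mul_mem_wedgePow hy hy) (by
    rw [wedgeContract_mul_of_mem_two d hy, hdy, zero_mul, mul_zero, add_zero])
  rw [hr, map_smul] at hxx'
  rw [hs, map_smul] at hyy'
  -- With α² = −s and β² = r the square of αx + βy vanishes, the cross terms being zero already.
  obtain ⟨α, hα⟩ := IsAlgClosed.exists_pow_nat_eq (-s) zero_lt_two
  obtain ⟨β, hβ⟩ := IsAlgClosed.exists_pow_nat_eq r zero_lt_two
  have hr0 : r ≠ 0 := by rintro rfl; exact hxx (by rw [hxx', zero_smul])
  have hβ0 : β ≠ 0 := by rintro rfl; exact hr0 (by rw [← hβ]; simp)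
  have hz := hdec α β (by
    simp only [mul_add, add_mul, smul_mul_assoc, mul_smul_comm, hxy, hyx, smul_zero, add_zero,
      zero_add]
    rw [hxx', hyy', smul_smul, smul_smul, smul_smul, smul_smul, ← add_smul,
      show α * α * r + β * β * s = α ^ 2 * r + β ^ 2 * s by ring, hα, hβ]
    rw [show -s * r + r * s = 0 by ring, zero_smul])
  have h := congr(x * $hz)
  rw [mul_add, mul_smul_comm, mul_smul_comm, hxy, smul_zero, add_zero, mul_zero] at h
  have hα0 : α = 0 := (smul_eq_zero.1 h).resolve_right hxx
  rw [hα0, zero_smul, zero_add] at hz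
  exact hy0 ((smul_eq_zero.1 hz).resolve_left hβ0)

end ExteriorContraction

/-! ### Parameter counts for families of quadratic forms in four variables -/

section Genericity

open MvPolynomial

/-- If the first coordinates of every point of a variety, with values in any field extension of
`ℂ`, are algebraically dependent, then a single nonzero polynomial vanishes on all of them. -/
lemma exists_polynomial_vanishing_on_projection {κ τ : Type} (E : Set (MvPolynomial (κ ⊕ τ) ℂ))
    (H : ∀ (K : Type) [Field K] [Algebra ℂ K] (p : κ ⊕ τ → K), (∀ f ∈ E, aeval p f = 0) →
      ¬ AlgebraicIndependent ℂ fun i => p (.inl i)) :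
    ∃ G : MvPolynomial κ ℂ, G ≠ 0 ∧ ∀ p : κ ⊕ τ → ℂ, (∀ f ∈ E, aeval p f = 0) →
      eval (fun i => p (.inl i)) G = 0 := by
  by_contra! hcon
  let S : Submonoid (MvPolynomial (κ ⊕ τ) ℂ) :=
    (nonZeroDivisors (MvPolynomial κ ℂ)).map (rename (R := ℂ) (Sum.inl : κ → κ ⊕ τ)).toRingHom.toMonoidHom
  have hdisj : Disjoint (Ideal.span E : Set (MvPolynomial (κ ⊕ τ) ℂ)) S := by
    rw [Set.disjoint_left]
    rintro _ hI ⟨G, hG, rfl⟩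
    obtain ⟨p, hp, hpG⟩ := hcon G (nonZeroDivisors.ne_zero hG)
    have : Ideal.span E ≤ RingHom.ker (aeval p : MvPolynomial (κ ⊕ τ) ℂ →ₐ[ℂ] ℂ).toRingHom :=
      Ideal.span_le.2 fun f hf => hp f hf
    have h := this hI
    refine hpG ?_
    have h2 : aeval p (rename (R := ℂ) (Sum.inl : κ → κ ⊕ τ) G) = 0 := h
    rwa [aeval_rename] at h2
  -- The fraction field of the quotient by a prime containing E and avoiding nonzero polynomials in
  -- the first coordinates is a point whose first coordinates are algebraically independent.
  obtain ⟨P, hP, hEP, hPS⟩ := Ideal.exists_le_prime_disjoint _ _ hdisj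
  refine H (FractionRing (MvPolynomial (κ ⊕ τ) ℂ ⧸ P))
    (fun i => algebraMap (MvPolynomial (κ ⊕ τ) ℂ ⧸ P) _ (Ideal.Quotient.mk P (X i))) ?_ ?_
  · intro f hf
    have h : aeval (fun i => algebraMap (MvPolynomial (κ ⊕ τ) ℂ ⧸ P)
        (FractionRing (MvPolynomial (κ ⊕ τ) ℂ ⧸ P)) (Ideal.Quotient.mk P (X i))) f =
        algebraMap _ _ (Ideal.Quotient.mkₐ ℂ P f) := by
      rw [← IsScalarTower.coe_toAlgHom' ℂ, ← AlgHom.comp_apply]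
      congr 1
      ext; simp
    rw [h, Ideal.Quotient.mkₐ_eq_mk, Ideal.Quotient.eq_zero_iff_mem.2 (hEP (Ideal.subset_span hf)),
      map_zero]
  · rw [algebraicIndependent_iff]
    intro G hG
    by_contra hG0
    have h : aeval (fun i => algebraMap (MvPolynomial (κ ⊕ τ) ℂ ⧸ P)
        (FractionRing (MvPolynomial (κ ⊕ τ) ℂ ⧸ P)) (Ideal.Quotient.mk P (X (.inl i)))) G =
        algebraMap _ _ (Ideal.Quotient.mkₐ ℂ P (rename Sum.inl G)) := by
      rw [← IsScalarTower.coe_toAlgHom' ℂ, ← AlgHom.comp_apply, ← AlgHom.comp_apply]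
      congr 1
      ext; simp
    rw [h, map_eq_zero_iff _ (IsFractionRing.injective _ _), Ideal.Quotient.mkₐ_eq_mk,
      Ideal.Quotient.eq_zero_iff_mem] at hG
    exact Set.disjoint_left.1 hPS hG ⟨G, mem_nonZeroDivisors_of_ne_zero hG0, rfl⟩

/-- L is the algebraic closure in K of the field generated by g; its transcendence degree is at most
the number of generators. Closure under square roots is all the algebraicity used later. -/
lemma exists_intermediateField_card_lt {K : Type*} [Field K] [Algebra ℂ K] {κ : Type*} [Finite κ]
    (g : κ → K) :
    ∃ L : IntermediateField ℂ K, (∀ i, g i ∈ L) ∧ (∀ z, z ^ 2 ∈ L → z ∈ L) ∧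
      ∀ (τ : Type) (y : τ → K), Nat.card κ < Nat.card τ → (∀ i, y i ∈ L) →
        ¬ AlgebraicIndependent ℂ y := by
  let A := Algebra.adjoin ℂ (Set.range g)
  let L₀ : Subalgebra ℂ K := (Subalgebra.algebraicClosure A K).restrictScalars ℂ
  have hmem : ∀ z, z ∈ L₀ ↔ IsAlgebraic A z := fun z => Iff.rfl
  refine ⟨L₀.toIntermediateField fun x hx => (hmem _).2 ((hmem _).1 hx).inv, ?_, ?_, ?_⟩
  · intro i
    exact isAlgebraic_algebraMap (⟨g i, Algebra.subset_adjoin ⟨i, rfl⟩⟩ : A)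
  · intro z hz
    exact IsAlgebraic.of_pow two_pos ((hmem _).1 hz)
  · intro τ y hcard hy hind
    have h1 : (AlgebraicIndependent.matroid ℂ K).Indep (Set.range y) :=
      AlgebraicIndependent.matroid_indep_iff.2 hind.to_subtype_range
    have h2 : Set.range y ⊆ (AlgebraicIndependent.matroid ℂ K).closure (Set.range g) := by
      rw [AlgebraicIndependent.matroid_closure_eq]
      rintro _ ⟨i, rfl⟩
      exact hy i
    have h3 := (h1.encard_le_eRk_of_subset h2).trans
      ((Matroid.eRk_closure_eq _ _).le.trans (Matroid.eRk_le_encard _ _))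
    have hfin : Finite τ := Nat.finite_of_card_ne_zero (by omega)
    rw [← (Set.finite_range y).cast_ncard_eq, ← (Set.finite_range g).cast_ncard_eq, Nat.cast_le,
      Set.ncard_range_of_injective hind.injective] at h3
    have h4 : (Set.range g).ncard ≤ Nat.card κ := Finite.card_range_le g
    omega

/-- The dimension count in algebraic form: coordinates obtained from fewer parameters by field
operations and square roots are algebraically dependent. -/
lemma exists_polynomial_vanishing_of_parameters {κ τ : Type} (E : Set (MvPolynomial (κ ⊕ τ) ℂ))
    (ρ : Type) [Finite ρ] (hρ : Nat.card ρ < Nat.card κ)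
    (H : ∀ (K : Type) [Field K] [Algebra ℂ K] (p : κ ⊕ τ → K), (∀ f ∈ E, aeval p f = 0) →
      ∃ g : ρ → K, ∀ L : IntermediateField ℂ K, (∀ i, g i ∈ L) → (∀ z, z ^ 2 ∈ L → z ∈ L) →
        ∀ i, p (.inl i) ∈ L) :
    ∃ G : MvPolynomial κ ℂ, G ≠ 0 ∧ ∀ p : κ ⊕ τ → ℂ, (∀ f ∈ E, aeval p f = 0) →
      eval (fun i => p (.inl i)) G = 0 := by
  refine exists_polynomial_vanishing_on_projection E fun K _ _ p hp => ?_
  obtain ⟨g, hg⟩ := H K p hp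
  obtain ⟨L, hgL, hL, hdep⟩ := exists_intermediateField_card_lt g
  exact hdep κ _ hρ (hg L hgL hL)

/-- The linear form `w ↦ m(a, w)` of a bilinear form `m` with complex coefficients. -/
def formRow {R : Type*} [CommRing R] [Algebra ℂ R] (m : Fin 4 → Fin 4 → ℂ) (a : Fin 4 → R)
    (j : Fin 4) : R :=
  ∑ p, algebraMap ℂ R (m p j) * a p

/-- The value `m(a, w)` of a bilinear form `m` with complex coefficients. -/
def formVal {R : Type*} [CommRing R] [Algebra ℂ R] (m : Fin 4 → Fin 4 → ℂ) (a w : Fin 4 → R) : R :=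
  ∑ j, formRow m a j * w j

lemma map_formRow {R R' : Type*} [CommRing R] [Algebra ℂ R] [CommRing R'] [Algebra ℂ R']
    (f : R →ₐ[ℂ] R') (m : Fin 4 → Fin 4 → ℂ) (a : Fin 4 → R) (j : Fin 4) :
    f (formRow m a j) = formRow m (fun p => f (a p)) j := by
  simp [formRow]

lemma map_formVal {R R' : Type*} [CommRing R] [Algebra ℂ R] [CommRing R'] [Algebra ℂ R']
    (f : R →ₐ[ℂ] R') (m : Fin 4 → Fin 4 → ℂ) (a w : Fin 4 → R) :
    f (formVal m a w) = formVal m (fun p => f (a p)) fun p => f (w p) := by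
  simp [formVal, map_formRow]

lemma formRow_mem {K : Type*} [Field K] [Algebra ℂ K] (L : IntermediateField ℂ K)
    (m : Fin 4 → Fin 4 → ℂ) {a : Fin 4 → K} (ha : ∀ p, a p ∈ L) (j : Fin 4) : formRow m a j ∈ L :=
  sum_mem fun p _ => mul_mem (L.algebraMap_mem _) (ha p)

lemma formVal_mem {K : Type*} [Field K] [Algebra ℂ K] (L : IntermediateField ℂ K)
    (m : Fin 4 → Fin 4 → ℂ) {a w : Fin 4 → K} (ha : ∀ p, a p ∈ L) (hw : ∀ p, w p ∈ L) :
    formVal m a w ∈ L :=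
  sum_mem fun j _ => mul_mem (formRow_mem L m ha j) (hw j)

/-- The symmetric matrix `∑ wᵢ mᵢ(a, ·) mᵢ(a, ·)`. -/
def pencilForm {R : Type*} [CommRing R] [Algebra ℂ R] (m : Fin 6 → Fin 4 → Fin 4 → ℂ)
    (w : Fin 6 → R) (a : Fin 4 → R) (j k : Fin 4) : R :=
  ∑ i, w i * (formRow (m i) a j * formRow (m i) a k)

lemma map_pencilForm {R R' : Type*} [CommRing R] [Algebra ℂ R] [CommRing R'] [Algebra ℂ R']
    (f : R →ₐ[ℂ] R') (m : Fin 6 → Fin 4 → Fin 4 → ℂ) (w : Fin 6 → R) (a : Fin 4 → R)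
    (j k : Fin 4) :
    f (pencilForm m w a j k) = pencilForm m (fun p => f (w p)) (fun p => f (a p)) j k := by
  simp [pencilForm, map_formRow]

lemma pencilForm_mem {K : Type*} [Field K] [Algebra ℂ K] (L : IntermediateField ℂ K)
    (m : Fin 6 → Fin 4 → Fin 4 → ℂ) {w : Fin 6 → K} (hw : ∀ i, w i ∈ L) {a : Fin 4 → K}
    (ha : ∀ p, a p ∈ L) (j k : Fin 4) : pencilForm m w a j k ∈ L :=
  sum_mem fun i _ => mul_mem (hw i) (mul_mem (formRow_mem L _ ha j) (formRow_mem L _ ha k))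

/-- The dimension of the space of quadratic forms on P; every parameter count must stay below it. -/
lemma card_symIdx : Nat.card (Sym2 (Fin 4)) = 10 := by
  rw [Nat.card_eq_fintype_card, Sym2.card]; rfl

/-- Forms congruent to a form of rank at most one modulo the forms `∑ (c - γᵢ)⁻¹ mᵢ(a, ·)²`. -/
lemma exists_polynomial_pencilForm_add_sq (m : Fin 6 → Fin 4 → Fin 4 → ℂ) (γ : Fin 6 → ℂ) :
    ∃ G : MvPolynomial (Sym2 (Fin 4)) ℂ, G ≠ 0 ∧ ∀ (S : Sym2 (Fin 4) → ℂ) (a l : Fin 4 → ℂ) (c : ℂ),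
      (∀ i, c ≠ γ i) →
      (∀ j k, S s(j, k) = pencilForm m (fun i => (c - γ i)⁻¹) a j k + l j * l k) →
      eval S G = 0 := by
  let Xa : Fin 4 → MvPolynomial (Sym2 (Fin 4) ⊕ (Fin 4 ⊕ Fin 4 ⊕ Unit ⊕ Fin 6)) ℂ :=
    fun p => X (.inr (.inl p))
  let Xl : Fin 4 → MvPolynomial (Sym2 (Fin 4) ⊕ (Fin 4 ⊕ Fin 4 ⊕ Unit ⊕ Fin 6)) ℂ :=
    fun p => X (.inr (.inr (.inl p)))
  let Xc : MvPolynomial (Sym2 (Fin 4) ⊕ (Fin 4 ⊕ Fin 4 ⊕ Unit ⊕ Fin 6)) ℂ :=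
    X (.inr (.inr (.inr (.inl ()))))
  let Xw : Fin 6 → MvPolynomial (Sym2 (Fin 4) ⊕ (Fin 4 ⊕ Fin 4 ⊕ Unit ⊕ Fin 6)) ℂ :=
    fun p => X (.inr (.inr (.inr (.inr p))))
  -- The parameters are a, l and c, 4 + 4 + 1 = 9 in number. The unknowns `Xw` stand for (c − γᵢ)⁻¹,
  -- to keep the equations polynomial; they are rational in c.
  have key := fun H => exists_polynomial_vanishing_of_parameters
    (κ := Sym2 (Fin 4)) (τ := Fin 4 ⊕ Fin 4 ⊕ Unit ⊕ Fin 6)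
    ((Set.range fun jk : Fin 4 × Fin 4 =>
      X (.inl s(jk.1, jk.2)) - (pencilForm m Xw Xa jk.1 jk.2 + Xl jk.1 * Xl jk.2)) ∪
      Set.range fun i => Xw i * (Xc - C (γ i)) - 1) (Fin 4 ⊕ Fin 4 ⊕ Unit)
    (by rw [card_symIdx]; simp) H
  obtain ⟨G, hG0, hG⟩ := key (by
    intro K _ _ p hp
    refine ⟨Sum.elim (fun i => p (.inr (.inl i))) (Sum.elim (fun i => p (.inr (.inr (.inl i))))
      fun _ => p (.inr (.inr (.inr (.inl ()))))), fun L hL _ z => ?_⟩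
    have ha : ∀ i, p (.inr (.inl i)) ∈ L := fun i => hL (.inl i)
    have hl : ∀ i, p (.inr (.inr (.inl i))) ∈ L := fun i => hL (.inr (.inl i))
    have hc : p (.inr (.inr (.inr (.inl ())))) ∈ L := hL (.inr (.inr ()))
    have hw : ∀ i, p (.inr (.inr (.inr (.inr i)))) ∈ L := fun i => by
      have h := hp _ (Or.inr ⟨i, rfl⟩)
      simp only [map_sub, map_mul, aeval_X, map_one, Xw, Xc, aeval_C, sub_eq_zero] at h
      rw [eq_inv_of_mul_eq_one_left h]
      exact inv_mem (sub_mem hc (L.algebraMap_mem _))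
    induction z using Sym2.ind with
    | _ j k =>
      have h := hp _ (Or.inl ⟨(j, k), rfl⟩)
      simp only [map_sub, map_add, map_mul, aeval_X, Xw, Xa, Xl, map_pencilForm, sub_eq_zero] at h
      rw [h]
      exact add_mem (pencilForm_mem L m hw ha j k) (mul_mem (hl j) (hl k)))
  refine ⟨G, hG0, fun S a l c hc hS => ?_⟩
  refine hG (Sum.elim S (Sum.elim a (Sum.elim l (Sum.elim (fun _ => c) fun i => (c - γ i)⁻¹)))) ?_
  rintro _ (⟨⟨j, k⟩, rfl⟩ | ⟨i, rfl⟩)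
  · simp only [map_sub, map_add, map_mul, aeval_X, Xw, Xa, Xl, map_pencilForm, sub_eq_zero]
    exact hS j k
  · simp [Xw, Xc, sub_ne_zero.2 (hc i)]

/-- The weights are fixed, so only the eight parameters a and l remain. The constants `m₀` and `ε`
serve two cases at once: `m₀ = 0`, `ε = 1/2` gives l², and `ε = 0` gives the symmetrised product of
m₀(a, ·) with l. -/
lemma exists_polynomial_pencilForm_add_mul (m : Fin 6 → Fin 4 → Fin 4 → ℂ) (w : Fin 6 → ℂ)
    (m₀ : Fin 4 → Fin 4 → ℂ) (ε : ℂ) :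
    ∃ G : MvPolynomial (Sym2 (Fin 4)) ℂ, G ≠ 0 ∧ ∀ (S : Sym2 (Fin 4) → ℂ) (a l : Fin 4 → ℂ),
      (∀ j k, S s(j, k) = pencilForm m w a j k + ((formRow m₀ a j + ε * l j) * l k +
        l j * (formRow m₀ a k + ε * l k))) → eval S G = 0 := by
  let Xa : Fin 4 → MvPolynomial (Sym2 (Fin 4) ⊕ (Fin 4 ⊕ Fin 4)) ℂ := fun p => X (.inr (.inl p))
  let Xl : Fin 4 → MvPolynomial (Sym2 (Fin 4) ⊕ (Fin 4 ⊕ Fin 4)) ℂ := fun p => X (.inr (.inr p))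
  have key := fun H => exists_polynomial_vanishing_of_parameters
    (κ := Sym2 (Fin 4)) (τ := Fin 4 ⊕ Fin 4)
    (Set.range fun jk : Fin 4 × Fin 4 =>
      X (.inl s(jk.1, jk.2)) - (pencilForm m (fun i => C (w i)) Xa jk.1 jk.2 +
        ((formRow m₀ Xa jk.1 + C ε * Xl jk.1) * Xl jk.2 +
          Xl jk.1 * (formRow m₀ Xa jk.2 + C ε * Xl jk.2)))) (Fin 4 ⊕ Fin 4)
    (by rw [card_symIdx]; simp) H
  obtain ⟨G, hG0, hG⟩ := key (by
    intro K _ _ p hp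
    refine ⟨fun i => p (.inr i), fun L hL _ z => ?_⟩
    have ha : ∀ i, p (.inr (.inl i)) ∈ L := fun i => hL (.inl i)
    have hl : ∀ i, p (.inr (.inr i)) ∈ L := fun i => hL (.inr i)
    induction z using Sym2.ind with
    | _ j k =>
      have h := hp _ ⟨(j, k), rfl⟩
      simp only [map_sub, map_add, map_mul, aeval_X, Xa, Xl, map_pencilForm, map_formRow, aeval_C,
        sub_eq_zero] at h
      rw [h]
      have hr : ∀ j, formRow m₀ (fun i => p (.inr (.inl i))) j + algebraMap ℂ K ε * p (.inr (.inr j))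
          ∈ L := fun j => add_mem (formRow_mem L m₀ ha j) (mul_mem (L.algebraMap_mem _) (hl j))
      exact add_mem (pencilForm_mem L m (fun i => L.algebraMap_mem _) ha j k)
        (add_mem (mul_mem (hr j) (hl k)) (mul_mem (hl j) (hr k))))
  refine ⟨G, hG0, fun S a l hS => ?_⟩
  refine hG (Sum.elim S (Sum.elim a l)) ?_
  rintro _ ⟨⟨j, k⟩, rfl⟩
  simp only [map_sub, map_add, map_mul, aeval_X, Xa, Xl, map_pencilForm, map_formRow, aeval_C,
    sub_eq_zero]
  exact hS j k

/-- The constants `mᵢ` describe a self-dual family: contraction identities for a basis of bivectors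
in dimension four which is orthonormal for the wedge product. -/
structure IsOrthonormalBivectorFrame (m : Fin 6 → Fin 4 → Fin 4 → ℂ) (d : Fin 6 → Fin 4 → Fin 4 → ℂ) :
    Prop where
  antisymm : ∀ p q r s, ∑ i, m i p q * m i r s = -∑ i, m i r q * m i p s
  dual : ∀ p q r s, ∑ i, d i p q * m i r s =
    (if p = r then 1 else 0) * (if q = s then 1 else 0) -
      (if q = r then 1 else 0) * (if p = s then 1 else 0)

lemma sum_rotate {M κ τ ρ : Type*} [AddCommMonoid M] [Fintype κ] [Fintype τ] [Fintype ρ]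
    (F : κ → τ → ρ → M) : ∑ i, ∑ p, ∑ r, F i p r = ∑ p, ∑ r, ∑ i, F i p r :=
  Finset.sum_comm.trans (Finset.sum_congr rfl fun _ _ => Finset.sum_comm)

/-- By `antisymm`, exchanging the two copies of a changes the sign, so the sum equals its own
negative. -/
lemma IsOrthonormalBivectorFrame.sum_formRow_mul {m d : Fin 6 → Fin 4 → Fin 4 → ℂ}
    (h : IsOrthonormalBivectorFrame m d) {K : Type*} [Field K] [Algebra ℂ K] (a : Fin 4 → K)
    (q s : Fin 4) : ∑ i, formRow (m i) a q * formRow (m i) a s = 0 := by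
  have : CharZero K := charZero_of_injective_algebraMap (algebraMap ℂ K).injective
  have e1 : ∑ i, formRow (m i) a q * formRow (m i) a s = ∑ p, ∑ r,
      algebraMap ℂ K (∑ i, m i p q * m i r s) * (a p * a r) := by
    simp only [formRow, Finset.mul_sum, map_sum, Finset.sum_mul, map_mul]
    rw [sum_rotate, Finset.sum_comm]
    exact Finset.sum_congr rfl fun p _ => Finset.sum_congr rfl fun r _ =>
      Finset.sum_congr rfl fun i _ => by ring
  have e2 : ∑ i, formRow (m i) a q * formRow (m i) a s =
      -∑ i, formRow (m i) a q * formRow (m i) a s := by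
    conv_lhs => rw [e1, Finset.sum_comm]
    rw [e1, ← Finset.sum_neg_distrib]
    refine Finset.sum_congr rfl fun p _ => ?_
    rw [← Finset.sum_neg_distrib]
    refine Finset.sum_congr rfl fun r _ => ?_
    rw [h.antisymm r q p s, map_neg]
    ring
  exact self_eq_neg.1 e2

/-- The pairing of a∧x with a∧y, computed in the orthonormal frame. -/
lemma IsOrthonormalBivectorFrame.isotropic {m d : Fin 6 → Fin 4 → Fin 4 → ℂ}
    (h : IsOrthonormalBivectorFrame m d) {K : Type*} [Field K] [Algebra ℂ K] (a x y : Fin 4 → K) :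
    ∑ i, formVal (m i) a x * formVal (m i) a y = 0 := by
  calc _ = ∑ q, ∑ s, (∑ i, formRow (m i) a q * formRow (m i) a s) * (x q * y s) := by
        simp only [formVal, Finset.mul_sum, Finset.sum_mul]
        rw [sum_rotate, Finset.sum_comm]
        exact Finset.sum_congr rfl fun p _ => Finset.sum_congr rfl fun r _ =>
          Finset.sum_congr rfl fun i _ => by ring
    _ = 0 := by simp [h.sum_formRow_mul]

/-- Recovers the Plücker coordinates of a∧x from its coefficients in the frame. -/
lemma IsOrthonormalBivectorFrame.sum_dual_mul_formVal {m d : Fin 6 → Fin 4 → Fin 4 → ℂ}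
    (h : IsOrthonormalBivectorFrame m d) {K : Type*} [Field K] [Algebra ℂ K] (a x : Fin 4 → K)
    (p q : Fin 4) :
    ∑ i, algebraMap ℂ K (d i p q) * formVal (m i) a x = a p * x q - a q * x p := by
  calc _ = ∑ r, ∑ s, algebraMap ℂ K (∑ i, d i p q * m i r s) * (a r * x s) := by
        simp only [formVal, formRow, Finset.mul_sum, Finset.sum_mul, map_sum, map_mul]
        rw [sum_rotate, Finset.sum_comm]
        exact Finset.sum_congr rfl fun p _ => Finset.sum_congr rfl fun r _ =>
          Finset.sum_congr rfl fun i _ => by ring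
    _ = _ := by
        simp only [h.dual, map_sub, map_mul, sub_mul, Finset.sum_sub_distrib]
        congr 1 <;> simp [apply_ite (algebraMap ℂ K)]

/-- Solving for the squares: three quadratic relations with distinct weights determine the first
coordinates of a point in terms of the last ones. -/
lemma mem_of_sum_mul_sq_eq_zero {K : Type*} [Field K] [Algebra ℂ K] {L : IntermediateField ℂ K}
    (hL : ∀ z, z ^ 2 ∈ L → z ∈ L) {γ : Fin 6 → ℂ} (hγ : Function.Injective γ) {X : Fin 6 → K}
    (hX : ∀ i : Fin 3, X (Fin.natAdd 3 i) ∈ L)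
    (h : ∀ k < 3, ∑ i, algebraMap ℂ K (γ i) ^ k * X i ^ 2 = 0) (i : Fin 6) : X i ∈ L := by
  -- The combination Σ Xₙ²(γₙ − γⱼ)(γₙ − γₖ) = 0 of the three relations removes Xⱼ and Xₖ, leaving
  -- Xᵢ² in terms of the last three coordinates.
  have key : ∀ i j k : Fin 6, i ≠ j → i ≠ k → X i ^ 2 * ((algebraMap ℂ K (γ i) - algebraMap ℂ K (γ j)) * (algebraMap ℂ K (γ i) - algebraMap ℂ K (γ k))) ∈ L → X i ∈ L := by
    intro i j k hij hik hm
    refine hL _ ?_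
    have h0 : (algebraMap ℂ K (γ i) - algebraMap ℂ K (γ j)) * (algebraMap ℂ K (γ i) - algebraMap ℂ K (γ k)) ≠ 0 := by
      refine mul_ne_zero ?_ ?_ <;> rw [sub_ne_zero] <;> intro h <;>
        have := hγ ((algebraMap ℂ K).injective h) <;> contradiction
    rw [← mul_div_cancel_right₀ (X i ^ 2) h0]
    exact div_mem hm (mul_mem (sub_mem (L.algebraMap_mem _) (L.algebraMap_mem _))
      (sub_mem (L.algebraMap_mem _) (L.algebraMap_mem _)))
  have h0 := h 0 (by norm_num)
  have h1 := h 1 (by norm_num)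
  have h2 := h 2 (by norm_num)
  have hX3 : X 3 ∈ L := hX 0
  have hX4 : X 4 ∈ L := hX 1
  have hX5 : X 5 ∈ L := hX 2
  have tail : ∀ j k : Fin 6, -(X 3 ^ 2 * ((algebraMap ℂ K (γ 3) - algebraMap ℂ K (γ j)) *
      (algebraMap ℂ K (γ 3) - algebraMap ℂ K (γ k))) + X 4 ^ 2 * ((algebraMap ℂ K (γ 4) -
      algebraMap ℂ K (γ j)) * (algebraMap ℂ K (γ 4) - algebraMap ℂ K (γ k))) + X 5 ^ 2 *
      ((algebraMap ℂ K (γ 5) - algebraMap ℂ K (γ j)) * (algebraMap ℂ K (γ 5) -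
      algebraMap ℂ K (γ k)))) ∈ L := by
    intro j k
    have hs : ∀ i j, algebraMap ℂ K (γ i) - algebraMap ℂ K (γ j) ∈ L := fun i j =>
      sub_mem (L.algebraMap_mem _) (L.algebraMap_mem _)
    refine neg_mem (add_mem (add_mem ?_ ?_) ?_) <;>
    exact mul_mem (pow_mem ‹_› 2) (mul_mem (hs _ _) (hs _ _))
  simp only [Fin.sum_univ_six, pow_zero, one_mul, pow_one] at h0 h1 h2
  fin_cases i
  · refine key 0 1 2 (by decide) (by decide) ?_
    convert tail 1 2 using 1
    linear_combination h2 - (algebraMap ℂ K (γ 1) + algebraMap ℂ K (γ 2)) * h1 +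
      algebraMap ℂ K (γ 1) * algebraMap ℂ K (γ 2) * h0
  · refine key 1 0 2 (by decide) (by decide) ?_
    convert tail 0 2 using 1
    linear_combination h2 - (algebraMap ℂ K (γ 0) + algebraMap ℂ K (γ 2)) * h1 +
      algebraMap ℂ K (γ 0) * algebraMap ℂ K (γ 2) * h0
  · refine key 2 0 1 (by decide) (by decide) ?_
    convert tail 0 1 using 1
    linear_combination h2 - (algebraMap ℂ K (γ 0) + algebraMap ℂ K (γ 1)) * h1 +
      algebraMap ℂ K (γ 0) * algebraMap ℂ K (γ 1) * h0
  · exact hX3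
  · exact hX4
  · exact hX5

/-- Solving two linear systems `a ∧ x = g`, `a ∧ y = h` for `a`. -/
lemma mem_of_wedge_mem {K : Type*} [Field K] [Algebra ℂ K] {L : IntermediateField ℂ K}
    {a x y : Fin 4 → K} (hx : ∀ i, x i ∈ L) (hy : ∀ i, y i ∈ L)
    (hax : ∀ p q, a p * x q - a q * x p ∈ L) (hay : ∀ p q, a p * y q - a q * y p ∈ L) {p q : Fin 4}
    (hD : x p * y q - x q * y p ≠ 0) (r : Fin 4) : a r ∈ L := by
  have hDL : x p * y q - x q * y p ∈ L :=
    sub_mem (mul_mem (hx _) (hy _)) (mul_mem (hx _) (hy _))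
  have hap : a p ∈ L := by
    have : a p = -((a p * x q - a q * x p) * y p - (a p * y q - a q * y p) * x p) /
        (x p * y q - x q * y p) := by
      rw [eq_div_iff hD]; ring
    rw [this]
    exact div_mem (neg_mem (sub_mem (mul_mem (hax _ _) (hy _)) (mul_mem (hay _ _) (hx _)))) hDL
  by_cases hxp : x p = 0
  · have hyp : y p ≠ 0 := by
      rintro hyp; rw [hxp, hyp, zero_mul, mul_zero, sub_zero] at hD; exact hD rfl
    have : a r = (a p * y r - (a p * y r - a r * y p)) / y p := by
      rw [eq_div_iff hyp]; ring
    rw [this]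
    exact div_mem (sub_mem (mul_mem hap (hy _)) (hay _ _)) (hy _)
  · have : a r = (a p * x r - (a p * x r - a r * x p)) / x p := by
      rw [eq_div_iff hxp]; ring
    rw [this]
    exact div_mem (sub_mem (mul_mem hap (hx _)) (hax _ _)) (hx _)

/-- The condition for `⋀³`-decomposability: `S a = a ∧ x ∧ y` with `a ∧ y = u (a ∧ x)`. -/
lemma exists_polynomial_decomposable {m d : Fin 6 → Fin 4 → Fin 4 → ℂ}
    (hm : IsOrthonormalBivectorFrame m d) {γ : Fin 6 → ℂ} (hγ : Function.Injective γ)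
    (i₀ p q : Fin 4) :
    ∃ G : MvPolynomial (Sym2 (Fin 4)) ℂ, G ≠ 0 ∧ ∀ (S : Sym2 (Fin 4) → ℂ) (a x y : Fin 4 → ℂ),
      a i₀ = 1 → x i₀ = 0 → y i₀ = 0 → x p * y q - x q * y p ≠ 0 →
      (∀ i, formVal (m i) a y = γ i * formVal (m i) a x) →
      (∀ w, ∑ k, S s(w, k) * a k = ∑ i, formVal (m i) (Pi.single w 1) a * formVal (m i) x y) →
      eval S G = 0 := by
  let T := Sym2 (Fin 4) ⊕ (Fin 4 ⊕ Fin 4 ⊕ Fin 4 ⊕ Unit)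
  let Xa : Fin 4 → MvPolynomial T ℂ := fun i => X (.inr (.inl i))
  let Xx : Fin 4 → MvPolynomial T ℂ := fun i => X (.inr (.inr (.inl i)))
  let Xy : Fin 4 → MvPolynomial T ℂ := fun i => X (.inr (.inr (.inr (.inl i))))
  -- Inverse of the minor x_p y_q − x_q y_p, so that its nonvanishing becomes an equation.
  let Xz : MvPolynomial T ℂ := X (.inr (.inr (.inr (.inr ()))))
  let E : Set (MvPolynomial T ℂ) := {Xa i₀ - 1, Xx i₀, Xy i₀,
    Xz * (Xx p * Xy q - Xx q * Xy p) - 1} ∪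
    (Set.range fun i => formVal (m i) Xa Xy - C (γ i) * formVal (m i) Xa Xx) ∪
    Set.range fun w => ∑ k, X (.inl s(w, k)) * Xa k -
      ∑ i, formVal (m i) (Pi.single w 1) Xa * formVal (m i) Xx Xy
  have hsingle : ∀ (K : Type) [Field K] [Algebra ℂ K] (f : MvPolynomial T ℂ →ₐ[ℂ] K) (w : Fin 4),
      (fun i => f ((Pi.single w 1 : Fin 4 → MvPolynomial T ℂ) i)) = Pi.single w 1 := by
    intro K _ _ f w
    ext i
    by_cases h : i = w
    · subst h; simp
    · simp [h]
  -- Nine parameters: three frame coefficients of a∧x and the six entries of S outside row and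
  -- column i₀.
  have hcard : Nat.card (Fin 3 ⊕ Sym2 {j : Fin 4 // j ≠ i₀}) < Nat.card (Sym2 (Fin 4)) := by
    rw [card_symIdx, Nat.card_sum, Nat.card_eq_fintype_card, Nat.card_eq_fintype_card, Sym2.card]
    simp [Nat.choose]
  obtain ⟨G, hG0, hG⟩ := exists_polynomial_vanishing_of_parameters E
    (Fin 3 ⊕ Sym2 {j : Fin 4 // j ≠ i₀}) hcard (by
    intro K _ _ v hv
    set a : Fin 4 → K := fun i => v (.inr (.inl i)) with ha
    set x : Fin 4 → K := fun i => v (.inr (.inr (.inl i))) with hx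
    set y : Fin 4 → K := fun i => v (.inr (.inr (.inr (.inl i)))) with hy
    have ha0 : a i₀ = 1 := by
      have h := hv _ (.inl (.inl (.inl rfl)))
      simpa [Xa, sub_eq_zero] using h
    have hx0 : x i₀ = 0 := by
      have h := hv _ (.inl (.inl (.inr (.inl rfl))))
      simpa [Xx] using h
    have hy0 : y i₀ = 0 := by
      have h := hv _ (.inl (.inl (.inr (.inr (.inl rfl)))))
      simpa [Xy] using h
    have hD : x p * y q - x q * y p ≠ 0 := by
      have h := hv _ (.inl (.inl (.inr (.inr (.inr rfl)))))
      simp only [map_sub, map_mul, aeval_X, map_one, Xx, Xy, Xz, sub_eq_zero] at h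
      exact right_ne_zero_of_mul_eq_one h
    have hu : ∀ i, formVal (m i) a y = algebraMap ℂ K (γ i) * formVal (m i) a x := fun i => by
      have h := hv _ (.inl (.inr ⟨i, rfl⟩))
      simpa only [map_sub, map_mul, aeval_X, aeval_C, map_formVal, Xx, Xy, Xa, sub_eq_zero] using h
    have hS : ∀ w, ∑ k, v (.inl s(w, k)) * a k =
        ∑ i, formVal (m i) (Pi.single w 1) a * formVal (m i) x y := fun w => by
      have h := hv _ (.inr ⟨w, rfl⟩)
      simpa only [map_sub, map_sum, map_mul, aeval_X, map_formVal, hsingle, Xx, Xy, Xa,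
        sub_eq_zero] using h
    refine ⟨Sum.elim (fun i => formVal (m (Fin.natAdd 3 i)) a x)
      fun z => v (.inl (z.map Subtype.val)), fun L hgL hL => ?_⟩
    -- The bivectors a∧x and a∧y = u(a∧x) span an isotropic space; the three pairings are the
    -- relations Σ γᵢᵏ Xᵢ² = 0 for k = 0, 1, 2.
    have hXL : ∀ i, formVal (m i) a x ∈ L :=
      mem_of_sum_mul_sq_eq_zero hL hγ (fun i => hgL (.inl i)) fun k hk => by
        interval_cases k
        · simpa [pow_two] using hm.isotropic a x x
        · rw [← hm.isotropic a x y]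
          exact Finset.sum_congr rfl fun i _ => by rw [hu i]; ring
        · rw [← hm.isotropic a y y]
          exact Finset.sum_congr rfl fun i _ => by rw [hu i]; ring
    have hax : ∀ p q, a p * x q - a q * x p ∈ L := fun p q => by
      rw [← hm.sum_dual_mul_formVal]
      exact sum_mem fun i _ => mul_mem (L.algebraMap_mem _) (hXL i)
    have hay : ∀ p q, a p * y q - a q * y p ∈ L := fun p q => by
      rw [← hm.sum_dual_mul_formVal]
      exact sum_mem fun i _ => mul_mem (L.algebraMap_mem _)
        (hu i ▸ mul_mem (L.algebraMap_mem _) (hXL i))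
    -- By the normalisation at i₀, x and y are the i₀-th rows of a∧x and a∧y; being independent,
    -- they determine a in turn.
    have hxL : ∀ i, x i ∈ L := fun i => by
      have := hax i₀ i
      rwa [ha0, hx0, one_mul, mul_zero, sub_zero] at this
    have hyL : ∀ i, y i ∈ L := fun i => by
      have := hay i₀ i
      rwa [ha0, hy0, one_mul, mul_zero, sub_zero] at this
    have haL : ∀ i, a i ∈ L := mem_of_wedge_mem hxL hyL hax hay hD
    have hsL : ∀ j k, j ≠ i₀ → k ≠ i₀ → v (.inl s(j, k)) ∈ L := fun j k hj hk =>
      hgL (.inr s(⟨j, hj⟩, ⟨k, hk⟩))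
    have hθ : ∀ w, ∑ k, v (.inl s(w, k)) * a k ∈ L := fun w => by
      rw [hS w]
      refine sum_mem fun i _ => mul_mem (formVal_mem L _ (fun j => ?_) haL) (formVal_mem L _ hxL hyL)
      by_cases h : j = w
      · subst h; simp
      · simp [h]
    -- As a has i₀-th coordinate 1, the known value of S a solves for the entry S(w, i₀) once the
    -- rest of row w is known.
    have step : ∀ w, (∀ k, k ≠ i₀ → v (.inl s(w, k)) ∈ L) → v (.inl s(w, i₀)) ∈ L := fun w hw => by
      have h := hθ w
      rw [← Finset.add_sum_erase _ _ (Finset.mem_univ i₀), ha0, mul_one] at h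
      have h2 : ∑ k ∈ Finset.univ.erase i₀, v (.inl s(w, k)) * a k ∈ L :=
        sum_mem fun k hk => mul_mem (hw k (Finset.ne_of_mem_erase hk)) (haL k)
      simpa using sub_mem h h2
    have hrow : ∀ w, w ≠ i₀ → v (.inl s(w, i₀)) ∈ L := fun w hw => step w fun k hk => hsL w k hw hk
    intro z
    induction z using Sym2.ind with
    | _ j k =>
      by_cases hj : j = i₀
      · subst hj
        by_cases hk : k = j
        · subst hk
          exact step k fun k' hk' => by rw [Sym2.eq_swap]; exact hrow k' hk'
        · rw [Sym2.eq_swap]; exact hrow k hk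
      · by_cases hk : k = i₀
        · subst hk; exact hrow j hj
        · exact hsL j k hj hk)
  refine ⟨G, hG0, fun S a x y ha0 hx0 hy0 hD hu hS => ?_⟩
  refine hG (Sum.elim S (Sum.elim a (Sum.elim x (Sum.elim y fun _ => (x p * y q - x q * y p)⁻¹)))) ?_
  rintro _ (((rfl | rfl | rfl | rfl) | ⟨i, rfl⟩) | ⟨w, rfl⟩)
  · simp [Xa, ha0]
  · simp [Xx, hx0]
  · simp [Xy, hy0]
  · simp [Xx, Xy, Xz, hD]
  · simp only [map_sub, map_mul, aeval_X, aeval_C, map_formVal, Xx, Xy, Xa, sub_eq_zero]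
    exact hu i
  · simp only [map_sub, map_sum, map_mul, aeval_X, map_formVal, hsingle, Xx, Xy, Xa, sub_eq_zero]
    exact hS w

end Genericity

/-! ### Top exterior power and nondegeneracy of the wedge pairing -/

section TopDegree

variable {V : Type*} [AddCommGroup V] [Module ℂ V]

/-- If the next power vanished, all of P would kill ⋀ⁿP, which is impossible for n < dim P. -/
lemma wedgePow_ne_bot {P : Submodule ℂ V} [FiniteDimensional ℂ P] {n : ℕ}
    (hn : n ≤ Module.finrank ℂ P) : wedgePow P n ≠ ⊥ := by
  induction n with
  | zero =>
    intro h
    have : (1 : ExteriorAlgebra ℂ V) ∈ wedgePow P 0 := mem_wedgePow_zero.2 ⟨1, map_one _⟩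
    rw [h, Submodule.mem_bot] at this
    exact one_ne_zero this
  | succ n ih =>
    intro h
    refine ih (by omega) ((Submodule.eq_bot_iff _).2 fun z hz => ?_)
    refine eq_zero_of_forall_ι_mul_eq_zero hz P (by omega) fun w hw => ?_
    have := ι_mul_mem_wedgePow hw hz
    rwa [h, Submodule.mem_bot] at this

lemma exists_top_functional {P : Submodule ℂ V} {n : ℕ} (e : Module.Basis (Fin n) ℂ P) :
    ∃ T : Module.Dual ℂ (ExteriorAlgebra ℂ V), T (ιMulti ℂ n fun i => (e i : V)) = 1 ∧
      ∀ z ∈ wedgePow P n, T z = 0 → z = 0 := by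
  have : FiniteDimensional ℂ P := e.finiteDimensional_of_finite
  have hn : Module.finrank ℂ P = n := by simpa using Module.finrank_eq_card_basis e
  have h0 : ιMulti ℂ n (fun i => (e i : V)) ≠ 0 := fun h => wedgePow_ne_bot hn.ge
    ((Submodule.eq_bot_iff _).2 fun z hz => by
      obtain ⟨s, rfl⟩ := exists_eq_smul_of_mem_wedgePow e hz
      rw [h, smul_zero])
  obtain ⟨T, hT, -⟩ := exists_dual_eq_one_of_notMem (Q := ⊥)
    (v := ιMulti ℂ n (fun i => (e i : V))) (by simpa using h0)
  refine ⟨T, hT, fun z hz h => ?_⟩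
  obtain ⟨s, rfl⟩ := exists_eq_smul_of_mem_wedgePow e hz
  rw [map_smul, hT, smul_eq_mul, mul_one] at h
  rw [h, zero_smul]

lemma finrank_wedgePow_le {P : Submodule ℂ V} [FiniteDimensional ℂ P] (n : ℕ) :
    Module.finrank ℂ (wedgePow P n) ≤ (Module.finrank ℂ P).choose n := by
  rw [wedgePow_eq_map, ← exteriorPower.finrank_eq]
  exact Submodule.finrank_map_le _ _

instance finiteDimensional_wedgePow (P : Submodule ℂ V) [FiniteDimensional ℂ P] (n : ℕ) :
    FiniteDimensional ℂ (wedgePow P n) := by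
  rw [wedgePow_eq_map]
  infer_instance

/-- Contractions with g₁ and g₀ separate the components of ⋀V along f₀∧f₁, f₀, f₁ and 1. Every
equation in ⋀V is read off this way. -/
lemma eq_zero_of_two_components {P : Submodule ℂ V} {f : Fin 2 → V} {g : Fin 2 → Module.Dual ℂ V}
    (hgP : ∀ i, ∀ v ∈ P, g i v = 0) (hgf : ∀ i j, g i (f j) = if i = j then 1 else 0)
    {n₁ n₂ n₃ n₄ : ℕ} {p q r s : ExteriorAlgebra ℂ V} (hp : p ∈ wedgePow P n₁)
    (hq : q ∈ wedgePow P n₂) (hr : r ∈ wedgePow P n₃) (hs : s ∈ wedgePow P n₄)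
    (h : ι ℂ (f 0) * (ι ℂ (f 1) * p) + ι ℂ (f 0) * q + ι ℂ (f 1) * r + s = 0) :
    p = 0 ∧ q = 0 ∧ r = 0 ∧ s = 0 := by
  have c : ∀ i, ∀ {n} {z : ExteriorAlgebra ℂ V}, z ∈ wedgePow P n → wedgeContract (g i) z = 0 :=
    fun i _ _ hz => wedgeContract_eq_zero (hgP i) hz
  have h1 := congr(wedgeContract (g 1) $h)
  simp only [map_add, wedgeContract_ι_mul, hgf, c _ hp, c _ hq, c _ hr, c _ hs, map_zero, mul_zero,
    sub_zero, zero_smul, one_smul, Fin.isValue, one_ne_zero, ↓reduceIte, zero_sub, add_zero] at h1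
  have h2 := congr(wedgeContract (g 0) $h1)
  simp only [map_add, map_neg, wedgeContract_ι_mul, hgf, c _ hp, c _ hr, map_zero, mul_zero,
    sub_zero, one_smul, ↓reduceIte, Fin.isValue, neg_eq_zero, add_zero] at h2
  have hr0 : r = 0 := by simpa [h2] using h1
  simp only [h2, hr0, mul_zero, zero_add, add_zero] at h
  have h3 := congr(wedgeContract (g 0) $h)
  simp only [map_add, wedgeContract_ι_mul, hgf, c _ hq, c _ hs, map_zero, mul_zero,
    sub_zero, one_smul, ↓reduceIte, Fin.isValue, add_zero] at h3
  exact ⟨h2, h3, hr0, by simpa [h3] using h⟩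

/-- Nondegeneracy of the pairing ⋀ᵏP × ⋀ⁿP, by peeling off one vector at a time. -/
lemma eq_zero_of_forall_mul_eq_zero {P : Submodule ℂ V} [FiniteDimensional ℂ P] {n k : ℕ}
    (hk : n + k ≤ Module.finrank ℂ P) {z : ExteriorAlgebra ℂ V} (hz : z ∈ wedgePow P n)
    (h : ∀ y ∈ wedgePow P k, y * z = 0) : z = 0 := by
  induction k generalizing n z with
  | zero => simpa using h 1 (mem_wedgePow_zero.2 ⟨1, map_one _⟩)
  | succ k ih =>
    refine eq_zero_of_forall_ι_mul_eq_zero hz P (by omega) fun w hw => ?_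
    refine ih (by omega) (ι_mul_mem_wedgePow hw hz) fun y hy => ?_
    rw [← mul_assoc]
    exact h _ (mul_mem_wedgePow hy (ι_mem_wedgePow hw))

end TopDegree

/-! ### Orthonormal eigenbasis of a self-adjoint operator on bivectors -/

section Frame

variable {V : Type*} [AddCommGroup V] [Module ℂ V]

/-- Six distinct eigenvalues on a space of dimension at most six give a basis of eigenvectors,
orthogonal by self-adjointness. None is isotropic, since it would be orthogonal to everything, so
each can be divided by a square root of its norm. -/
lemma exists_orthonormal_eigenbasis {P : Submodule ℂ V} (hP : Module.finrank ℂ P = 4)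
    {T : Module.Dual ℂ (ExteriorAlgebra ℂ V)} (hT : ∀ z ∈ wedgePow P 4, T z = 0 → z = 0)
    (u : Module.End ℂ (wedgePow P 2))
    (hsa : ∀ x y : wedgePow P 2, T ((x : ExteriorAlgebra ℂ V) * u y) = T ((u x : ExteriorAlgebra ℂ V) * y))
    (h6 : {μ : ℂ | u.HasEigenvalue μ}.ncard = 6) :
    ∃ (γ : Fin 6 → ℂ) (x : Fin 6 → wedgePow P 2), Function.Injective γ ∧
      (∀ i, u (x i) = γ i • x i) ∧
      (∀ i j, T ((x i : ExteriorAlgebra ℂ V) * x j) = if i = j then 1 else 0) ∧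
      ∀ z : wedgePow P 2, z = ∑ i, T ((x i : ExteriorAlgebra ℂ V) * z) • x i := by
  have hfd : FiniteDimensional ℂ P := Module.finite_of_finrank_pos (by omega)
  have hfin : {μ : ℂ | u.HasEigenvalue μ}.Finite := Set.finite_of_ncard_ne_zero (by omega)
  have hcard : Fintype.card (Fin 6) = Nat.card {μ : ℂ | u.HasEigenvalue μ} := by
    rw [Nat.card_coe_set_eq, h6]; simp
  have := hfin.to_subtype
  obtain ⟨E⟩ : Nonempty (Fin 6 ≃ {μ : ℂ | u.HasEigenvalue μ}) := by
    rw [← Finite.card_eq]; simpa using hcard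
  choose y hy using fun i : Fin 6 => (E i).2.exists_hasEigenvector
  have hinj : Function.Injective fun i => (E i : ℂ) := Subtype.val_injective.comp E.injective
  have hli : LinearIndependent ℂ y := Module.End.eigenvectors_linearIndependent' u _ hinj y hy
  have hdim : Module.finrank ℂ (wedgePow P 2) ≤ 6 := by
    have := finrank_wedgePow_le (P := P) 2
    rw [hP] at this; exact this
  have hdim' : Fintype.card (Fin 6) = Module.finrank ℂ (wedgePow P 2) := by
    have := hli.fintype_card_le_finrank
    simp only [Fintype.card_fin] at this ⊢
    omega
  let b := basisOfLinearIndependentOfCardEqFinrank hli hdim'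
  have hb : ∀ i, b i = y i := fun i => by simp [b]
  have hyu : ∀ i, u (y i) = (E i : ℂ) • y i := fun i => (hy i).apply_eq_smul
  have hort : ∀ i j, i ≠ j → T ((y i : ExteriorAlgebra ℂ V) * y j) = 0 := fun i j hij => by
    have h := hsa (y i) (y j)
    rw [hyu, hyu, Submodule.coe_smul, Submodule.coe_smul, mul_smul_comm, smul_mul_assoc, map_smul,
      map_smul, smul_eq_mul, smul_eq_mul, ← sub_eq_zero, ← sub_mul] at h
    exact (mul_eq_zero.1 h).resolve_left (sub_ne_zero.2 fun h => hij (hinj h).symm)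
  have hexp : ∀ z : wedgePow P 2, ∀ i, T ((y i : ExteriorAlgebra ℂ V) * z) =
      b.repr z i * T ((y i : ExteriorAlgebra ℂ V) * y i) := fun z i => by
    conv_lhs => rw [← b.sum_repr z]
    simp only [hb, AddSubmonoidClass.coe_finsetSum, Submodule.coe_smul, Finset.mul_sum, mul_smul_comm,
      map_sum, map_smul, smul_eq_mul]
    rw [Finset.sum_eq_single i (fun j _ hj => by rw [hort i j hj.symm, mul_zero]) (by simp)]
  have hne : ∀ i, T ((y i : ExteriorAlgebra ℂ V) * y i) ≠ 0 := fun i h0 => by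
    refine (hy i).2 (Subtype.ext ?_)
    refine eq_zero_of_forall_mul_eq_zero (P := P) (k := 2) (by omega) (y i).2 fun z hz => ?_
    rw [commute_of_mem_wedgePow_two hz]
    refine hT _ (mul_mem_wedgePow (y i).2 hz) ?_
    rw [hexp ⟨z, hz⟩ i, h0, mul_zero]
  choose ρ hρ using fun i => IsAlgClosed.exists_pow_nat_eq
    (T ((y i : ExteriorAlgebra ℂ V) * y i))⁻¹ zero_lt_two
  have hρ' : ∀ i, ρ i * ρ i * T ((y i : ExteriorAlgebra ℂ V) * y i) = 1 := fun i => by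
    rw [← pow_two, hρ, inv_mul_cancel₀ (hne i)]
  refine ⟨fun i => E i, fun i => ρ i • y i, hinj, fun i => ?_, fun i j => ?_, fun z => ?_⟩
  · rw [map_smul, hyu, smul_comm]
  · split_ifs with h
    · subst h
      rw [Submodule.coe_smul, smul_mul_smul_comm, map_smul, smul_eq_mul, hρ']
    · rw [Submodule.coe_smul, Submodule.coe_smul, smul_mul_smul_comm, map_smul, hort i j h, smul_zero]
  · conv_lhs => rw [← b.sum_repr z]
    refine Finset.sum_congr rfl fun i _ => ?_
    rw [Submodule.coe_smul, smul_mul_assoc, map_smul, hexp, hb, smul_smul, smul_eq_mul]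
    congr 1
    linear_combination -b.repr z i * hρ' i

end Frame

/-! ### Bivector frames and the parametrisation of A -/

section Frame

variable {V : Type*} [AddCommGroup V] [Module ℂ V]

/-- A splitting `V = P ⊕ ⟨f₀, f₁⟩` with `dim P = 4`, together with a basis of `⋀² P` which is
orthonormal for the wedge product, and distinct weights `γ`. -/
structure BivectorFrame (V : Type*) [AddCommGroup V] [Module ℂ V] where
  P : Submodule ℂ V
  e : Module.Basis (Fin 4) ℂ P
  f : Fin 2 → V
  g : Fin 2 → Module.Dual ℂ V
  g_eq_zero : ∀ i, ∀ v ∈ P, g i v = 0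
  g_f : ∀ i j, g i (f j) = if i = j then 1 else 0
  exists_eq_add : ∀ v, ∃ a ∈ P, v = a + (g 0 v • f 0 + g 1 v • f 1)
  T : Module.Dual ℂ (ExteriorAlgebra ℂ V)
  eq_zero_of_T : ∀ z ∈ wedgePow P 4, T z = 0 → z = 0
  γ : Fin 6 → ℂ
  γ_injective : Function.Injective γ
  x : Fin 6 → ExteriorAlgebra ℂ V
  x_mem : ∀ i, x i ∈ wedgePow P 2
  T_x_mul_x : ∀ i j, T (x i * x j) = if i = j then 1 else 0
  eq_sum : ∀ z ∈ wedgePow P 2, z = ∑ i, T (x i * z) • x i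

namespace BivectorFrame

variable (F : BivectorFrame V)

instance : FiniteDimensional ℂ F.P := F.e.finiteDimensional_of_finite

lemma finrank_P : Module.finrank ℂ F.P = 4 := by
  simpa using Module.finrank_eq_card_basis F.e

/-- The operator on bivectors with eigenvectors `xᵢ` and eigenvalues `γᵢ`. -/
def u : ExteriorAlgebra ℂ V →ₗ[ℂ] ExteriorAlgebra ℂ V :=
  ∑ i, F.γ i • ((F.T.comp (LinearMap.mulLeft ℂ (F.x i))).smulRight (F.x i))

lemma u_apply (z : ExteriorAlgebra ℂ V) : F.u z = ∑ i, (F.γ i * F.T (F.x i * z)) • F.x i := by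
  simp [u, smul_smul]

lemma u_mem (z : ExteriorAlgebra ℂ V) : F.u z ∈ wedgePow F.P 2 := by
  rw [u_apply]
  exact sum_mem fun i _ => Submodule.smul_mem _ _ (F.x_mem i)

lemma T_x_mul_u (i : Fin 6) (z : ExteriorAlgebra ℂ V) :
    F.T (F.x i * F.u z) = F.γ i * F.T (F.x i * z) := by
  simp [u_apply, Finset.mul_sum, F.T_x_mul_x]

/-- Parseval's identity for the orthonormal basis `x`. -/
lemma T_mul {y z : ExteriorAlgebra ℂ V} (hz : z ∈ wedgePow F.P 2) :
    F.T (y * z) = ∑ i, F.T (F.x i * y) * F.T (F.x i * z) := by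
  conv_lhs => rw [F.eq_sum z hz]
  simp only [Finset.mul_sum, map_sum, mul_smul_comm, map_smul, smul_eq_mul]
  exact Finset.sum_congr rfl fun i _ => by rw [← commute_of_mem_wedgePow_two (F.x_mem i), mul_comm]

lemma eq_of_T_x_mul_eq {y z : ExteriorAlgebra ℂ V} (hy : y ∈ wedgePow F.P 2)
    (hz : z ∈ wedgePow F.P 2) (h : ∀ i, F.T (F.x i * y) = F.T (F.x i * z)) : y = z := by
  rw [F.eq_sum y hy, F.eq_sum z hz]
  exact Finset.sum_congr rfl fun i _ => by rw [h]

lemma eq_zero_of_T_x_mul {z : ExteriorAlgebra ℂ V} (hz : z ∈ wedgePow F.P 2)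
    (h : ∀ i, F.T (F.x i * z) = 0) : z = 0 :=
  F.eq_of_T_x_mul_eq hz (zero_mem _) fun i => by rw [h, mul_zero, map_zero]

/-- Linear forms on `V` restricting to the coordinates on `P`. -/
def coord : Fin 4 → Module.Dual ℂ V := Classical.choose (exists_dual_extending_coord F.e)

lemma coord_apply (i : Fin 4) (v : F.P) : F.coord i v = F.e.repr v i :=
  Classical.choose_spec (exists_dual_extending_coord F.e) i v

lemma eq_sum_coord {v : V} (hv : v ∈ F.P) : v = ∑ p, F.coord p v • (F.e p : V) := by
  have := congr(($(F.e.sum_repr ⟨v, hv⟩) : V))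
  simp only [AddSubmonoidClass.coe_finsetSum, Submodule.coe_smul] at this
  conv_lhs => rw [← this]
  exact Finset.sum_congr rfl fun i _ => by rw [F.coord_apply i ⟨v, hv⟩]

lemma coord_e (p q : Fin 4) : F.coord p (F.e q) = if q = p then 1 else 0 := by
  rw [F.coord_apply, F.e.repr_self, Finsupp.single_apply]

/-- The coefficients of the bivectors `xᵢ`, viewed as alternating forms. -/
def m (i : Fin 6) (p q : Fin 4) : ℂ := F.T (F.x i * (ι ℂ (F.e p : V) * ι ℂ (F.e q : V)))

/-- The Plücker coordinates of the bivectors `xᵢ`. -/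
def d (i : Fin 6) (p q : Fin 4) : ℂ :=
  ExteriorAlgebra.algebraMapInv (wedgeContract (F.coord q) (wedgeContract (F.coord p) (F.x i)))

lemma formRow_m {a : V} (ha : a ∈ F.P) (i : Fin 6) (j : Fin 4) :
    formRow (F.m i) (fun p => F.coord p a) j = F.T (F.x i * (ι ℂ a * ι ℂ (F.e j : V))) := by
  conv_rhs => rw [F.eq_sum_coord ha]
  simp [formRow, m, Finset.mul_sum, Finset.sum_mul, mul_comm]

lemma formVal_m {a w : V} (ha : a ∈ F.P) (hw : w ∈ F.P) (i : Fin 6) :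
    formVal (F.m i) (fun p => F.coord p a) (fun p => F.coord p w) =
      F.T (F.x i * (ι ℂ a * ι ℂ w)) := by
  conv_rhs => rw [F.eq_sum_coord hw]
  simp [formVal, F.formRow_m ha, Finset.mul_sum, mul_comm]

/-- By Parseval, `antisymm` is the sign rule in e_p∧e_q∧e_r∧e_s; `dual` is the expansion of e_r∧e_s
in the frame, contracted twice. -/
lemma isOrthonormalBivectorFrame : IsOrthonormalBivectorFrame F.m F.d where
  antisymm p q r s := by
    simp only [m]
    rw [← F.T_mul (ι_mul_ι_mem_wedgePow (F.e r).2 (F.e s).2),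
      ← F.T_mul (ι_mul_ι_mem_wedgePow (F.e p).2 (F.e s).2), ← map_neg]
    congr 1
    rw [mul_assoc, mul_assoc, ι_mul_swap_mul (F.e p : V) (F.e q : V) (ι ℂ (F.e r : V) * _),
      ι_mul_swap_mul (F.e p : V) (F.e r : V), mul_neg, neg_neg, ι_mul_swap_mul (F.e q : V)]
  dual p q r s := by
    have h := congr(ExteriorAlgebra.algebraMapInv (wedgeContract (F.coord q) (wedgeContract (F.coord p)
      $(F.eq_sum _ (ι_mul_ι_mem_wedgePow (F.e r).2 (F.e s).2)))))
    simp only [map_sum, map_smul, smul_eq_mul] at h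
    simp only [m, d]
    rw [Finset.sum_congr rfl fun i _ => mul_comm _ _, ← h]
    rw [wedgeContract_ι_mul, wedgeContract_ι, ← Algebra.commutes, ← Algebra.smul_def, map_sub,
      map_smul, map_smul, wedgeContract_ι, wedgeContract_ι, map_sub, map_smul, map_smul]
    simp [F.coord_e, eq_comm, mul_comm]

/-- `f₀ ∧ f₁ ∧ w + φ w + f₀ ∧ z + f₁ ∧ u z`. -/
def param (φ : F.P →ₗ[ℂ] ExteriorAlgebra ℂ V) : F.P × wedgePow F.P 2 →ₗ[ℂ] ExteriorAlgebra ℂ V :=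
  ((LinearMap.mulLeft ℂ (ι ℂ (F.f 0) * ι ℂ (F.f 1))).comp ((ι ℂ).comp F.P.subtype) + φ).coprod
    ((LinearMap.mulLeft ℂ (ι ℂ (F.f 0)) + (LinearMap.mulLeft ℂ (ι ℂ (F.f 1))).comp F.u).comp
      (wedgePow F.P 2).subtype)

lemma param_apply (φ : F.P →ₗ[ℂ] ExteriorAlgebra ℂ V) (w : F.P) (z : wedgePow F.P 2) :
    F.param φ (w, z) = ι ℂ (F.f 0) * ι ℂ (F.f 1) * ι ℂ (w : V) + φ w +
      (ι ℂ (F.f 0) * z + ι ℂ (F.f 1) * F.u z) := by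
  simp [param, mul_assoc]

/-- The four components of the product. These are the equations of F_v ∩ A for v = a + b₀f₀ + b₁f₁,
on which all the case distinctions rest. -/
lemma ι_mul_param_eq_zero {φ : F.P →ₗ[ℂ] ExteriorAlgebra ℂ V} (hφ : ∀ w, φ w ∈ wedgePow F.P 3)
    {a : V} (ha : a ∈ F.P) (b₀ b₁ : ℂ) {w : F.P} {z : wedgePow F.P 2}
    (h : ι ℂ (a + (b₀ • F.f 0 + b₁ • F.f 1)) * F.param φ (w, z) = 0) :
    ι ℂ a * ι ℂ (w : V) = b₁ • (z : ExteriorAlgebra ℂ V) - b₀ • F.u z ∧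
      ι ℂ a * (z : ExteriorAlgebra ℂ V) = b₀ • φ w ∧ ι ℂ a * F.u z = b₁ • φ w ∧ ι ℂ a * φ w = 0 := by
  have hz := z.2
  have huz := F.u_mem z
  have key := eq_zero_of_two_components F.g_eq_zero F.g_f
    (p := ι ℂ a * ι ℂ (w : V) + b₀ • F.u z - b₁ • (z : ExteriorAlgebra ℂ V))
    (q := b₀ • φ w - ι ℂ a * z) (r := b₁ • φ w - ι ℂ a * F.u z) (s := ι ℂ a * φ w)
    (sub_mem (add_mem (ι_mul_ι_mem_wedgePow ha w.2) (Submodule.smul_mem _ _ huz))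
      (Submodule.smul_mem _ _ hz))
    (sub_mem (Submodule.smul_mem _ _ (hφ w)) (ι_mul_mem_wedgePow ha hz))
    (sub_mem (Submodule.smul_mem _ _ (hφ w)) (ι_mul_mem_wedgePow ha huz))
    (ι_mul_mem_wedgePow ha (hφ w)) ?_
  · obtain ⟨h1, h2, h3, h4⟩ := key
    refine ⟨?_, (sub_eq_zero.1 h2).symm, (sub_eq_zero.1 h3).symm, h4⟩
    rw [sub_eq_zero] at h1
    rw [← h1, add_sub_cancel_right]
  · rw [← h, param_apply]
    simp only [map_add, map_smul, mul_add, add_mul, mul_sub, smul_mul_assoc, mul_smul_comm, mul_assoc]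
    rw [ι_mul_self_mul (F.f 0), ι_mul_self_mul (F.f 0), ι_mul_self_mul (F.f 1),
      ι_mul_swap_mul a (F.f 0) (ι ℂ (F.f 1) * _), ι_mul_swap_mul a (F.f 1), ι_mul_swap_mul a (F.f 0),
      ι_mul_swap_mul a (F.f 1), ι_mul_swap_mul (F.f 1) (F.f 0), ι_mul_swap_mul (F.f 1) (F.f 0)
      , ι_mul_self_mul (F.f 1)]
    simp only [mul_neg, mul_zero, smul_zero, smul_neg, neg_neg, neg_zero]
    abel

end BivectorFrame
end Frame

/-! ### Symmetric forms of small rank on a hyperplane -/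

section SymmetricForms

variable {M : Type*} [AddCommGroup M] [Module ℂ M] [FiniteDimensional ℂ M]

lemma eq_ker_of_finrank_le {W : Submodule ℂ M} (hW : Module.finrank ℂ M ≤ Module.finrank ℂ W + 1)
    {r : Module.Dual ℂ M} (hr : r ≠ 0) (hWr : W ≤ LinearMap.ker r) : W = LinearMap.ker r := by
  refine Submodule.eq_of_le_of_finrank_le hWr ?_
  have h : Module.finrank ℂ (LinearMap.ker r) < Module.finrank ℂ M :=
    Submodule.finrank_lt fun h => hr (LinearMap.ker_eq_top.1 h)
  omega

/-- A symmetric form whose kernel on a hyperplane `r = 0` is proportional to `r`. -/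
lemma exists_form_eq_mul_add_mul {N : LinearMap.BilinForm ℂ M} (hN : ∀ v w, N v w = N w v)
    {W : Submodule ℂ M} (hW : Module.finrank ℂ M ≤ Module.finrank ℂ W + 1)
    {r : Module.Dual ℂ M} (hr : r ≠ 0) (hWr : W ≤ LinearMap.ker r)
    (h : ∀ w ∈ W, ∃ t, ∀ v, N w v = t * r v) :
    ∃ l : Module.Dual ℂ M, ∀ v w, N v w = r v * l w + l v * r w := by
  have hWk := eq_ker_of_finrank_le hW hr hWr
  obtain ⟨w₁, hw₁⟩ : ∃ w, r w ≠ 0 := by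
    by_contra! h; exact hr (LinearMap.ext h)
  let w₀ := (r w₁)⁻¹ • w₁
  have hw₀ : r w₀ = 1 := by simp [w₀, hw₁]
  have hmem : ∀ v, v - r v • w₀ ∈ W := fun v => by
    rw [hWk, LinearMap.mem_ker, map_sub, map_smul, hw₀, smul_eq_mul, mul_one, sub_self]
  have key : ∀ v w, N v w = r v * N w₀ w + (N v w₀ - r v * N w₀ w₀) * r w := fun v w => by
    obtain ⟨t, ht⟩ := h _ (hmem v)
    have h1 := ht w
    have h2 := ht w₀
    simp only [map_sub, map_smul, LinearMap.sub_apply, LinearMap.smul_apply, smul_eq_mul, hw₀] at h1 h2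
    linear_combination h1 - r w * h2
  refine ⟨N w₀ - (N w₀ w₀ / 2) • r, fun v w => ?_⟩
  rw [key v w, hN v w₀]
  simp only [LinearMap.sub_apply, LinearMap.smul_apply, smul_eq_mul]
  ring

/-- The kernel contains a hyperplane, so the rank is at most one, and over ℂ such a form is a
square. -/
lemma exists_form_eq_mul_self {N : LinearMap.BilinForm ℂ M} (hN : ∀ v w, N v w = N w v)
    {W : Submodule ℂ M} (hW : Module.finrank ℂ M ≤ Module.finrank ℂ W + 1)
    (h : ∀ w ∈ W, ∀ v, N w v = 0) :
    ∃ l : Module.Dual ℂ M, ∀ v w, N v w = l v * l w := by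
  by_cases htop : W = ⊤
  · exact ⟨0, fun v w => by simpa using h v (htop ▸ Submodule.mem_top) w⟩
  · obtain ⟨w₀, hw₀⟩ : ∃ w, w ∉ W := by
      by_contra! h; exact htop (Submodule.eq_top_iff'.2 h)
    obtain ⟨r, hr, hrW⟩ := exists_dual_eq_one_of_notMem hw₀
    have hr0 : r ≠ 0 := by rintro rfl; simp at hr
    have hWk := eq_ker_of_finrank_le hW hr0 hrW
    have hmem : ∀ v, v - r v • w₀ ∈ W := fun v => by
      rw [hWk, LinearMap.mem_ker, map_sub, map_smul, hr, smul_eq_mul, mul_one, sub_self]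
    have key : ∀ v w, N v w = r v * N w₀ w := fun v w => by
      have := h _ (hmem v) w
      simp only [map_sub, map_smul, LinearMap.sub_apply, LinearMap.smul_apply, smul_eq_mul] at this
      exact sub_eq_zero.1 this
    obtain ⟨ρ, hρ⟩ := IsAlgClosed.exists_pow_nat_eq (N w₀ w₀) zero_lt_two
    refine ⟨ρ • r, fun v w => ?_⟩
    rw [key v w, hN w₀ w, key w w₀, ← hρ]
    simp only [LinearMap.smul_apply, smul_eq_mul]
    ring

end SymmetricForms

/-! ### Genericity conditions, and fibres over v with nonzero component in V⁺ -/

section Frame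

variable {V : Type*} [AddCommGroup V] [Module ℂ V]

namespace BivectorFrame

variable (F : BivectorFrame V)

/-- The linear form `w ↦ xᵢ ∧ a ∧ w` on `P`. -/
def row (a : V) (i : Fin 6) : Module.Dual ℂ F.P :=
  (F.T.comp ((LinearMap.mulLeft ℂ (F.x i)).comp (LinearMap.mulLeft ℂ (ι ℂ a)))).comp
    ((ι ℂ).comp F.P.subtype)

lemma row_apply (a : V) (i : Fin 6) (w : F.P) : F.row a i w = F.T (F.x i * (ι ℂ a * ι ℂ (w : V))) :=
  rfl

lemma row_smul (t : ℂ) (a : V) (i : Fin 6) (w : F.P) : F.row (t • a) i w = t * F.row a i w := by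
  simp [row_apply]

/-- The symmetric form `∑ ωᵢ (xᵢ ∧ a ∧ ·)²` on `P`. -/
def pencil (ω : Fin 6 → ℂ) (a : V) : LinearMap.BilinForm ℂ F.P :=
  ∑ i, ω i • LinearMap.BilinForm.linMulLin (F.row a i) (F.row a i)

lemma pencil_apply (ω : Fin 6 → ℂ) (a : V) (v w : F.P) :
    F.pencil ω a v w = ∑ i, ω i * (F.row a i v * F.row a i w) := by
  simp [pencil, LinearMap.BilinForm.linMulLin_apply]

lemma pencil_symm (ω : Fin 6 → ℂ) (a : V) (v w : F.P) : F.pencil ω a v w = F.pencil ω a w v := by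
  simp only [pencil_apply, mul_comm (F.row a _ v)]

lemma pencil_smul (ω : Fin 6 → ℂ) (t : ℂ) (a : V) (v w : F.P) :
    F.pencil ω (t • a) v w = t ^ 2 * F.pencil ω a v w := by
  simp only [pencil_apply, row_smul, Finset.mul_sum]
  exact Finset.sum_congr rfl fun i _ => by ring

lemma T_ι_mul_ι_mul (a : V) {z : ExteriorAlgebra ℂ V} (hz : z ∈ wedgePow F.P 2) (w : F.P) :
    F.T (ι ℂ (w : V) * (ι ℂ a * z)) = -∑ i, F.T (F.x i * z) * F.row a i w := by
  rw [← mul_assoc, F.T_mul hz, ← Finset.sum_neg_distrib]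
  refine Finset.sum_congr rfl fun i _ => ?_
  rw [ι_mul_swap, mul_neg, map_neg, row_apply]
  ring

/-- The genericity conditions on a quadratic form `q` on `P` with respect to the frame. -/
structure IsGeneral (q : QuadraticForm ℂ F.P) : Prop where
  -- For v = a + b₀f₀ + b₁f₁ with b₀ ≠ 0 and c = b₁/b₀ not an eigenvalue.
  ne_pencil_add_sq : ∀ a ∈ F.P, ∀ c, (∀ i, c ≠ F.γ i) → ∀ l : Module.Dual ℂ F.P,
    ¬ ∀ v w, QuadraticMap.polar q v w = F.pencil (fun i => (c - F.γ i)⁻¹) a v w + l v * l w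
  -- For v = a + b₁f₁ with b₁ ≠ 0.
  ne_pencil_add_sq' : ∀ a ∈ F.P, ∀ l : Module.Dual ℂ F.P,
    ¬ ∀ v w, QuadraticMap.polar q v w = F.pencil F.γ a v w + l v * l w
  -- For b₁/b₀ = γ_k. The k-th weight is the inverse of zero, which is 0, so the k-th square is
  -- absent from the pencil.
  ne_pencil_add_mul : ∀ a ∈ F.P, ∀ k, ∀ l : Module.Dual ℂ F.P,
    ¬ ∀ v w, QuadraticMap.polar q v w = F.pencil (fun i => (F.γ k - F.γ i)⁻¹) a v w +
      (F.row a k v * l w + l v * F.row a k w)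
  -- For v = a in P.
  apply_ne_zero : ∀ a : F.P, a ≠ 0 → ∀ z ∈ wedgePow F.P 2, z ≠ 0 → ι ℂ (a : V) * z = 0 →
    ι ℂ (a : V) * F.u z = 0 → ι ℂ (a : V) * F.u (F.u z) = 0 → q a ≠ 0
  -- For decomposable vectors of A divisible by a.
  ne_decomposable : ∀ a x y : F.P, ∀ i, F.coord i a = 1 → F.coord i x = 0 → F.coord i y = 0 →
    ι ℂ (x : V) * ι ℂ (y : V) ≠ 0 → ι ℂ (a : V) * ι ℂ (y : V) = F.u (ι ℂ (a : V) * ι ℂ (x : V)) →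
    ¬ ∀ w : F.P, QuadraticMap.polar q w a =
      F.T (ι ℂ (w : V) * ι ℂ (a : V) * (ι ℂ (x : V) * ι ℂ (y : V)))

variable {F} {q : QuadraticForm ℂ F.P} {φ : F.P →ₗ[ℂ] ExteriorAlgebra ℂ V}

/-- Otherwise a∧xᵢ = 0, so xᵢ∧xᵢ = 0, against the normalisation of the frame. -/
lemma row_ne_zero {a : V} (ha : a ∈ F.P) (ha0 : a ≠ 0) (i : Fin 6) : F.row a i ≠ 0 := by
  intro h
  have h1 : ι ℂ a * F.x i = 0 := by
    refine eq_zero_of_forall_ι_mul_eq_zero (ι_mul_mem_wedgePow ha (F.x_mem i)) F.P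
      (by rw [F.finrank_P]; norm_num) fun w hw => ?_
    refine F.eq_zero_of_T _ (ι_mul_mem_wedgePow hw (ι_mul_mem_wedgePow ha (F.x_mem i))) ?_
    rw [← mul_assoc, ι_mul_swap, ← commute_of_mem_wedgePow_two (F.x_mem i), mul_neg, map_neg]
    have := LinearMap.congr_fun h ⟨w, hw⟩
    rw [row_apply] at this
    rw [this]; simp
  have h2 := mul_self_eq_zero_of_ι_mul_eq_zero ha0 (F.x_mem i) h1 h1
  have h3 := F.T_x_mul_x i i
  rw [h2, map_zero] at h3
  simp at h3

variable (hφ : ∀ w, φ w ∈ wedgePow F.P 3) (hinj : ∀ w, φ w = 0 → w = 0) {s : ℂ} (hs : s ≠ 0)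
  (hB : ∀ v w : F.P, F.T (ι ℂ (v : V) * φ w) = s * QuadraticMap.polar q v w)

include hφ hs hB in
/-- Elements `v ∧ ⋀² V` of the subspace, for `v` with nonzero components in both summands. -/
lemma finrank_ker_le_two_of_ne_zero (hq : F.IsGeneral q) {a : V} (ha : a ∈ F.P) (ha0 : a ≠ 0)
    (b₀ b₁ : ℂ) (hb : b₀ ≠ 0 ∨ b₁ ≠ 0) :
    Module.finrank ℂ (LinearMap.ker ((LinearMap.mulLeft ℂ (ι ℂ (a + (b₀ • F.f 0 + b₁ • F.f 1)))).comp
      (F.param φ))) ≤ 2 := by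
  set E := LinearMap.ker ((LinearMap.mulLeft ℂ (ι ℂ (a + (b₀ • F.f 0 + b₁ • F.f 1)))).comp
      (F.param φ)) with hE
  have hEq : ∀ p : E, _ := fun p => F.ι_mul_param_eq_zero hφ ha b₀ b₁ (w := p.1.1) (z := p.1.2) p.2
  have hco : ∀ p : E, ∀ i, F.row a i p.1.1 = (b₁ - b₀ * F.γ i) * F.T (F.x i * p.1.2) := fun p i => by
    rw [row_apply, (hEq p).1, mul_sub, mul_smul_comm, mul_smul_comm, map_sub, map_smul, map_smul,
      T_x_mul_u, smul_eq_mul, smul_eq_mul]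
    ring
  have hpol0 : ∀ p : E, ∀ v, b₀ * (s * QuadraticMap.polar q v p.1.1) =
      -∑ i, F.T (F.x i * p.1.2) * F.row a i v := fun p v => by
    rw [← hB, ← F.T_ι_mul_ι_mul a p.1.2.2, (hEq p).2.1, mul_smul_comm, map_smul, smul_eq_mul]
  have hpol1 : ∀ p : E, ∀ v, b₁ * (s * QuadraticMap.polar q v p.1.1) =
      -∑ i, F.γ i * F.T (F.x i * p.1.2) * F.row a i v := fun p v => by
    have := F.T_ι_mul_ι_mul a (F.u_mem p.1.2) v
    simp only [T_x_mul_u] at this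
    rw [← hB, ← this, (hEq p).2.2.1, mul_smul_comm, map_smul, smul_eq_mul]
  -- The component w determines z: by `hco` only a coordinate z_k with b₁ = b₀γ_k could remain, and
  -- a∧z = b₀φ(0) = 0 kills it because a∧x_k ≠ 0.
  have hfst : ∀ p : E, p.1.1 = 0 → p = 0 := by
    intro p hp
    have h1 : ∀ i, (b₁ - b₀ * F.γ i) * F.T (F.x i * p.1.2) = 0 := fun i => by
      rw [← hco, hp, map_zero]
    have hz : ∀ k, b₁ - b₀ * F.γ k = 0 → F.T (F.x k * p.1.2) = 0 := by
      intro k hk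
      have hb₀ : b₀ ≠ 0 := by
        rintro rfl; rw [zero_mul, sub_zero] at hk; simp [hk] at hb
      have hother : ∀ i, i ≠ k → F.T (F.x i * p.1.2) = 0 := fun i hi => by
        refine (mul_eq_zero.1 (h1 i)).resolve_left fun h => hi (F.γ_injective ?_)
        exact mul_left_cancel₀ hb₀ (by linear_combination hk - h)
      obtain ⟨v, hv⟩ : ∃ v, F.row a k v ≠ 0 := by
        by_contra! h; exact row_ne_zero ha ha0 k (LinearMap.ext h)
      have h2 := hpol0 p v
      rw [hp, Finset.sum_eq_single k (fun i _ hi => by rw [hother i hi, zero_mul]) (by simp)] at h2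
      simp only [QuadraticMap.polar_zero_right, mul_zero] at h2
      exact (mul_eq_zero.1 (neg_eq_zero.1 h2.symm)).resolve_right hv
    refine Subtype.ext (Prod.ext hp (Subtype.ext (F.eq_zero_of_T_x_mul p.1.2.2 fun i => ?_)))
    by_cases hk : b₁ - b₀ * F.γ i = 0
    · exact hz i hk
    · exact (mul_eq_zero.1 (h1 i)).resolve_left hk
  -- If the kernel has dimension at least three, its projection to P is injective and contains a
  -- hyperplane, on which q is compared with the pencil.
  by_contra! h3
  let π : E →ₗ[ℂ] F.P := (LinearMap.fst ℂ F.P (wedgePow F.P 2)).comp E.subtype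
  have hπ : Function.Injective π := fun p p' h =>
    sub_eq_zero.1 (hfst (p - p') (sub_eq_zero.2 h))
  have hW : Module.finrank ℂ F.P ≤ Module.finrank ℂ (LinearMap.range π) + 1 := by
    rw [LinearMap.finrank_range_of_inj hπ, F.finrank_P]; omega
  have hsymm : ∀ (ω : Fin 6 → ℂ) (a : V) (v w : F.P), (QuadraticMap.polarBilin q - F.pencil ω a) v w =
      (QuadraticMap.polarBilin q - F.pencil ω a) w v := fun ω a v w => by
    simp only [LinearMap.sub_apply, QuadraticMap.polarBilin_apply_apply, F.pencil_symm ω a v w,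
      QuadraticMap.polar_comm _ v w]
  have hpol : ∀ (ω : Fin 6 → ℂ) (τ : ℂ) (v w : F.P) (l : ℂ), (QuadraticMap.polarBilin q - F.pencil ω (τ • a)) v w = l →
      QuadraticMap.polar q v w = F.pencil ω (τ • a) v w + l := fun ω τ v w l h => by
    rw [LinearMap.sub_apply, LinearMap.sub_apply, QuadraticMap.polarBilin_apply_apply] at h
    rw [← h]; ring
  by_cases hb₀ : b₀ = 0
  · have hb₁ : b₁ ≠ 0 := by simpa [hb₀] using hb
    -- The pencil is quadratic in a, so replacing a by τa absorbs the constant.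
    obtain ⟨τ, hτ⟩ := IsAlgClosed.exists_pow_nat_eq (-(s * b₁ ^ 2)⁻¹) zero_lt_two
    obtain ⟨l, hl⟩ := exists_form_eq_mul_self (hsymm F.γ (τ • a)) hW (by
      rintro _ ⟨p, rfl⟩ v
      rw [LinearMap.sub_apply, LinearMap.sub_apply, QuadraticMap.polarBilin_apply_apply, pencil_smul, hτ,
        sub_eq_zero, QuadraticMap.polar_comm]
      have h := hpol1 p v
      have h2 : F.pencil F.γ a (π p) v = b₁ * ∑ i, F.γ i * F.T (F.x i * p.1.2) * F.row a i v := by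
        rw [pencil_apply, Finset.mul_sum]
        refine Finset.sum_congr rfl fun i _ => ?_
        change F.γ i * (F.row a i p.1.1 * _) = _
        rw [hco, hb₀]; ring
      rw [h2]
      change QuadraticMap.polar q v p.1.1 = _
      field_simp
      linear_combination h)
    exact hq.ne_pencil_add_sq' (τ • a) (F.P.smul_mem _ ha) l fun v w => hpol _ _ _ _ _ (hl v w)
  obtain ⟨τ, hτ⟩ := IsAlgClosed.exists_pow_nat_eq (-(s * b₀ ^ 2)⁻¹) zero_lt_two
  have hτ0 : τ ≠ 0 := by
    rintro rfl
    rw [zero_pow two_ne_zero, eq_comm, neg_eq_zero, inv_eq_zero] at hτ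
    exact mul_ne_zero hs (pow_ne_zero 2 hb₀) hτ
  obtain ⟨c, rfl⟩ : ∃ c, b₁ = b₀ * c := ⟨b₁ / b₀, by field_simp⟩
  by_cases hc : ∀ i, c ≠ F.γ i
  · obtain ⟨l, hl⟩ := exists_form_eq_mul_self (hsymm (fun i => (c - F.γ i)⁻¹) (τ • a)) hW (by
      rintro _ ⟨p, rfl⟩ v
      rw [LinearMap.sub_apply, LinearMap.sub_apply, QuadraticMap.polarBilin_apply_apply, pencil_smul, hτ,
        sub_eq_zero, QuadraticMap.polar_comm]
      have h := hpol0 p v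
      have h2 : F.pencil (fun i => (c - F.γ i)⁻¹) a (π p) v =
          b₀ * ∑ i, F.T (F.x i * p.1.2) * F.row a i v := by
        rw [pencil_apply, Finset.mul_sum]
        refine Finset.sum_congr rfl fun i _ => ?_
        change (c - F.γ i)⁻¹ * (F.row a i p.1.1 * _) = _
        have := sub_ne_zero.2 (hc i)
        rw [hco]; field_simp
      rw [h2]
      change QuadraticMap.polar q v p.1.1 = _
      field_simp
      linear_combination h)
    exact hq.ne_pencil_add_sq (τ • a) (F.P.smul_mem _ ha) c hc l fun v w => hpol _ _ _ _ _ (hl v w)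
  · push Not at hc
    obtain ⟨k, rfl⟩ := hc
    -- At an eigenvalue the admissible w lie in the hyperplane x_k∧a∧w = 0, and there the difference
    -- of the two forms is only proportional to x_k∧a∧·, because z_k is not determined by `hco`.
    have hrow : F.row (τ • a) k ≠ 0 := row_ne_zero (F.P.smul_mem _ ha) (smul_ne_zero hτ0 ha0) k
    obtain ⟨l, hl⟩ := exists_form_eq_mul_add_mul (hsymm (fun i => (F.γ k - F.γ i)⁻¹) (τ • a)) hW hrow
      (by
        rintro _ ⟨p, rfl⟩
        rw [LinearMap.mem_ker, row_smul]
        change τ * F.row a k p.1.1 = 0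
        rw [hco]; ring) (by
      rintro _ ⟨p, rfl⟩
      refine ⟨-F.T (F.x k * p.1.2) / (b₀ * s * τ), fun v => ?_⟩
      rw [LinearMap.sub_apply, LinearMap.sub_apply, QuadraticMap.polarBilin_apply_apply, pencil_smul, hτ,
        QuadraticMap.polar_comm, row_smul]
      have h := hpol0 p v
      have h2 : F.pencil (fun i => (F.γ k - F.γ i)⁻¹) a (π p) v =
          b₀ * (∑ i, F.T (F.x i * p.1.2) * F.row a i v - F.T (F.x k * p.1.2) * F.row a k v) := by
        rw [← Finset.add_sum_erase _ _ (Finset.mem_univ k), add_sub_cancel_left, pencil_apply,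
          Finset.mul_sum, ← Finset.add_sum_erase _ _ (Finset.mem_univ k), sub_self, inv_zero, zero_mul,
          zero_add]
        refine Finset.sum_congr rfl fun i hi => ?_
        change (F.γ k - F.γ i)⁻¹ * (F.row a i p.1.1 * _) = _
        have : F.γ k - F.γ i ≠ 0 := sub_ne_zero.2 fun h =>
          Finset.ne_of_mem_erase hi (F.γ_injective h.symm)
        rw [hco]; field_simp
      rw [h2]
      change QuadraticMap.polar q v p.1.1 - _ = _
      field_simp
      linear_combination h)
    exact hq.ne_pencil_add_mul (τ • a) (F.P.smul_mem _ ha) k l fun v w => hpol _ _ _ _ _ (hl v w)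

end BivectorFrame
end Frame

/-! ### Fibres over V⁺ and V⁻, and the bound on F_v ∩ A -/

section Frame

variable {V : Type*} [AddCommGroup V] [Module ℂ V]

lemma finrank_le_of_forall_eq_zero {M N : Type*} [AddCommGroup M] [Module ℂ M] [AddCommGroup N]
    [Module ℂ N] {E : Submodule ℂ M} (f : M →ₗ[ℂ] N) {W : Submodule ℂ N} [FiniteDimensional ℂ W]
    (hW : ∀ x ∈ E, f x ∈ W) (h : ∀ x ∈ E, f x = 0 → x = 0) :
    Module.finrank ℂ E ≤ Module.finrank ℂ W := by
  refine LinearMap.finrank_le_finrank_of_injective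
    (f := (f.comp E.subtype).codRestrict W fun x => hW x x.2)
    (LinearMap.ker_eq_bot.1 ((Submodule.eq_bot_iff _).2 fun x hx => ?_))
  exact Subtype.ext (h x x.2 congr(($hx : N)))

namespace BivectorFrame

variable (F : BivectorFrame V)

/-- The bivectors killed by `a`. -/
def annihilated (a : V) : Submodule ℂ (ExteriorAlgebra ℂ V) :=
  wedgePow F.P 2 ⊓ LinearMap.ker (LinearMap.mulLeft ℂ (ι ℂ a))

/-- The bivectors `z` such that `z` and `u z` are killed by `a`. -/
def biannihilated (a : V) : Submodule ℂ (ExteriorAlgebra ℂ V) :=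
  F.annihilated a ⊓ LinearMap.ker ((LinearMap.mulLeft ℂ (ι ℂ a)).comp F.u)

variable {F}

lemma mem_annihilated {a : V} {z : ExteriorAlgebra ℂ V} :
    z ∈ F.annihilated a ↔ z ∈ wedgePow F.P 2 ∧ ι ℂ a * z = 0 := Iff.rfl

lemma mem_biannihilated {a : V} {z : ExteriorAlgebra ℂ V} :
    z ∈ F.biannihilated a ↔ (z ∈ wedgePow F.P 2 ∧ ι ℂ a * z = 0) ∧ ι ℂ a * F.u z = 0 := Iff.rfl

instance (a : V) : FiniteDimensional ℂ (F.annihilated a) :=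
  Submodule.finiteDimensional_of_le inf_le_left

instance (a : V) : FiniteDimensional ℂ (F.biannihilated a) :=
  Submodule.finiteDimensional_of_le inf_le_left

lemma finrank_annihilated_le {a : V} (ha : a ∈ F.P) (ha0 : a ≠ 0) :
    Module.finrank ℂ (F.annihilated a) ≤ 3 := by
  let L : F.P →ₗ[ℂ] ExteriorAlgebra ℂ V :=
    (LinearMap.mulLeft ℂ (ι ℂ a)).comp ((ι ℂ).comp F.P.subtype)
  have h1 := L.finrank_range_add_finrank_ker
  have h2 : 0 < Module.finrank ℂ (LinearMap.ker L) := by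
    rw [Module.finrank_pos_iff_exists_ne_zero]
    refine ⟨⟨⟨a, ha⟩, ?_⟩, fun h => ha0 congr((($h : F.P) : V))⟩
    exact ι_mul_self a
  have h3 : Module.finrank ℂ (F.annihilated a) ≤ Module.finrank ℂ (LinearMap.range L) := by
    refine Submodule.finrank_mono fun z hz => ?_
    obtain ⟨w, hw, h⟩ := exists_ι_mul_ι_eq ha0 hz.1 hz.2
    exact ⟨⟨w, hw⟩, h.symm⟩
  rw [F.finrank_P] at h1
  omega

lemma T_mul_eq_zero {a : V} (ha0 : a ≠ 0) {y z : ExteriorAlgebra ℂ V}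
    (hz : z ∈ wedgePow F.P 2) (hay : ι ℂ a * y = 0) (haz : ι ℂ a * z = 0) :
    ∑ i, F.T (F.x i * y) * F.T (F.x i * z) = 0 := by
  rw [← F.T_mul hz, mul_self_eq_zero_of_ι_mul_eq_zero ha0 hz hay haz, map_zero]

/-- All of z, uz, u²z lie in the isotropic space of bivectors divisible by a; their mutual pairings
are the moments of the squares zᵢ² of orders 0 to 4. -/
lemma sum_sq_mul_pow_eq_zero {a : V} (ha0 : a ≠ 0) {z : ExteriorAlgebra ℂ V}
    (hz : z ∈ wedgePow F.P 2) (h0 : ι ℂ a * z = 0) (h1 : ι ℂ a * F.u z = 0)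
    (h2 : ι ℂ a * F.u (F.u z) = 0) (k : ℕ) (hk : k < 5) :
    ∑ i, F.T (F.x i * z) ^ 2 * F.γ i ^ k = 0 := by
  have hu := F.u_mem
  interval_cases k
  · rw [← T_mul_eq_zero ha0 hz h0 h0]
    exact Finset.sum_congr rfl fun i _ => by ring
  · rw [← T_mul_eq_zero ha0 (hu z) h0 h1]
    exact Finset.sum_congr rfl fun i _ => by rw [T_x_mul_u]; ring
  · rw [← T_mul_eq_zero ha0 (hu z) h1 h1]
    exact Finset.sum_congr rfl fun i _ => by rw [T_x_mul_u]; ring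
  · rw [← T_mul_eq_zero ha0 (hu _) h1 h2]
    exact Finset.sum_congr rfl fun i _ => by simp only [T_x_mul_u]; ring
  · rw [← T_mul_eq_zero ha0 (hu _) h2 h2]
    exact Finset.sum_congr rfl fun i _ => by simp only [T_x_mul_u]; ring

/-- Otherwise the space of bivectors divisible by a is u-invariant. Then u³z lies in it too, the
fifth moment also vanishes, and the 6×6 Vandermonde matrix forces every zᵢ² = 0. -/
lemma finrank_biannihilated_le {a : V} (ha : a ∈ F.P) (ha0 : a ≠ 0) :
    Module.finrank ℂ (F.biannihilated a) ≤ 2 := by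
  by_contra! h3
  have heq : F.biannihilated a = F.annihilated a :=
    Submodule.eq_of_le_of_finrank_le inf_le_left ((finrank_annihilated_le ha ha0).trans (by omega))
  have hinv : ∀ z ∈ wedgePow F.P 2, ι ℂ a * z = 0 → ι ℂ a * F.u z = 0 := fun z hz h =>
    (heq ▸ mem_annihilated.2 ⟨hz, h⟩ : z ∈ F.biannihilated a).2
  obtain ⟨z, ⟨⟨hz, h0⟩, -⟩, hz0⟩ := Submodule.exists_mem_ne_zero_of_ne_bot
    (p := F.biannihilated a) fun h => by rw [h, finrank_bot] at h3; omega
  have hu := F.u_mem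
  have h1 := hinv _ hz h0
  have h2 := hinv _ (hu _) h1
  have h4 := hinv _ (hu _) h2
  have hv := Matrix.eq_zero_of_forall_pow_sum_mul_pow_eq_zero F.γ_injective
    (v := fun i => F.T (F.x i * z) ^ 2) fun k => by
      by_cases hk : k.1 < 5
      · exact sum_sq_mul_pow_eq_zero ha0 hz h0 h1 h2 k.1 hk
      · have hk : (k : ℕ) = 5 := by omega
        rw [hk]
        rw [← T_mul_eq_zero ha0 (hu _) h2 h4]
        refine Finset.sum_congr rfl fun i _ => ?_
        simp only [T_x_mul_u]
        ring
  exact hz0 (F.eq_zero_of_T_x_mul hz fun i => by simpa using congr_fun hv i)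

/-- Two copies of the space E of such bivectors map by y + u z to a space of dimension at most
three, so there is a relation uz = −y with y, z ∈ E; hence u²z is divisible by a. -/
lemma exists_mem_biannihilated {a : V} (ha : a ∈ F.P) (ha0 : a ≠ 0)
    (h : 2 ≤ Module.finrank ℂ (F.biannihilated a)) :
    ∃ z ∈ wedgePow F.P 2, z ≠ 0 ∧ ι ℂ a * z = 0 ∧ ι ℂ a * F.u z = 0 ∧ ι ℂ a * F.u (F.u z) = 0 := by
  let L : (F.biannihilated a × F.biannihilated a) →ₗ[ℂ] F.annihilated a :=
    LinearMap.codRestrict _ ((F.biannihilated a).subtype.coprod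
      (F.u.comp (F.biannihilated a).subtype))
      fun p => add_mem p.1.2.1 ⟨F.u_mem _, p.2.2.2⟩
  have hker : LinearMap.ker L ≠ ⊥ := LinearMap.ker_ne_bot_of_finrank_lt (by
    rw [Module.finrank_prod]
    have := finrank_annihilated_le ha ha0
    omega)
  obtain ⟨⟨y, z⟩, hp, hne⟩ := Submodule.exists_mem_ne_zero_of_ne_bot hker
  have hL : (y : ExteriorAlgebra ℂ V) + F.u z = 0 := congr(($(hp) : ExteriorAlgebra ℂ V))
  have hz := mem_biannihilated.1 z.2
  have hy := mem_biannihilated.1 y.2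
  refine ⟨z, z.2.1.1, fun h0 => hne ?_, hz.1.2, hz.2, ?_⟩
  · rw [h0, map_zero, add_zero] at hL
    exact Prod.ext (Subtype.ext hL) (Subtype.ext h0)
  · rw [eq_neg_of_add_eq_zero_right hL, map_neg, mul_neg, hy.2, neg_zero]

variable {q : QuadraticForm ℂ F.P} {φ : F.P →ₗ[ℂ] ExteriorAlgebra ℂ V}
  (hφ : ∀ w, φ w ∈ wedgePow F.P 3) (hinj : ∀ w, φ w = 0 → w = 0) {s : ℂ} (hs : s ≠ 0)
  (hB : ∀ v w : F.P, F.T (ι ℂ (v : V) * φ w) = s * QuadraticMap.polar q v w)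

include hφ hinj in
-- Here φ(w) = 0 forces w = 0, and z lies in an eigenspace of u, which has dimension at most one.
lemma finrank_ker_le_two_of_eq_zero (b₀ b₁ : ℂ) (hb : b₀ ≠ 0 ∨ b₁ ≠ 0) :
    Module.finrank ℂ (LinearMap.ker ((LinearMap.mulLeft ℂ (ι ℂ (0 + (b₀ • F.f 0 + b₁ • F.f 1)))).comp
      (F.param φ))) ≤ 2 := by
  set E := LinearMap.ker ((LinearMap.mulLeft ℂ (ι ℂ (0 + (b₀ • F.f 0 + b₁ • F.f 1)))).comp
      (F.param φ)) with hE
  have hEq : ∀ p : E, _ := fun p =>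
    F.ι_mul_param_eq_zero hφ (zero_mem _) b₀ b₁ (w := p.1.1) (z := p.1.2) p.2
  have hco : ∀ p : E, ∀ i, (b₁ - b₀ * F.γ i) * F.T (F.x i * p.1.2) = 0 := fun p i => by
    have := congr(F.T (F.x i * $((hEq p).1)))
    rw [map_zero, zero_mul, mul_zero, mul_sub, mul_smul_comm, mul_smul_comm, map_sub, map_smul,
      map_smul, T_x_mul_u, smul_eq_mul, smul_eq_mul, map_zero] at this
    linear_combination -this
  have hw : ∀ p : E, p.1.1 = 0 := fun p => by
    obtain ⟨-, h0, h1, -⟩ := hEq p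
    rw [map_zero, zero_mul] at h0 h1
    rcases hb with hb | hb
    · exact hinj _ ((smul_eq_zero.1 h0.symm).resolve_left hb)
    · exact hinj _ ((smul_eq_zero.1 h1.symm).resolve_left hb)
  obtain ⟨k, hk⟩ : ∃ k, ∀ i, i ≠ k → b₁ - b₀ * F.γ i ≠ 0 := by
    by_cases h : ∃ k, b₁ - b₀ * F.γ k = 0
    · obtain ⟨k, hk⟩ := h
      refine ⟨k, fun i hi h => ?_⟩
      have hb₀ : b₀ ≠ 0 := by
        rintro rfl; rw [zero_mul, sub_zero] at hk; simp [hk] at hb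
      exact hi (F.γ_injective (mul_left_cancel₀ hb₀ (by linear_combination hk - h)))
    · push Not at h
      exact ⟨0, fun i _ => h i⟩
  have := finrank_le_of_forall_eq_zero (E := E) (W := ⊤)
    ((F.T.comp ((LinearMap.mulLeft ℂ (F.x k)).comp (wedgePow F.P 2).subtype)).comp
      (LinearMap.snd ℂ F.P (wedgePow F.P 2))) (fun _ _ => trivial) fun p hp h => by
    refine Prod.ext (hw ⟨p, hp⟩) (Subtype.ext (F.eq_zero_of_T_x_mul p.2.2 fun i => ?_))
    by_cases hi : i = k
    · subst hi
      exact h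
    · exact (mul_eq_zero.1 (hco ⟨p, hp⟩ i)).resolve_left (hk i hi)
  rw [finrank_top, Module.finrank_self] at this
  omega

include hφ hs hB in
-- Now w = r a, and a∧φ(w) = 0 reads r q(a) = 0. If q(a) ≠ 0 only z remains, in a space of dimension
-- at most two. If q(a) = 0, genericity makes that space at most one-dimensional, and r adds one.
lemma finrank_ker_le_two_of_mem (hq : F.IsGeneral q) {a : V} (ha : a ∈ F.P) (ha0 : a ≠ 0) :
    Module.finrank ℂ (LinearMap.ker ((LinearMap.mulLeft ℂ (ι ℂ
      (a + ((0 : ℂ) • F.f 0 + (0 : ℂ) • F.f 1)))).comp (F.param φ))) ≤ 2 := by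
  set E := LinearMap.ker ((LinearMap.mulLeft ℂ (ι ℂ
      (a + ((0 : ℂ) • F.f 0 + (0 : ℂ) • F.f 1)))).comp (F.param φ)) with hE
  have hEq : ∀ p : E, _ := fun p => F.ι_mul_param_eq_zero hφ ha 0 0 (w := p.1.1) (z := p.1.2) p.2
  simp only [zero_smul, sub_zero] at hEq
  have hmem : ∀ p ∈ E, (p.2 : ExteriorAlgebra ℂ V) ∈ F.biannihilated a := fun p hp =>
    ⟨⟨p.2.2, (hEq ⟨p, hp⟩).2.1⟩, (hEq ⟨p, hp⟩).2.2.1⟩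
  have hra : ∀ p ∈ E, ∃ r : ℂ, (p.1 : V) = r • a := fun p hp =>
    exists_smul_of_ι_mul_ι_eq_zero ha0 (hEq ⟨p, hp⟩).1
  by_cases hqa : q ⟨a, ha⟩ = 0
  · have h1 : Module.finrank ℂ (F.biannihilated a) ≤ 1 := by
      by_contra! h
      obtain ⟨z, hz, hz0, h0, h1, h2⟩ := exists_mem_biannihilated ha ha0 h
      exact hq.apply_ne_zero ⟨a, ha⟩ (fun h => ha0 congr(($h : V))) z hz hz0 h0 h1 h2 hqa
    obtain ⟨d, hd⟩ := exists_dual_eq_one ha0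
    let ψ : (⊤ : Submodule ℂ ℂ).prod (F.biannihilated a) →ₗ[ℂ] ℂ × F.biannihilated a :=
      ((LinearMap.fst ℂ ℂ _).comp (Submodule.subtype _)).prod
        (((LinearMap.snd ℂ ℂ _).comp (Submodule.subtype _)).codRestrict _ fun x => x.2.2)
    have hψ : Function.Injective ψ := fun x y h =>
      Subtype.ext (Prod.ext congr(($h).1) congr(((($h).2 : F.biannihilated a) : ExteriorAlgebra ℂ V)))
    have := FiniteDimensional.of_injective ψ hψ
    have h2 := LinearMap.finrank_le_finrank_of_injective hψ
    rw [Module.finrank_prod, Module.finrank_self] at h2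
    have := finrank_le_of_forall_eq_zero (E := E) (W := (⊤ : Submodule ℂ ℂ).prod (F.biannihilated a))
      (((d.comp F.P.subtype).comp (LinearMap.fst ℂ F.P (wedgePow F.P 2))).prod
        ((wedgePow F.P 2).subtype.comp (LinearMap.snd ℂ F.P (wedgePow F.P 2))))
      (fun p hp => ⟨trivial, hmem p hp⟩) fun p hp h => by
      refine Prod.ext (Subtype.ext ?_) (Subtype.ext congr(($h).2))
      obtain ⟨r, hr⟩ := hra p hp
      have h1 : d (p.1 : V) = 0 := congr(($h).1)
      rw [hr, map_smul, hd, smul_eq_mul, mul_one] at h1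
      rw [hr, h1, zero_smul]; rfl
    omega
  · refine (finrank_le_of_forall_eq_zero (E := E) (W := F.biannihilated a)
      ((wedgePow F.P 2).subtype.comp (LinearMap.snd ℂ F.P (wedgePow F.P 2))) hmem
      fun p hp h => ?_).trans (finrank_biannihilated_le ha ha0)
    refine Prod.ext (Subtype.ext ?_) (Subtype.ext h)
    obtain ⟨r, hr⟩ := hra p hp
    have hw : p.1 = r • (⟨a, ha⟩ : F.P) := Subtype.ext hr
    have h2 := hB ⟨a, ha⟩ p.1
    rw [(hEq ⟨p, hp⟩).2.2.2, map_zero, hw, QuadraticMap.polar_smul_right,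
      QuadraticMap.polar_self] at h2
    have hr0 : r = 0 := by
      have := (mul_eq_zero.1 h2.symm).resolve_left hs
      simpa [hqa] using this
    rw [hr, hr0, zero_smul]; rfl

include hφ hinj hs hB in
lemma finrank_wedgeFiber_inf_le (hq : F.IsGeneral q) {A : Submodule ℂ (ExteriorAlgebra ℂ V)}
    (hA : A ≤ LinearMap.range (F.param φ)) (v : V) : Module.finrank ℂ ↥(wedgeFiber v ⊓ A) ≤ 2 := by
  by_cases hv : v = 0
  · subst hv
    have : wedgeFiber (0 : V) = ⊥ := by simp [wedgeFiber]
    rw [this, bot_inf_eq, finrank_bot]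
    norm_num
  -- Only the easy inclusion is needed: elements of F_v are killed by v.
  have hle : wedgeFiber v ⊓ A ≤ (LinearMap.ker ((LinearMap.mulLeft ℂ (ι ℂ v)).comp (F.param φ))).map
      (F.param φ) := by
    rintro _ ⟨hz, hzA⟩
    obtain ⟨p, rfl⟩ := hA hzA
    refine ⟨p, ?_, rfl⟩
    change ι ℂ v * F.param φ p = 0
    refine Submodule.mul_induction_on hz (fun x hx y _ => ?_) fun x y hx hy => by rw [mul_add, hx, hy, add_zero]
    obtain ⟨r, rfl⟩ := Submodule.mem_span_singleton.1 hx
    rw [smul_mul_assoc, mul_smul_comm, ι_mul_self_mul, smul_zero]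
  refine (Submodule.finrank_mono hle).trans ((Submodule.finrank_map_le _ _).trans ?_)
  obtain ⟨a, ha, hva⟩ := F.exists_eq_add v
  rw [hva]
  by_cases hb : F.g 0 v ≠ 0 ∨ F.g 1 v ≠ 0
  · by_cases ha0 : a = 0
    · rw [ha0]
      exact finrank_ker_le_two_of_eq_zero hφ hinj _ _ hb
    · exact finrank_ker_le_two_of_ne_zero hφ hs hB hq ha ha0 _ _ hb
  · push Not at hb
    rw [hb.1, hb.2]
    refine finrank_ker_le_two_of_mem hφ hs hB hq ha fun h => hv ?_
    rw [hva, h, hb.1, hb.2]; simp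

end BivectorFrame
end Frame

/-! ### Absence of decomposable vectors -/

section Frame

variable {V : Type*} [AddCommGroup V] [Module ℂ V]

/-- The contraction is a bivector in the span of v₁, v₂, v₃, and four vectors there have zero
product. -/
lemma wedgeContract_mul_self_eq_zero (d : Module.Dual ℂ V) (v₁ v₂ v₃ : V) :
    wedgeContract d (ι ℂ v₁ * ι ℂ v₂ * ι ℂ v₃) * wedgeContract d (ι ℂ v₁ * ι ℂ v₂ * ι ℂ v₃) = 0 := by
  have h : wedgeContract d (ι ℂ v₁ * ι ℂ v₂ * ι ℂ v₃) =
      d v₁ • (ι ℂ v₂ * ι ℂ v₃) - d v₂ • (ι ℂ v₁ * ι ℂ v₃) + d v₃ • (ι ℂ v₁ * ι ℂ v₂) := by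
    rw [mul_assoc, wedgeContract_ι_mul, wedgeContract_ι_mul, wedgeContract_ι, ← Algebra.commutes,
      ← Algebra.smul_def]
    simp only [mul_sub, mul_smul_comm]
    abel
  rw [h]
  simp only [mul_add, add_mul, mul_sub, sub_mul, smul_mul_assoc, mul_smul_comm, mul_assoc,
    ι_mul_swap_mul v₂ v₁, ι_mul_swap_mul v₃ v₁, ι_mul_swap_mul v₃ v₂,
    ι_mul_swap v₃ v₂, ι_mul_self, ι_mul_self_mul, mul_neg, mul_zero, neg_zero,
    smul_zero, add_zero, sub_zero]

/-- The component along f₀∧f₁ is the one that matters: when the square vanishes, it gives rB = x∧y.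
-/
lemma bivector_mul_self {P : Submodule ℂ V} {B : ExteriorAlgebra ℂ V} (hB : B ∈ wedgePow P 2)
    (r : ℂ) (f₀ f₁ x y : V) :
    (r • (ι ℂ f₀ * ι ℂ f₁) + B - ι ℂ f₀ * ι ℂ x - ι ℂ f₁ * ι ℂ y) *
      (r • (ι ℂ f₀ * ι ℂ f₁) + B - ι ℂ f₀ * ι ℂ x - ι ℂ f₁ * ι ℂ y) =
    ι ℂ f₀ * (ι ℂ f₁ * ((2 : ℂ) • (r • B - ι ℂ x * ι ℂ y))) + ι ℂ f₀ * ((-2 : ℂ) • (ι ℂ x * B)) +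
      ι ℂ f₁ * ((-2 : ℂ) • (ι ℂ y * B)) + B * B := by
  have h1 : ∀ v, B * ι ℂ v = ι ℂ v * B := fun v => commute_of_mem_wedgePow_two hB _
  have h2 : ∀ v z, B * (ι ℂ v * z) = ι ℂ v * (B * z) := fun v z => by
    rw [← mul_assoc, h1, mul_assoc]
  simp only [mul_add, add_mul, mul_sub, sub_mul, smul_mul_assoc, mul_smul_comm, mul_assoc, h1, h2,
    ι_mul_swap_mul f₁ f₀, ι_mul_swap_mul x f₀, ι_mul_swap_mul x f₁, ι_mul_swap_mul y f₁,
    ι_mul_swap_mul y f₀, ι_mul_swap y x, ι_mul_self, ι_mul_self_mul, mul_neg, mul_zero, neg_zero,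
    smul_zero, neg_neg, smul_sub, ι_mul_swap y f₁]
  module

namespace BivectorFrame

variable {F : BivectorFrame V} {q : QuadraticForm ℂ F.P} {φ : F.P →ₗ[ℂ] ExteriorAlgebra ℂ V}

/-- The eigenvalues being distinct, an eigenvector is a multiple of some x_k, which is not
isotropic. -/
lemma eq_zero_of_u_eq_smul {z : ExteriorAlgebra ℂ V} (hz : z ∈ wedgePow F.P 2) {c : ℂ}
    (hu : F.u z = c • z) (hzz : z * z = 0) : z = 0 := by
  by_contra hz0
  have hco : ∀ k, (F.γ k - c) * F.T (F.x k * z) = 0 := fun k => by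
    have := F.T_x_mul_u k z
    rw [hu, mul_smul_comm, map_smul, smul_eq_mul] at this
    linear_combination -this
  obtain ⟨k, hk⟩ : ∃ k, F.T (F.x k * z) ≠ 0 := by
    by_contra! h
    exact hz0 (F.eq_zero_of_T_x_mul hz h)
  have hck : F.γ k = c := sub_eq_zero.1 ((mul_eq_zero.1 (hco k)).resolve_right hk)
  have hT := F.T_mul (y := z) hz
  rw [hzz, map_zero, Finset.sum_eq_single k] at hT
  · exact hk (mul_self_eq_zero.1 hT.symm)
  · intro j _ hj
    rw [(mul_eq_zero.1 (hco j)).resolve_left (sub_ne_zero.2 fun h => hj (F.γ_injective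
      (h.trans hck.symm))), zero_mul]
  · simp

/-- A three-dimensional space meets P, which has codimension two; every vector of the span divides
v₁∧v₂∧v₃. -/
lemma exists_mem_inf_of_three (v₁ v₂ v₃ : V) (h0 : ι ℂ v₁ * ι ℂ v₂ * ι ℂ v₃ ≠ 0) :
    ∃ a ∈ F.P, a ≠ 0 ∧ ι ℂ a * (ι ℂ v₁ * ι ℂ v₂ * ι ℂ v₃) = 0 := by
  let L : ℂ × ℂ × ℂ →ₗ[ℂ] V := (LinearMap.toSpanSingleton ℂ V v₁).coprod
    ((LinearMap.toSpanSingleton ℂ V v₂).coprod (LinearMap.toSpanSingleton ℂ V v₃))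
  have hL : ∀ c, L c = c.1 • v₁ + (c.2.1 • v₂ + c.2.2 • v₃) := fun c => rfl
  have hker : LinearMap.ker (((F.g 0).prod (F.g 1)).comp L) ≠ ⊥ :=
    LinearMap.ker_ne_bot_of_finrank_lt (by simp)
  obtain ⟨c, hc, hc0⟩ := Submodule.exists_mem_ne_zero_of_ne_bot hker
  have hg0 : F.g 0 (L c) = 0 := congr(($hc).1)
  have hg1 : F.g 1 (L c) = 0 := congr(($hc).2)
  obtain ⟨a, ha, hLa⟩ := F.exists_eq_add (L c)
  rw [hg0, hg1, zero_smul, zero_smul, add_zero, add_zero] at hLa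
  refine ⟨L c, hLa ▸ ha, fun h => hc0 ?_, ?_⟩
  · rw [hL] at h
    have e1 : c.1 • (ι ℂ v₁ * ι ℂ v₂ * ι ℂ v₃) = 0 := by
      have := congrArg (fun t => ι ℂ t * (ι ℂ v₂ * ι ℂ v₃)) h
      simpa [add_mul, mul_assoc, ι_mul_self_mul, ι_mul_swap_mul v₃ v₂, ι_mul_self] using this
    have e2 : c.2.1 • (ι ℂ v₁ * ι ℂ v₂ * ι ℂ v₃) = 0 := by
      have := congrArg (fun t => ι ℂ v₁ * (ι ℂ t * ι ℂ v₃)) h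
      simpa [add_mul, mul_add, mul_assoc, ι_mul_self_mul, ι_mul_self] using this
    have e3 : c.2.2 • (ι ℂ v₁ * ι ℂ v₂ * ι ℂ v₃) = 0 := by
      have := congr(ι ℂ v₁ * (ι ℂ v₂ * ι ℂ $(h)))
      simpa [add_mul, mul_add, mul_assoc, ι_mul_self_mul, ι_mul_swap v₂ v₁, ι_mul_self] using this
    exact Prod.ext ((smul_eq_zero.1 e1).resolve_right h0)
      (Prod.ext ((smul_eq_zero.1 e2).resolve_right h0) ((smul_eq_zero.1 e3).resolve_right h0))
  · rw [hL]
    simp [add_mul, mul_assoc, ι_mul_self_mul, ι_mul_swap_mul v₂ v₁, ι_mul_swap_mul v₃ v₁,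
      ι_mul_swap_mul v₃ v₂]

/-- Linear forms restricting to the coordinates on `P` and vanishing on `f₀` and `f₁`. -/
def extCoord (F : BivectorFrame V) (i : Fin 4) : Module.Dual ℂ V :=
  F.coord i - (F.coord i (F.f 0) • F.g 0 + F.coord i (F.f 1) • F.g 1)

lemma extCoord_of_mem (i : Fin 4) {a : V} (ha : a ∈ F.P) : F.extCoord i a = F.coord i a := by
  simp [extCoord, F.g_eq_zero _ a ha]

lemma extCoord_f (i : Fin 4) (j : Fin 2) : F.extCoord i (F.f j) = 0 := by
  fin_cases j <;> simp [extCoord, F.g_f]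

variable (hφ : ∀ w, φ w ∈ wedgePow F.P 3) (hinj : ∀ w, φ w = 0 → w = 0) {s : ℂ} (hs : s ≠ 0)
  (hB : ∀ v w : F.P, F.T (ι ℂ (v : V) * φ w) = s * QuadraticMap.polar q v w)

include hφ hinj hs hB in
-- Divisibility by a gives w = ra, z = a∧x, uz = a∧y and φ(w) = a∧B, and the vanishing square gives
-- rB = x∧y. If r = 0, then x and y are proportional and z would be an isotropic eigenvector of u.
-- If r ≠ 0, the form q(·, a) is a multiple of a∧x∧y, which `ne_decomposable` excludes.
lemma eq_zero_of_wedgeContract_mul_self (hq : F.IsGeneral q) {a : V} (ha : a ∈ F.P) {i : Fin 4}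
    (hai : F.coord i a = 1) {w : F.P} {z : wedgePow F.P 2} (h : ι ℂ a * F.param φ (w, z) = 0)
    (hsq : wedgeContract (F.extCoord i) (F.param φ (w, z)) *
      wedgeContract (F.extCoord i) (F.param φ (w, z)) = 0) : F.param φ (w, z) = 0 := by
  set d := F.extCoord i with hd
  have ha0 : a ≠ 0 := by rintro rfl; simp at hai
  have hda : d a = 1 := by rw [hd, extCoord_of_mem i ha, hai]
  obtain ⟨h1, h2, h3, h4⟩ := F.ι_mul_param_eq_zero hφ ha 0 0 (w := w) (z := z) (by simpa using h)
  simp only [zero_smul, sub_zero] at h1 h2 h3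
  obtain ⟨r, hr⟩ := exists_smul_of_ι_mul_ι_eq_zero ha0 h1
  have hmk : ∀ y ∈ wedgePow F.P 2, ι ℂ a * y = 0 → ∃ x ∈ F.P, d x = 0 ∧ y = ι ℂ a * ι ℂ x := by
    intro y hy hay
    obtain ⟨x, hx, rfl⟩ := exists_ι_mul_ι_eq ha0 hy hay
    refine ⟨x - d x • a, sub_mem hx (Submodule.smul_mem _ _ ha), ?_, ?_⟩
    · rw [map_sub, map_smul, hda, smul_eq_mul, mul_one, sub_self]
    · rw [map_sub, map_smul, mul_sub, mul_smul_comm, ι_mul_self, smul_zero, sub_zero]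
  obtain ⟨x, hx, hdx, hzx⟩ := hmk z z.2 h2
  obtain ⟨y, hy, hdy, hzy⟩ := hmk _ (F.u_mem z) h3
  set B := wedgeContract d (φ w) with hBdef
  have hBm : B ∈ wedgePow F.P 2 := wedgeContract_mem d (hφ w)
  have hφB : φ w = ι ℂ a * B := eq_ι_mul_wedgeContract hda h4
  have hτ : wedgeContract d (F.param φ (w, z)) = r • (ι ℂ (F.f 0) * ι ℂ (F.f 1)) + B -
      ι ℂ (F.f 0) * ι ℂ x - ι ℂ (F.f 1) * ι ℂ y := by
    have hf : ∀ j, d (F.f j) = 0 := extCoord_f i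
    rw [param_apply, hzy, hzx, hr]
    simp only [map_add, mul_assoc, wedgeContract_ι_mul, wedgeContract_ι, hf, hda, hdx, hdy,
      map_smul, zero_smul, zero_sub, one_smul, map_zero, mul_zero, sub_zero, mul_neg, neg_neg,
      Algebra.mul_smul_comm, map_one, mul_one]
    abel
  rw [hτ, bivector_mul_self hBm] at hsq
  obtain ⟨hxy, -⟩ := eq_zero_of_two_components F.g_eq_zero F.g_f
    (Submodule.smul_mem _ _ (sub_mem (Submodule.smul_mem _ r hBm) (ι_mul_ι_mem_wedgePow hx hy)))
    (Submodule.smul_mem _ _ (ι_mul_mem_wedgePow hx hBm))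
    (Submodule.smul_mem _ _ (ι_mul_mem_wedgePow hy hBm)) (mul_mem_wedgePow hBm hBm) hsq
  replace hxy : r • B = ι ℂ x * ι ℂ y :=
    sub_eq_zero.1 ((smul_eq_zero.1 hxy).resolve_left two_ne_zero)
  by_cases hr0 : r = 0
  · have hw : w = 0 := Subtype.ext (by rw [hr, hr0, zero_smul]; rfl)
    suffices hz : (z : ExteriorAlgebra ℂ V) = 0 by
      rw [param_apply, hw, hz]; simp
    by_contra hz
    have hx0 : x ≠ 0 := by rintro rfl; exact hz (by rw [hzx, map_zero, mul_zero])
    rw [hr0, zero_smul] at hxy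
    obtain ⟨c, rfl⟩ := exists_smul_of_ι_mul_ι_eq_zero hx0 hxy.symm
    have huz : F.u z = c • (z : ExteriorAlgebra ℂ V) := by
      rw [hzy, hzx, map_smul, mul_smul_comm]
    exact hz (eq_zero_of_u_eq_smul z.2 huz (mul_self_eq_zero_of_ι_mul_eq_zero ha0 z.2 h2 h2))
  · exfalso
    -- The pairing of v∧a with x∧y is s r² times the polar form at (v, a); scaling x and y by c
    -- removes this factor.
    obtain ⟨c, hc⟩ := IsAlgClosed.exists_pow_nat_eq (s * r ^ 2)⁻¹ (n := 2) (by norm_num)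
    have hc0 : c ≠ 0 := by
      rintro rfl
      exact inv_ne_zero (mul_ne_zero hs (pow_ne_zero 2 hr0)) (by simpa using hc.symm)
    have hwa : w = r • (⟨a, ha⟩ : F.P) := Subtype.ext hr
    refine hq.ne_decomposable ⟨a, ha⟩ (c • ⟨x, hx⟩) (c • ⟨y, hy⟩) i hai ?_ ?_ ?_ ?_ fun v => ?_
    · rw [Submodule.coe_smul, ← extCoord_of_mem i (Submodule.smul_mem _ c hx)]
      exact (map_smul _ _ _).trans (by rw [← hd, hdx, smul_zero])
    · rw [Submodule.coe_smul, ← extCoord_of_mem i (Submodule.smul_mem _ c hy)]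
      exact (map_smul _ _ _).trans (by rw [← hd, hdy, smul_zero])
    · simp only [Submodule.coe_smul, map_smul, smul_mul_assoc, mul_smul_comm, ← hxy]
      refine smul_ne_zero hc0 (smul_ne_zero hc0 (smul_ne_zero hr0 fun hB0 => hr0 ?_))
      rw [hB0, mul_zero] at hφB
      have := hinj _ hφB
      rw [this] at hr
      exact (smul_eq_zero.1 hr.symm).resolve_right ha0
    · simp only [Submodule.coe_smul, map_smul, mul_smul_comm, ← hzx, ← hzy]
    · have h5 := hB v w
      rw [hφB, hwa, QuadraticMap.polar_smul_right] at h5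
      simp only [Submodule.coe_smul, map_smul, smul_mul_assoc, mul_smul_comm, ← hxy, smul_eq_mul,
        mul_assoc, h5]
      have : c ^ 2 * (s * r ^ 2) = 1 := by
        rw [hc, inv_mul_cancel₀ (mul_ne_zero hs (pow_ne_zero 2 hr0))]
      linear_combination -QuadraticMap.polar q v ⟨a, ha⟩ * this

include hφ hinj hs hB in
lemma eq_zero_of_decomposable (hq : F.IsGeneral q) {A : Submodule ℂ (ExteriorAlgebra ℂ V)}
    (hA : A ≤ LinearMap.range (F.param φ)) {v₁ v₂ v₃ : V} (h : ι ℂ v₁ * ι ℂ v₂ * ι ℂ v₃ ∈ A) :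
    ι ℂ v₁ * ι ℂ v₂ * ι ℂ v₃ = 0 := by
  by_contra h0
  obtain ⟨a, ha, ha0, hav⟩ := exists_mem_inf_of_three (F := F) v₁ v₂ v₃ h0
  obtain ⟨i, hi⟩ : ∃ i, F.coord i a ≠ 0 := by
    by_contra! hi
    exact ha0 (by rw [F.eq_sum_coord ha]; simp [hi])
  obtain ⟨⟨w, z⟩, hp⟩ := hA h
  refine h0 (hp ▸ eq_zero_of_wedgeContract_mul_self hφ hinj hs hB hq
    (a := (F.coord i a)⁻¹ • a) (Submodule.smul_mem _ _ ha) (i := i) ?_ ?_ ?_)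
  · rw [map_smul, smul_eq_mul, inv_mul_cancel₀ hi]
  · rw [hp, map_smul, smul_mul_assoc, hav, smul_zero]
  · rw [hp, wedgeContract_mul_self_eq_zero]

end BivectorFrame
end Frame

/-! ### General quadratic forms are Zariski dense -/

section Frame

open MvPolynomial

variable {V : Type*} [AddCommGroup V] [Module ℂ V]

namespace BivectorFrame

variable (F : BivectorFrame V)

/-- The bivectors `z` for which `z`, `u z` and `u (u z)` have a common linear divisor. -/
def exceptional : Set (ExteriorAlgebra ℂ V) :=
  {z | z ∈ wedgePow F.P 2 ∧ F.T (F.x 0 * z) = 1 ∧ ∃ a : F.P, a ≠ 0 ∧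
    ι ℂ (a : V) * z = 0 ∧ ι ℂ (a : V) * F.u z = 0 ∧ ι ℂ (a : V) * F.u (F.u z) = 0}

variable {F}

/-- Five moments of six numbers leave one degree of freedom, removed by the vanishing of the zeroth
number; a 5×5 Vandermonde matrix remains. -/
lemma eq_zero_of_sum_mul_pow {v : Fin 6 → ℂ} (h0 : v 0 = 0)
    (h : ∀ k < 5, ∑ i, v i * F.γ i ^ k = 0) : v = 0 := by
  have key := Matrix.eq_zero_of_forall_pow_sum_mul_pow_eq_zero
    (f := fun i : Fin 5 => F.γ i.succ) (v := fun i : Fin 5 => v i.succ)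
    (fun i j hij => Fin.succ_injective _ (F.γ_injective hij)) fun k => by
      have := h k k.2
      rwa [Fin.sum_univ_succ, h0, zero_mul, zero_add] at this
  funext i
  refine Fin.cases h0 (fun j => congr_fun key j) i

lemma T_x_zero_ne_zero {a : V} (ha0 : a ≠ 0) {z : ExteriorAlgebra ℂ V} (hz : z ∈ wedgePow F.P 2)
    (hz0 : z ≠ 0) (h0 : ι ℂ a * z = 0) (h1 : ι ℂ a * F.u z = 0) (h2 : ι ℂ a * F.u (F.u z) = 0) :
    F.T (F.x 0 * z) ≠ 0 := by
  intro h
  have := eq_zero_of_sum_mul_pow (F := F) (v := fun i => F.T (F.x i * z) ^ 2) (by simp [h])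
    (sum_sq_mul_pow_eq_zero ha0 hz h0 h1 h2)
  exact hz0 (F.eq_zero_of_T_x_mul hz fun i => by simpa using congr_fun this i)

/-- The moments and the normalisation z₀ = 1 determine all the squares zᵢ², so z is unique up to the
signs of its coordinates. -/
lemma finite_exceptional : F.exceptional.Finite := by
  rcases F.exceptional.eq_empty_or_nonempty with he | ⟨z₀, hz₀⟩
  · rw [he]; exact Set.finite_empty
  refine Set.Finite.of_injOn (f := fun z i => F.T (F.x i * z))
    (t := Set.pi Set.univ fun i => {F.T (F.x i * z₀), -F.T (F.x i * z₀)}) ?_ ?_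
    (Set.Finite.pi fun i => (Set.finite_singleton _).insert _)
  · rintro z ⟨hz, h1, a, ha, e0, e1, e2⟩ i -
    obtain ⟨hz', h1', a', ha', e0', e1', e2'⟩ := hz₀
    have := eq_zero_of_sum_mul_pow (F := F)
      (v := fun i => F.T (F.x i * z) ^ 2 - F.T (F.x i * z₀) ^ 2) (by simp [h1, h1'])
      fun k hk => by
        simp only [sub_mul, Finset.sum_sub_distrib]
        rw [sum_sq_mul_pow_eq_zero (fun h => ha (Subtype.ext h)) hz e0 e1 e2 k hk,
          sum_sq_mul_pow_eq_zero (fun h => ha' (Subtype.ext h)) hz' e0' e1' e2' k hk, sub_zero]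
    exact sq_eq_sq_iff_eq_or_eq_neg.1 (sub_eq_zero.1 (congr_fun this i))
  · intro z hz z' hz' h
    exact F.eq_of_T_x_mul_eq hz.1 hz'.1 fun i => congr_fun h i

/-- If a and b were independent, z and uz would both be multiples of a∧b, making z an isotropic
eigenvector of u. So an exceptional bivector determines its divisor up to scale. -/
lemma exists_eq_smul_of_exceptional {a b : V} (ha0 : a ≠ 0) {z : ExteriorAlgebra ℂ V}
    (hz : z ∈ wedgePow F.P 2) (hz0 : z ≠ 0) (h0 : ι ℂ a * z = 0) (h1 : ι ℂ a * F.u z = 0)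
    (h0' : ι ℂ b * z = 0) (h1' : ι ℂ b * F.u z = 0) : ∃ r : ℂ, b = r • a := by
  by_contra! hb
  obtain ⟨r, hr⟩ := exists_eq_smul_of_ι_mul_eq_zero ha0 hb hz h0 h0'
  obtain ⟨t, ht⟩ := exists_eq_smul_of_ι_mul_eq_zero ha0 hb (F.u_mem z) h1 h1'
  have hr0 : r ≠ 0 := by rintro rfl; exact hz0 (by rw [hr, zero_smul])
  have hu : F.u z = (t / r) • z := by rw [ht]; conv_rhs => rw [hr, smul_smul, div_mul_cancel₀ _ hr0]
  exact hz0 (eq_zero_of_u_eq_smul hz hu (mul_self_eq_zero_of_ι_mul_eq_zero ha0 hz h0 h0))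

variable (F) in
/-- The Gram matrix of a quadratic form on `P`. -/
def gram (q : QuadraticForm ℂ F.P) : Sym2 (Fin 4) → ℂ :=
  Sym2.lift ⟨fun j k => QuadraticMap.polar q (F.e j) (F.e k), fun _ _ => QuadraticMap.polar_comm _ _ _⟩

lemma gram_mk (q : QuadraticForm ℂ F.P) (j k : Fin 4) :
    F.gram q s(j, k) = QuadraticMap.polar q (F.e j) (F.e k) := rfl

lemma sum_gram_mul (q : QuadraticForm ℂ F.P) (j : Fin 4) (a : F.P) :
    ∑ k, F.gram q s(j, k) * F.coord k a = QuadraticMap.polar q (F.e j) a := by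
  conv_rhs => rw [← F.e.sum_repr a]
  rw [← QuadraticMap.polarBilin_apply_apply, map_sum]
  exact Finset.sum_congr rfl fun k _ => by
    rw [map_smul, smul_eq_mul, QuadraticMap.polarBilin_apply_apply, F.coord_apply, gram_mk, mul_comm]

lemma sum_sum_gram_mul (q : QuadraticForm ℂ F.P) (a : F.P) :
    ∑ j, ∑ k, F.gram q s(j, k) * F.coord k a * F.coord j a = 2 * q a := by
  simp only [← Finset.sum_mul, sum_gram_mul]
  calc _ = QuadraticMap.polarBilin q a (∑ j, F.e.repr a j • F.e j) := by
        rw [map_sum]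
        exact Finset.sum_congr rfl fun j _ => by
          rw [map_smul, smul_eq_mul, QuadraticMap.polarBilin_apply_apply, QuadraticMap.polar_comm,
            F.coord_apply, mul_comm]
    _ = 2 * q a := by
        rw [F.e.sum_repr, QuadraticMap.polarBilin_apply_apply, QuadraticMap.polar_self, two_smul,
          two_mul]

variable (F) in
-- The polynomial is the product, over the finitely many exceptional z, of q evaluated at the
-- divisor of z.
lemma exists_polynomial_apply_ne_zero : ∃ G : MvPolynomial (Sym2 (Fin 4)) ℂ, G ≠ 0 ∧
    ∀ q : QuadraticForm ℂ F.P, eval (F.gram q) G ≠ 0 → ∀ a : F.P, a ≠ 0 → ∀ z ∈ wedgePow F.P 2,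
      z ≠ 0 → ι ℂ (a : V) * z = 0 → ι ℂ (a : V) * F.u z = 0 → ι ℂ (a : V) * F.u (F.u z) = 0 →
      q a ≠ 0 := by
  have hex : ∀ z : ExteriorAlgebra ℂ V, ∃ a : F.P, z ∈ F.exceptional → a ≠ 0 ∧
    ι ℂ (a : V) * z = 0 ∧ ι ℂ (a : V) * F.u z = 0 ∧ ι ℂ (a : V) * F.u (F.u z) = 0 := fun z => by
    by_cases hz : z ∈ F.exceptional
    · obtain ⟨-, -, a, ha⟩ := hz
      exact ⟨a, fun _ => ha⟩
    · exact ⟨0, fun h => (hz h).elim⟩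
  choose a ha using hex
  let g : ExteriorAlgebra ℂ V → MvPolynomial (Sym2 (Fin 4)) ℂ := fun z =>
    ∑ j, ∑ k, X s(j, k) * C (F.coord k (a z)) * C (F.coord j (a z))
  refine ⟨∏ z ∈ F.finite_exceptional.toFinset, g z, ?_, fun q hG b hb z hz hz0 h0 h1 h2 hqb => ?_⟩
  · refine Finset.prod_ne_zero_iff.2 fun z hz h => ?_
    have ha0 := (ha z (F.finite_exceptional.mem_toFinset.1 hz)).1
    refine ha0 (Subtype.ext ?_)
    rw [F.eq_sum_coord (a z).2]
    refine Finset.sum_eq_zero fun i _ => ?_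
    -- Each factor is a nonzero polynomial: at the Gram matrix with single entry 1 in position (i,
    -- i) it takes the value of the squared i-th coordinate.
    have := congr(eval (Sym2.lift ⟨fun j k => (Pi.single i 1 : Fin 4 → ℂ) j *
      (Pi.single i 1 : Fin 4 → ℂ) k, fun _ _ => mul_comm _ _⟩) $h)
    have h2 : F.coord i (a z) * F.coord i (a z) = 0 := by
      simpa [g, Pi.single_apply, ite_and] using this
    rw [mul_self_eq_zero.1 h2, zero_smul]
  · have hT := T_x_zero_ne_zero (fun h => hb (Subtype.ext h)) hz hz0 h0 h1 h2
    obtain ⟨z', hzz⟩ : ∃ z', z' = (F.T (F.x 0 * z))⁻¹ • z := ⟨_, rfl⟩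
    have hz' : z' ∈ F.exceptional := by
      refine ⟨hzz ▸ Submodule.smul_mem _ _ hz, ?_, b, hb, ?_⟩
      · rw [hzz, mul_smul_comm, map_smul, smul_eq_mul, inv_mul_cancel₀ hT]
      · simp only [hzz, map_smul, mul_smul_comm, h0, h1, h2, smul_zero, and_self]
    obtain ⟨ha0, e0, e1, -⟩ := ha z' hz'
    have hT' := hz'.2.1
    obtain ⟨r, hr⟩ := exists_eq_smul_of_exceptional (a := (b : V)) (fun h => hb (Subtype.ext h)) hz'.1
      (fun h => by rw [h, mul_zero, map_zero] at hT'; exact zero_ne_one hT') (b := a z') (by rw [hzz, mul_smul_comm, h0, smul_zero])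
      (by rw [hzz, map_smul, mul_smul_comm, h1, smul_zero]) e0 e1
    refine hG ?_
    rw [map_prod]
    refine Finset.prod_eq_zero (F.finite_exceptional.mem_toFinset.2 hz') ?_
    have har : a z' = r • b := Subtype.ext hr
    simp only [g, map_sum, map_mul, eval_X, eval_C, sum_sum_gram_mul]
    rw [har, QuadraticMap.map_smul, hqb, smul_zero, mul_zero]

variable (F) in
-- The value `none` yields the condition `ne_pencil_add_sq'`, and `some k` yields
-- `ne_pencil_add_mul`.
lemma exists_polynomial_pencil (ω : Fin 6 → ℂ) (k : Option (Fin 6)) :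
    ∃ G : MvPolynomial (Sym2 (Fin 4)) ℂ, G ≠ 0 ∧ ∀ q : QuadraticForm ℂ F.P,
      eval (F.gram q) G ≠ 0 → ∀ a ∈ F.P, ∀ l : Module.Dual ℂ F.P,
      ¬ ∀ v w, QuadraticMap.polar q v w = F.pencil ω a v w +
        k.elim (l v * l w) fun k => F.row a k v * l w + l v * F.row a k w := by
  obtain ⟨G, hG, h⟩ := exists_polynomial_pencilForm_add_mul F.m ω (k.elim 0 F.m) (k.elim (1 / 2) 0)
  refine ⟨G, hG, fun q hq a ha l hl => hq (h _ (fun p => F.coord p a) (fun p => l (F.e p)) ?_)⟩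
  intro i j
  rw [gram_mk, hl, pencil_apply]
  congr 1
  · exact Finset.sum_congr rfl fun n _ => by rw [row_apply, row_apply, F.formRow_m ha, F.formRow_m ha]
  · cases k with
    | none => simp [formRow]; ring
    | some k => simp [F.formRow_m ha, row_apply]

variable (F) in
lemma exists_polynomial_pencil_add_sq :
    ∃ G : MvPolynomial (Sym2 (Fin 4)) ℂ, G ≠ 0 ∧ ∀ q : QuadraticForm ℂ F.P,
      eval (F.gram q) G ≠ 0 → ∀ a ∈ F.P, ∀ c, (∀ i, c ≠ F.γ i) → ∀ l : Module.Dual ℂ F.P,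
      ¬ ∀ v w, QuadraticMap.polar q v w = F.pencil (fun i => (c - F.γ i)⁻¹) a v w + l v * l w := by
  obtain ⟨G, hG, h⟩ := exists_polynomial_pencilForm_add_sq F.m F.γ
  refine ⟨G, hG, fun q hq a ha c hc l hl =>
    hq (h _ (fun p => F.coord p a) (fun p => l (F.e p)) c hc ?_)⟩
  intro i j
  rw [gram_mk, hl, pencil_apply]
  congr 1
  exact Finset.sum_congr rfl fun n _ => by rw [row_apply, row_apply, F.formRow_m ha, F.formRow_m ha]

/-- If all minors vanished, the coefficients of x∧y would be symmetric, so x∧y = y∧x = −x∧y. -/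
lemma exists_minor_ne_zero {x y : V} (hx : x ∈ F.P) (hy : y ∈ F.P) (h : ι ℂ x * ι ℂ y ≠ 0) :
    ∃ p q, F.coord p x * F.coord q y - F.coord q x * F.coord p y ≠ 0 := by
  by_contra! h0
  have key : ι ℂ x * ι ℂ y = -(ι ℂ x * ι ℂ y) := ?_
  · have h2 : (2 : ℂ) • (ι ℂ x * ι ℂ y) = 0 := by
      rw [two_smul]; nth_rw 2 [key]; exact add_neg_cancel _
    exact h ((smul_eq_zero.1 h2).resolve_left two_ne_zero)
  rw [← ι_mul_swap, F.eq_sum_coord hx, F.eq_sum_coord hy]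
  simp only [map_sum, map_smul, Finset.mul_sum, Finset.sum_mul, smul_mul_assoc, mul_smul_comm,
    smul_smul, Finset.smul_sum]
  exact Finset.sum_congr rfl fun p _ => Finset.sum_congr rfl fun q _ => by
    congr 1
    linear_combination -h0 p q

variable (F) in
lemma exists_polynomial_ne_decomposable (i p q : Fin 4) :
    ∃ G : MvPolynomial (Sym2 (Fin 4)) ℂ, G ≠ 0 ∧ ∀ Q : QuadraticForm ℂ F.P,
      eval (F.gram Q) G ≠ 0 → ∀ a x y : F.P, F.coord i a = 1 → F.coord i x = 0 → F.coord i y = 0 →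
      F.coord p x * F.coord q y - F.coord q x * F.coord p y ≠ 0 →
      ι ℂ (a : V) * ι ℂ (y : V) = F.u (ι ℂ (a : V) * ι ℂ (x : V)) →
      ¬ ∀ w : F.P, QuadraticMap.polar Q w a =
        F.T (ι ℂ (w : V) * ι ℂ (a : V) * (ι ℂ (x : V) * ι ℂ (y : V))) := by
  obtain ⟨G, hG, h⟩ := exists_polynomial_decomposable F.isOrthonormalBivectorFrame F.γ_injective i p q
  refine ⟨G, hG, fun Q hQ a x y ha hx hy hxy hu hl => hQ (h _ (fun p => F.coord p a)
    (fun p => F.coord p x) (fun p => F.coord p y) ha hx hy hxy (fun j => ?_) fun w => ?_)⟩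
  · rw [F.formVal_m a.2 y.2, F.formVal_m a.2 x.2, hu, T_x_mul_u]
  · have hw : (Pi.single w 1 : Fin 4 → ℂ) = fun p => F.coord p (F.e w) := by
      funext p; rw [F.coord_e, Pi.single_apply]; simp only [eq_comm]
    rw [sum_gram_mul, hl, F.T_mul (ι_mul_ι_mem_wedgePow x.2 y.2), hw]
    exact Finset.sum_congr rfl fun i _ => by rw [F.formVal_m (F.e w).2 a.2, F.formVal_m x.2 y.2]

variable (F) in
/-- General quadratic forms exist, and being general is implied by the nonvanishing of a nonzero
polynomial in the coefficients. -/
lemma exists_polynomial_isGeneral : ∃ G : MvPolynomial (Sym2 (Fin 4)) ℂ, G ≠ 0 ∧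
    ∀ q : QuadraticForm ℂ F.P, eval (F.gram q) G ≠ 0 → F.IsGeneral q := by
  obtain ⟨G₁, h₁, H₁⟩ := F.exists_polynomial_pencil_add_sq
  obtain ⟨G₂, h₂, H₂⟩ := F.exists_polynomial_pencil F.γ none
  choose G₃ h₃ H₃ using fun k => F.exists_polynomial_pencil (fun i => (F.γ k - F.γ i)⁻¹) (some k)
  obtain ⟨G₄, h₄, H₄⟩ := F.exists_polynomial_apply_ne_zero
  choose G₅ h₅ H₅ using F.exists_polynomial_ne_decomposable
  refine ⟨G₁ * G₂ * (∏ k, G₃ k) * G₄ * ∏ i, ∏ p, ∏ q, G₅ i p q, ?_, fun q hq => ?_⟩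
  · simp [h₁, h₂, h₃, h₄, h₅, Finset.prod_ne_zero_iff]
  · simp only [map_mul, map_prod, mul_ne_zero_iff, Finset.prod_ne_zero_iff] at hq
    obtain ⟨⟨⟨⟨e₁, e₂⟩, e₃⟩, e₄⟩, e₅⟩ := hq
    exact {
      ne_pencil_add_sq := H₁ q e₁
      ne_pencil_add_sq' := H₂ q e₂
      ne_pencil_add_mul := fun a ha k => H₃ k q (e₃ k (Finset.mem_univ k)) a ha
      apply_ne_zero := H₄ q e₄
      ne_decomposable := fun a x y i ha hx hy hxy hu => by
        obtain ⟨p, r, hpr⟩ := exists_minor_ne_zero x.2 y.2 hxy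
        exact H₅ i p r q (e₅ i (Finset.mem_univ i) p (Finset.mem_univ p) r (Finset.mem_univ r))
          a x y ha hx hy hpr hu }

lemma exists_gram_eq (S : Sym2 (Fin 4) → ℂ) : ∃ q : QuadraticForm ℂ F.P, F.gram q = S := by
  let B := Matrix.toBilin F.e (Matrix.of fun j k => S s(j, k) / 2)
  have hB : ∀ j k, B (F.e j) (F.e k) = S s(j, k) / 2 := fun j k => by
    rw [← LinearMap.BilinForm.toMatrix_apply F.e, LinearMap.BilinForm.toMatrix_toBilin, Matrix.of_apply]
  refine ⟨LinearMap.BilinMap.toQuadraticMap B, ?_⟩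
  funext t
  induction t using Sym2.ind with
  | _ j k =>
    rw [gram_mk, LinearMap.BilinMap.polar_toQuadraticMap, hB, hB, Sym2.eq_swap, add_halves]

variable (F) in
/-- An entry of the Gram matrix, as a linear functional of the quadratic form. -/
def gramFunctional (t : Sym2 (Fin 4)) : Module.Dual ℂ (QuadraticForm ℂ F.P) where
  toFun q := F.gram q t
  map_add' q q' := by
    induction t using Sym2.ind with
    | _ j k => exact QuadraticMap.polar_add q q' (F.e j) (F.e k)
  map_smul' r q := by
    induction t using Sym2.ind with
    | _ j k => exact QuadraticMap.polar_smul q r (F.e j) (F.e k)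

variable (F) in
lemma exists_isZariskiOpen_isGeneral : ∃ U : Set (QuadraticForm ℂ F.P),
    IsZariskiOpen U ∧ U.Nonempty ∧ ∀ q ∈ U, F.IsGeneral q := by
  obtain ⟨G, hG, h⟩ := F.exists_polynomial_isGeneral
  refine ⟨{q | eval (F.gram q) G ≠ 0}, ⟨{rename F.gramFunctional G}, ?_⟩, ?_, h⟩
  · ext q
    simp only [Set.mem_compl_iff, Set.mem_ofPred_eq, not_not, Set.mem_singleton_iff, forall_eq,
      eval_rename]
    rfl
  · obtain ⟨S, hS⟩ : ∃ S, eval S G ≠ 0 := by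
      by_contra! h0
      exact hG (MvPolynomial.funext fun S => by rw [h0, map_zero])
    obtain ⟨q, rfl⟩ := exists_gram_eq (F := F) S
    exact ⟨q, hS⟩

end BivectorFrame
end Frame

/-! ### From LG(⋀³V)^* to frames: A lies in LG⁰ -/

section Frame

variable {V : Type*} [AddCommGroup V] [Module ℂ V]

/-- The bases of V⁻ describing A⁺ and A⁻ may differ, but A⁺ depends on its basis only through f₀∧f₁,
which changes by a determinant. -/
lemma exists_wedge_basis_eq_smul {M : Submodule ℂ V} (f f' : Module.Basis (Fin 2) ℂ M) :
    ∃ δ : ℂ, δ ≠ 0 ∧ ι ℂ (f' 0 : V) * ι ℂ (f' 1 : V) = δ • (ι ℂ (f 0 : V) * ι ℂ (f 1 : V)) := by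
  have h : ∀ i, (f' i : V) = f.repr (f' i) 0 • (f 0 : V) + f.repr (f' i) 1 • (f 1 : V) := fun i => by
    have := congr(($(f.sum_repr (f' i)) : V))
    simp only [Fin.sum_univ_two, Submodule.coe_add, Submodule.coe_smul] at this
    exact this.symm
  have hδ : ι ℂ (f' 0 : V) * ι ℂ (f' 1 : V) =
      (f.repr (f' 0) 0 * f.repr (f' 1) 1 - f.repr (f' 0) 1 * f.repr (f' 1) 0) •
        (ι ℂ (f 0 : V) * ι ℂ (f 1 : V)) := by
    rw [h 0, h 1]
    simp only [map_add, map_smul, mul_add, add_mul, smul_mul_assoc, mul_smul_comm, ι_mul_self,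
      ι_mul_swap (f 1 : V) (f 0 : V), smul_zero]
    module
  refine ⟨_, fun h0 => ?_, hδ⟩
  rw [h0, zero_smul] at hδ
  have h0' : (f' 0 : V) ≠ 0 := fun h => f'.ne_zero 0 (Subtype.ext h)
  obtain ⟨r, hr⟩ := exists_smul_of_ι_mul_ι_eq_zero h0' hδ
  have hr' : f' 1 = r • f' 0 := Subtype.ext hr
  have := congr(f'.repr $hr' 1)
  simp at this

lemma mul_ι_mul_ι_mul (v w : V) (y z : ExteriorAlgebra ℂ V) :
    y * (ι ℂ v * (ι ℂ w * z)) = ι ℂ v * (ι ℂ w * (y * z)) := by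
  rw [← mul_assoc (ι ℂ v), ← mul_assoc, ← commute_of_mem_wedgePow_two (P := ⊤)
    (ι_mul_ι_mem_wedgePow trivial trivial), mul_assoc, mul_assoc]

namespace BivectorFrame

variable (F : BivectorFrame V)

lemma eq_zero_of_f_mul {n : ℕ} {z : ExteriorAlgebra ℂ V} (hz : z ∈ wedgePow F.P n)
    (h : ι ℂ (F.f 0) * (ι ℂ (F.f 1) * z) = 0) : z = 0 :=
  (eq_zero_of_two_components F.g_eq_zero F.g_f hz (zero_mem (wedgePow F.P 0))
    (zero_mem (wedgePow F.P 0)) (zero_mem (wedgePow F.P 0)) (by simpa using h)).1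

variable {F}

/-- Passes from A to the frame: φ is rescaled by δ⁻¹ to ψ, the condition A⁺ ∩ (⋀²V⁻ ⊗ V⁺) = 0 makes
ψ injective, and isotropy of A⁺ makes v∧ψ(w) symmetric, hence a multiple of the polarisation of q.
-/
theorem mem_LGZero_of_isGeneral {A Ap Am : Submodule ℂ (ExteriorAlgebra ℂ V)} (hA : IsLagrangian A)
    (hsup : A = Ap ⊔ Am) {M : Submodule ℂ V} (hf : ∀ i, F.f i ∈ M)
    (hAp : Ap ⊓ (wedgePow M 2 * wedgePow F.P 1) = ⊥)
    (hAm : ∀ a, a ∈ Am ↔ ∃ x : wedgePow F.P 2,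
      a = ι ℂ (F.f 0) * (x : ExteriorAlgebra ℂ V) + ι ℂ (F.f 1) * F.u x)
    {f' : Fin 2 → V} {δ : ℂ} (hδ : δ ≠ 0)
    (hf' : ι ℂ (f' 0) * ι ℂ (f' 1) = δ • (ι ℂ (F.f 0) * ι ℂ (F.f 1)))
    {φ : F.P →ₗ[ℂ] wedgePow F.P 3} {η : ExteriorAlgebra ℂ V} {q : QuadraticForm ℂ F.P}
    (hφ : ∀ a, a ∈ Ap ↔ ∃ v : F.P, a = ι ℂ (f' 0) * ι ℂ (f' 1) * ι ℂ (v : V) + φ v)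
    (hη : η ∈ wedgePow F.P 4) (hη0 : η ≠ 0)
    (hq : ∀ v : F.P, ι ℂ (v : V) * (φ v : ExteriorAlgebra ℂ V) = q v • η) (hqg : F.IsGeneral q) :
    A ∈ LGZero V := by
  let ψ : F.P →ₗ[ℂ] ExteriorAlgebra ℂ V := δ⁻¹ • (wedgePow F.P 3).subtype.comp φ
  have hψφ : ∀ v, (φ v : ExteriorAlgebra ℂ V) = δ • ψ v := fun v => by
    simp [ψ, smul_smul, mul_inv_cancel₀ hδ]
  have hψ : ∀ w, ψ w ∈ wedgePow F.P 3 := fun w => Submodule.smul_mem _ _ (φ w).2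
  have hmem : ∀ v : F.P, ι ℂ (F.f 0) * ι ℂ (F.f 1) * ι ℂ (v : V) + ψ v ∈ Ap := fun v =>
    (hφ _).2 ⟨δ⁻¹ • v, by
      rw [hψφ, hf', map_smul, smul_smul, mul_inv_cancel₀ hδ, one_smul, Submodule.coe_smul, map_smul,
        mul_smul_comm, smul_mul_assoc, smul_smul, inv_mul_cancel₀ hδ, one_smul]⟩
  have hinj : ∀ w, ψ w = 0 → w = 0 := fun w hw => by
    have h1 := hmem w
    rw [hw, add_zero] at h1
    have h2 : ι ℂ (F.f 0) * ι ℂ (F.f 1) * ι ℂ (w : V) ∈ Ap ⊓ (wedgePow M 2 * wedgePow F.P 1) :=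
      ⟨h1, Submodule.mul_mem_mul (ι_mul_ι_mem_wedgePow (hf 0) (hf 1)) (ι_mem_wedgePow w.2)⟩
    rw [hAp, Submodule.mem_bot, mul_assoc] at h2
    have h3 := F.eq_zero_of_f_mul (ι_mem_wedgePow w.2) h2
    exact Subtype.ext (by simpa using h3)
  have hle : Ap ≤ A := hsup ▸ le_sup_left
  have hsymm : ∀ v w : F.P, ι ℂ (v : V) * ψ w = ι ℂ (w : V) * ψ v := fun v w => by
    have h1 := ((hA.2 _ (hA.1 (hle (hmem v)))).1 (hle (hmem v))) _ (hle (hmem w))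
    have h3 : ∀ y : F.P, ι ℂ (y : V) * ψ v = -(ψ v * ι ℂ (y : V)) := fun y => by
      rw [ι_mul_comm_of_mem _ (hψ v)]; norm_num
    have h2 : ι ℂ (F.f 0) * (ι ℂ (F.f 1) * (ι ℂ (v : V) * ψ w - ι ℂ (w : V) * ψ v)) +
        ι ℂ (F.f 0) * 0 + ι ℂ (F.f 1) * 0 + ψ v * ψ w = 0 := by
      refine Eq.trans ?_ h1
      simp only [h3 w, mul_add, add_mul, mul_assoc, ι_mul_swap_mul (v : V) (F.f 0), mul_neg,
        ι_mul_self_mul, ι_mul_swap_mul (F.f 1) (F.f 0), mul_zero, neg_zero, mul_sub,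
        mul_ι_mul_ι_mul (F.f 0) (F.f 1) (ψ v)]
      abel
    exact sub_eq_zero.1 (eq_zero_of_two_components F.g_eq_zero F.g_f
      (sub_mem (ι_mul_mem_wedgePow v.2 (hψ w)) (ι_mul_mem_wedgePow w.2 (hψ v)))
      (zero_mem (wedgePow F.P 0)) (zero_mem (wedgePow F.P 0)) (mul_mem_wedgePow (hψ v) (hψ w)) h2).1
  have hTη : F.T η ≠ 0 := fun h => hη0 (F.eq_zero_of_T η hη h)
  -- The 2 comes from polar(q)(v, v) = 2q(v), and δ from the change of basis of V⁻.
  have hB : ∀ v w : F.P, F.T (ι ℂ (v : V) * ψ w) = F.T η / (2 * δ) * QuadraticMap.polar q v w := by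
    intro v w
    have hq' : ∀ v : F.P, δ * F.T (ι ℂ (v : V) * ψ v) = q v * F.T η := fun v => by
      have := congr(F.T $(hq v))
      rwa [hψφ, mul_smul_comm, map_smul, map_smul, smul_eq_mul, smul_eq_mul] at this
    have h1 := hq' (v + w)
    simp only [Submodule.coe_add, map_add, add_mul, mul_add, hsymm w v] at h1
    rw [QuadraticMap.polar]
    field_simp
    linear_combination h1 - hq' v - hq' w
  have hs : F.T η / (2 * δ) ≠ 0 := div_ne_zero hTη (mul_ne_zero two_ne_zero hδ)
  have hrange : A ≤ LinearMap.range (F.param ψ) := by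
    rw [hsup]
    refine sup_le (fun a ha => ?_) fun a ha => ?_
    · obtain ⟨v, rfl⟩ := (hφ a).1 ha
      refine ⟨(δ • v, 0), ?_⟩
      rw [param_apply, hf', hψφ, map_smul]
      simp
    · obtain ⟨x, rfl⟩ := (hAm a).1 ha
      exact ⟨(0, x), by rw [param_apply]; simp⟩
  exact ⟨hA, fun v₁ v₂ v₃ h => eq_zero_of_decomposable hψ hinj hs hB hqg hrange h,
    finrank_wedgeFiber_inf_le hψ hinj hs hB hqg hrange⟩

end BivectorFrame

lemma exists_bivectorFrame {P M : Submodule ℂ V} (hPM : IsCompl P M) (hP : Module.finrank ℂ P = 4)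
    (f : Module.Basis (Fin 2) ℂ M) (u : Module.End ℂ (wedgePow P 2))
    {A : Submodule ℂ (ExteriorAlgebra ℂ V)} (hA : IsLagrangian A)
    (hu : ∀ x : wedgePow P 2, ι ℂ (f 0 : V) * (x : ExteriorAlgebra ℂ V) +
      ι ℂ (f 1 : V) * (u x : ExteriorAlgebra ℂ V) ∈ A)
    (h6 : {μ : ℂ | u.HasEigenvalue μ}.ncard = 6) :
    ∃ F : BivectorFrame V, F.P = P ∧ (∀ i, F.f i = f i) ∧
      ∀ x : wedgePow P 2, F.u x = u x := by
  have hfd : FiniteDimensional ℂ P := Module.finite_of_finrank_pos (by omega)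
  obtain ⟨T, -, hT⟩ := exists_top_functional (Module.finBasisOfFinrankEq ℂ P hP)
  let π : V →ₗ[ℂ] M := M.projectionOnto P hPM.symm
  have hker : LinearMap.ker π = P := Submodule.ker_projectionOnto _
  have hπ : ∀ w : M, π w = w := Submodule.projectionOnto_apply_left _
  let g : Fin 2 → Module.Dual ℂ V := fun i => (f.coord i).comp π
  have hgP : ∀ i, ∀ v ∈ P, g i v = 0 := fun i v hv => by
    have : π v = 0 := by rwa [← LinearMap.mem_ker, hker]
    simp [g, this]
  have hgf : ∀ i j, g i (f j) = if i = j then 1 else 0 := fun i j => by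
    simp [g, hπ, Finsupp.single_apply, eq_comm]
  -- The product of f₀x + f₁u(x) and f₀y + f₁u(y) is f₀∧f₁∧(x∧u(y) − u(x)∧y), and A is isotropic: u
  -- is self-adjoint.
  have hsa : ∀ x y : wedgePow P 2, (x : ExteriorAlgebra ℂ V) * u y = (u x : ExteriorAlgebra ℂ V) * y := by
    intro x y
    have h1 := ((hA.2 _ (hA.1 (hu x))).1 (hu x)) _ (hu y)
    have hx : ∀ v z, (x : ExteriorAlgebra ℂ V) * (ι ℂ v * z) = ι ℂ v * ((x : ExteriorAlgebra ℂ V) * z) := fun v z => by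
      rw [← mul_assoc, commute_of_mem_wedgePow_two x.2, mul_assoc]
    have hux : ∀ v z, (u x : ExteriorAlgebra ℂ V) * (ι ℂ v * z) = ι ℂ v * ((u x : ExteriorAlgebra ℂ V) * z) := fun v z => by
      rw [← mul_assoc, commute_of_mem_wedgePow_two (u x).2, mul_assoc]
    refine sub_eq_zero.1 (eq_zero_of_two_components (f := fun i => (f i : V)) hgP hgf
      (sub_mem (mul_mem_wedgePow x.2 (u y).2) (mul_mem_wedgePow (u x).2 y.2))
      (zero_mem (wedgePow P 0)) (zero_mem (wedgePow P 0)) (zero_mem (wedgePow P 0)) ?_).1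
    refine Eq.trans ?_ h1
    simp only [mul_add, add_mul, mul_assoc, hx, hux, ι_mul_self_mul, mul_sub, mul_zero,
      ι_mul_swap_mul (f 1 : V) (f 0 : V)]
    abel
  obtain ⟨γ, x, hγ, hux, hxx, hsum⟩ := exists_orthonormal_eigenbasis hP hT u
    (fun x y => by rw [hsa]) h6
  have hsum' : ∀ z ∈ wedgePow P 2, z = ∑ i, T ((x i : ExteriorAlgebra ℂ V) * z) • (x i : ExteriorAlgebra ℂ V) :=
    fun z hz => by simpa using congr(($(hsum ⟨z, hz⟩) : ExteriorAlgebra ℂ V))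
  refine ⟨{
    P := P
    e := Module.finBasisOfFinrankEq ℂ P hP
    f := fun i => f i
    g := g
    g_eq_zero := hgP
    g_f := hgf
    exists_eq_add := fun v => ?_
    T := T
    eq_zero_of_T := hT
    γ := γ
    γ_injective := hγ
    x := fun i => x i
    x_mem := fun i => (x i).2
    T_x_mul_x := hxx
    eq_sum := hsum' }, rfl, fun _ => rfl, fun z => ?_⟩
  · refine ⟨v - π v, ?_, ?_⟩
    · rw [← hker, LinearMap.mem_ker, map_sub, hπ, sub_self]
    · have := congr(($(f.sum_repr (π v)) : V))
      simp only [Fin.sum_univ_two, Submodule.coe_add, Submodule.coe_smul] at this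
      change v = v - π v + (f.repr (π v) 0 • (f 0 : V) + f.repr (π v) 1 • (f 1 : V))
      rw [this, sub_add_cancel]
  · rw [BivectorFrame.u_apply]
    conv_rhs => rw [hsum z, map_sum]
    simp [hux, smul_smul, mul_comm]

/-- The defining data f and u of the frame describe A₀⁻ alone, so one frame, and one open set,
serves every A with the same minus part. -/
theorem exists_isZariskiOpen_mem_LGZero {σ : V →ₗ[ℂ] V} (hσ : σ ∘ₗ σ = LinearMap.id)
    (hplus : Module.finrank ℂ (plusSpace σ) = 4) {A₀ : Submodule ℂ (ExteriorAlgebra ℂ V)}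
    (hA₀ : A₀ ∈ LGStar σ) :
    ∃ U : Set (QuadraticForm ℂ (plusSpace σ)), IsZariskiOpen U ∧ U.Nonempty ∧
      ∀ A ∈ LGStar σ, minusPart σ A = minusPart σ A₀ → ∀ q ∈ U, IsQuadricEquation σ A q →
        A ∈ LGZero V := by
  have hσ' : ∀ v, σ (σ v) = v := fun v => congr($hσ v)
  have hPM : IsCompl (plusSpace σ) (minusSpace σ) := by
    refine IsCompl.of_eq ((Submodule.eq_bot_iff _).2 fun v hv => ?_) ((Submodule.eq_top_iff').2 fun v => ?_)
    · have h1 := Module.End.mem_eigenspace_iff.1 hv.1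
      have h2 := Module.End.mem_eigenspace_iff.1 hv.2
      rw [one_smul] at h1
      rw [h1, neg_one_smul] at h2
      have h3 : (2 : ℂ) • v = 0 := by rw [two_smul]; nth_rw 1 [h2]; exact neg_add_cancel v
      exact (smul_eq_zero.1 h3).resolve_left two_ne_zero
    · refine Submodule.mem_sup.2 ⟨(2⁻¹ : ℂ) • (v + σ v), ?_, (2⁻¹ : ℂ) • (v - σ v), ?_, by module⟩
      · rw [Module.End.mem_eigenspace_iff, map_smul, map_add, hσ']; module
      · rw [Module.End.mem_eigenspace_iff, map_smul, map_sub, hσ']; module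
  obtain ⟨hlag, -, -, -, f, u, -, hu, h6, -⟩ := hA₀
  obtain ⟨F, hF, hFf, hFu⟩ := exists_bivectorFrame hPM hplus f u hlag
    (fun x => ((hu _).2 ⟨x, rfl⟩).1) h6
  simp only [LGStar, IsQuadricEquation, minusPart, plusPart] at hu ⊢
  -- Making `plusSpace σ` a variable allows it to be replaced by `F.P` everywhere, with no transport
  -- along an equality.
  generalize plusSpace σ = P at *
  subst hF
  obtain ⟨U, hU, hne, hgen⟩ := F.exists_isZariskiOpen_isGeneral
  refine ⟨U, hU, hne, ?_⟩
  rintro A ⟨hA, hsup, -, hAp, -⟩ hmin q hq ⟨f', φ, η, hφ, hη, hη0, hqη⟩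
  obtain ⟨δ, hδ, hff⟩ := exists_wedge_basis_eq_smul f f'
  refine BivectorFrame.mem_LGZero_of_isGeneral (F := F) (f' := fun i => f' i) hA hsup
    (M := minusSpace σ) (fun i => hFf i ▸ (f i).2) hAp ?_ hδ ?_ hφ hη hη0 hqη (hgen q hq)
  · rw [hmin]
    intro a
    rw [hu]
    simp only [hFf, hFu]
  · rw [hFf, hFf]; exact hff

end Frame

/-! ### Infinitesimal criterion for smoothness at closed points -/

section Lifting

open Algebra

/-- Nullstellensatz: the residue field is finite over ℂ, hence equal to ℂ. -/
lemma exists_algHom_ker_eq {S : Type*} [CommRing S] [Algebra ℂ S] [Algebra.FiniteType ℂ S]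
    (m : Ideal S) [m.IsMaximal] : ∃ π : S →ₐ[ℂ] ℂ, RingHom.ker π = m := by
  let := Ideal.Quotient.field m
  have hfin : Module.Finite ℂ (S ⧸ m) := finite_of_finite_type_of_isJacobsonRing ℂ (S ⧸ m)
  have hb := IsAlgClosed.algebraMap_bijective_of_isIntegral (k := ℂ) (K := S ⧸ m)
  let e : ℂ ≃ₐ[ℂ] S ⧸ m := AlgEquiv.ofBijective (Algebra.ofId ℂ (S ⧸ m)) hb
  refine ⟨(e.symm : S ⧸ m →ₐ[ℂ] ℂ).comp (Ideal.Quotient.mkₐ ℂ m), ?_⟩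
  ext a
  simp [RingHom.mem_ker, Ideal.Quotient.eq_zero_iff_mem]

/-- Let O be the local ring of Q at the point and K the kernel of its map onto the local ring of
Q/I. Lifting the tautological map Q → O/K² to one that kills I gives a section of O/K² onto the
local ring, and such a splitting characterises formal smoothness. -/
lemma mem_smoothLocus_of_lifting {Q : Type} [CommRing Q] [Algebra ℂ Q] [Algebra.FormallySmooth ℂ Q]
    [Algebra.FiniteType ℂ Q] {I : Ideal Q}
    (H : ∀ {B : Type} [CommRing B] [Algebra ℂ B] (π : B →ₐ[ℂ] ℂ), (∀ b, π b ≠ 0 → IsUnit b) →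
      ∀ J : Ideal B, (∀ a ∈ J, ∀ b ∈ J, a * b = 0) → ∀ f : Q →ₐ[ℂ] B, (∀ q ∈ I, f q ∈ J) →
      ∃ f' : Q →ₐ[ℂ] B, (∀ q, f' q - f q ∈ J) ∧ ∀ q ∈ I, f' q = 0)
    (m : Ideal (Q ⧸ I)) [m.IsMaximal] : Algebra.IsSmoothAt ℂ m := by
  obtain ⟨ev, hev⟩ := exists_algHom_ker_eq m
  let M := m.comap (Ideal.Quotient.mk I)
  have hM : ∀ q, q ∈ M ↔ ev (Ideal.Quotient.mk I q) = 0 := fun q => by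
    rw [← RingHom.mem_ker, hev]; rfl
  let O := Localization.AtPrime M
  let Sm := Localization.AtPrime m
  have : Algebra.FormallySmooth Q O := Algebra.FormallySmooth.of_isLocalization M.primeCompl
  have : Algebra.FormallySmooth ℂ O := Algebra.FormallySmooth.comp ℂ Q O
  let ψ₀ : Q →ₐ[ℂ] Sm := (IsScalarTower.toAlgHom ℂ (Q ⧸ I) Sm).comp (Ideal.Quotient.mkₐ ℂ I)
  have hψ₀ : ∀ q, ψ₀ q = algebraMap (Q ⧸ I) Sm (Ideal.Quotient.mk I q) := fun _ => rfl
  have hψu : ∀ y : M.primeCompl, IsUnit (ψ₀ y) := fun y =>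
    IsLocalization.map_units Sm (⟨Ideal.Quotient.mk I y, y.2⟩ : m.primeCompl)
  let ψ : O →ₐ[ℂ] Sm := IsLocalization.liftAlgHom (M := M.primeCompl) hψu
  have hψ : ∀ q, ψ (algebraMap Q O q) = ψ₀ q := fun q => IsLocalization.lift_eq _ q
  have hsurj : Function.Surjective ψ := fun z => by
    obtain ⟨a, s, rfl⟩ := IsLocalization.exists_mk'_eq m.primeCompl z
    obtain ⟨q, rfl⟩ := Ideal.Quotient.mk_surjective a
    obtain ⟨r, hr⟩ := Ideal.Quotient.mk_surjective s.1
    have hrM : r ∈ M.primeCompl := fun h => s.2 (hr ▸ h)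
    refine ⟨IsLocalization.mk' O q ⟨r, hrM⟩, ?_⟩
    rw [IsLocalization.eq_mk'_iff_mul_eq, ← hr, ← hψ₀, ← hψ, ← map_mul]
    exact (congrArg ψ (IsLocalization.mk'_spec O q ⟨r, hrM⟩)).trans ((hψ q).trans (hψ₀ q))
  have hevu : ∀ y : M.primeCompl, IsUnit (ev.comp (Ideal.Quotient.mkₐ ℂ I) y) := fun y =>
    isUnit_iff_ne_zero.2 fun h => y.2 ((hM y).2 h)
  let π₀ : O →ₐ[ℂ] ℂ := IsLocalization.liftAlgHom (M := M.primeCompl) hevu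
  have hπ₀ : ∀ q, π₀ (algebraMap Q O q) = ev (Ideal.Quotient.mk I q) := fun q =>
    IsLocalization.lift_eq _ q
  have hπ₀u : ∀ b, π₀ b ≠ 0 → IsUnit b := fun b hb => by
    obtain ⟨q, s, rfl⟩ := IsLocalization.exists_mk'_eq M.primeCompl b
    refine (IsLocalization.AtPrime.isUnit_mk'_iff O M q s).2 fun hq => hb ?_
    have h1 : π₀ (IsLocalization.mk' O q s) * π₀ (algebraMap Q O s) = 0 := by
      rw [← map_mul, IsLocalization.mk'_spec, hπ₀]
      exact (hM q).1 hq
    refine (mul_eq_zero.1 h1).resolve_right fun h => s.2 ((hM s).2 ?_)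
    rw [← hπ₀, h]
  have hker : ∀ b, ψ b = 0 → π₀ b = 0 := fun b hb => by
    by_contra h
    exact not_isUnit_zero (hb ▸ (hπ₀u b h).map ψ)
  let K := RingHom.ker ψ.toRingHom
  have hKπ : ∀ b ∈ K ^ 2, π₀ b = 0 := fun b hb =>
    hker b (Ideal.pow_le_self two_ne_zero hb)
  let π : (O ⧸ K ^ 2) →ₐ[ℂ] ℂ := Ideal.Quotient.liftₐ (K ^ 2) π₀ hKπ
  let J : Ideal (O ⧸ K ^ 2) := RingHom.ker ψ.kerSquareLift
  have hlift : ∀ b, ψ.kerSquareLift (Ideal.Quotient.mk _ b) = ψ b := fun _ => rfl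
  have hJ : ∀ a ∈ J, ∀ b ∈ J, a * b = 0 := fun a ha b hb => by
    obtain ⟨a, rfl⟩ := Ideal.Quotient.mk_surjective a
    obtain ⟨b, rfl⟩ := Ideal.Quotient.mk_surjective b
    rw [← map_mul, Ideal.Quotient.eq_zero_iff_mem, pow_two]
    exact Ideal.mul_mem_mul ha hb
  have hJπ : ∀ a ∈ J, π a = 0 := fun a ha => by
    obtain ⟨a, rfl⟩ := Ideal.Quotient.mk_surjective a
    exact hker a ha
  have hπu : ∀ b, π b ≠ 0 → IsUnit b := fun b hb => by
    obtain ⟨b, rfl⟩ := Ideal.Quotient.mk_surjective b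
    exact (hπ₀u b hb).map (Ideal.Quotient.mk _)
  let f : Q →ₐ[ℂ] O ⧸ K ^ 2 := (Ideal.Quotient.mkₐ ℂ (K ^ 2)).comp (IsScalarTower.toAlgHom ℂ Q O)
  have hf : ∀ q, ψ.kerSquareLift (f q) = ψ₀ q := fun q => (hlift _).trans (hψ q)
  obtain ⟨f', hf', hfI⟩ := H π hπu J hJ f fun q hq => by
    change ψ.kerSquareLift (f q) = 0
    rw [hf, hψ₀, Ideal.Quotient.eq_zero_iff_mem.2 hq, map_zero]
  let g₀ : (Q ⧸ I) →ₐ[ℂ] O ⧸ K ^ 2 := Ideal.Quotient.liftₐ I f' hfI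
  have hg₀u : ∀ y : m.primeCompl, IsUnit (g₀ y) := fun y => by
    obtain ⟨q, hq⟩ := Ideal.Quotient.mk_surjective y.1
    rw [← hq]
    change IsUnit (f' q)
    refine hπu _ ?_
    have h1 := hJπ _ (hf' q)
    rw [map_sub, sub_eq_zero] at h1
    rw [h1]
    change π₀ (algebraMap Q O q) ≠ 0
    rw [hπ₀, ne_eq, ← hM]
    intro h
    exact y.2 (hq ▸ h)
  let g : Sm →ₐ[ℂ] O ⧸ K ^ 2 := IsLocalization.liftAlgHom (M := m.primeCompl) hg₀u
  refine Algebra.FormallySmooth.of_split ψ g ?_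
  refine AlgHom.coe_ringHom_injective (IsLocalization.ringHom_ext m.primeCompl
    (Ideal.Quotient.ringHom_ext (RingHom.ext fun q => ?_)))
  have h1 : g (algebraMap (Q ⧸ I) Sm (Ideal.Quotient.mk I q)) = f' q := IsLocalization.lift_eq _ _
  change ψ.kerSquareLift (g (algebraMap (Q ⧸ I) Sm (Ideal.Quotient.mk I q))) =
    algebraMap (Q ⧸ I) Sm (Ideal.Quotient.mk I q)
  rw [h1, ← hψ₀, ← hf, ← sub_eq_zero, ← map_sub]
  exact hf' q

/-- A quotient of a smooth algebra is smooth if the corresponding points over local square-zero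
extensions with residue field `ℂ` lift. -/
theorem smooth_quotient_of_lifting {Q : Type} [CommRing Q] [Algebra ℂ Q]
    [Algebra.FormallySmooth ℂ Q] [Algebra.FinitePresentation ℂ Q] {I : Ideal Q} (hI : I.FG)
    (H : ∀ {B : Type} [CommRing B] [Algebra ℂ B] (π : B →ₐ[ℂ] ℂ), (∀ b, π b ≠ 0 → IsUnit b) →
      ∀ J : Ideal B, (∀ a ∈ J, ∀ b ∈ J, a * b = 0) → ∀ f : Q →ₐ[ℂ] B, (∀ q ∈ I, f q ∈ J) →
      ∃ f' : Q →ₐ[ℂ] B, (∀ q, f' q - f q ∈ J) ∧ ∀ q ∈ I, f' q = 0) :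
    Algebra.Smooth ℂ (Q ⧸ I) := by
  have : Algebra.FinitePresentation ℂ (Q ⧸ I) := Algebra.FinitePresentation.quotient hI
  refine ⟨Algebra.smoothLocus_eq_univ_iff.1 (Set.eq_univ_of_forall fun p => ?_), this⟩
  -- Closed points suffice: the smooth locus is open and every point specialises to a closed one.
  obtain ⟨m, hm, hpm⟩ := p.asIdeal.exists_le_maximal p.2.ne_top
  have hmem : (⟨m, hm.isPrime⟩ : PrimeSpectrum (Q ⧸ I)) ∈ Algebra.smoothLocus ℂ (Q ⧸ I) :=
    mem_smoothLocus_of_lifting H m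
  have hsp : p ⤳ ⟨m, hm.isPrime⟩ := (PrimeSpectrum.le_iff_specializes _ _).1 hpm
  exact hsp.mem_open Algebra.isOpen_smoothLocus hmem

instance : Algebra.FormallySmooth ℂ (MvPolynomial PairIdx (MvPolynomial (Fin 5) ℂ)) :=
  Algebra.FormallySmooth.comp ℂ (MvPolynomial (Fin 5) ℂ) _

instance : Algebra.FinitePresentation ℂ (MvPolynomial PairIdx (MvPolynomial (Fin 5) ℂ)) :=
  Algebra.FinitePresentation.trans ℂ (MvPolynomial (Fin 5) ℂ) _

end Lifting

/-! ### The equations of the double cover: base change and Schur complement -/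

section System

open Matrix

variable {n ρ κ : Type*} [Fintype n] [DecidableEq n] [Fintype ρ] [DecidableEq ρ] [Fintype κ]
  [DecidableEq κ] {B : Type*} [CommRing B]

/-- The equations of a point of the double cover attached to the matrices of `λ` and `ω`. -/
structure IsSolution (lam Om : Matrix n n B) (t : n → B) : Prop where
  det_eq_zero : lam.det = 0
  transpose_mulVec : lamᵀ *ᵥ t = 0
  vecMulVec_eq : vecMulVec t t = Om * lam.adjugate

lemma adjugate_eq_of_mul_eq_one {U Ui : Matrix n n B} (hU : U * Ui = 1) (hd : U.det = 1) :
    U.adjugate = Ui := by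
  have h := U.adjugate_mul
  rw [hd, one_smul] at h
  rw [← Matrix.mul_one U.adjugate, ← hU, ← Matrix.mul_assoc, h, Matrix.one_mul]

/-- Here t and the rows of Ω transform contragrediently to the rows of λ. Determinant one avoids
scalar factors in the adjugate. -/
lemma IsSolution.transform {lam Om : Matrix n n B} {t : n → B} (h : IsSolution lam Om t)
    {U Ui U' : Matrix n n B} (hU : U * Ui = 1) (hd : U.det = 1) (hd' : U'.det = 1) :
    IsSolution (U * lam * U') (Uiᵀ * Om * U') (Uiᵀ *ᵥ t) where
  det_eq_zero := by simp [h.det_eq_zero]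
  transpose_mulVec := by
    rw [mulVec_mulVec, ← transpose_mul, ← Matrix.mul_assoc, ← Matrix.mul_assoc,
      mul_eq_one_comm.1 hU, Matrix.one_mul, transpose_mul, ← mulVec_mulVec, h.transpose_mulVec,
      mulVec_zero]
  vecMulVec_eq := by
    have h1 : vecMulVec (Uiᵀ *ᵥ t) (Uiᵀ *ᵥ t) = Uiᵀ * vecMulVec t t * Ui := by
      rw [mul_vecMulVec, vecMulVec_mul, mulVec_transpose]
    rw [h1, h.vecMulVec_eq, adjugate_mul_distrib, adjugate_mul_distrib,
      adjugate_eq_of_mul_eq_one hU hd]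
    have h2 : U' * U'.adjugate = 1 := by rw [mul_adjugate, hd', one_smul]
    simp only [Matrix.mul_assoc]
    rw [← Matrix.mul_assoc U', h2, Matrix.one_mul]

lemma IsSolution.submatrix {lam Om : Matrix n n B} {t : n → B} (h : IsSolution lam Om t)
    (e : ρ ≃ n) : IsSolution (lam.submatrix e e) (Om.submatrix e e) (t ∘ e) where
  det_eq_zero := by rw [det_submatrix_equiv_self, h.det_eq_zero]
  transpose_mulVec := by
    rw [transpose_submatrix, submatrix_mulVec_equiv, Function.comp_assoc, e.self_comp_symm,
      Function.comp_id, h.transpose_mulVec]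
    rfl
  vecMulVec_eq := by
    rw [adjugate_submatrix_equiv_self, submatrix_mul_equiv, ← h.vecMulVec_eq]
    rfl

lemma adjugate_eq_of_mul_eq {M X : Matrix n n B} (hM : IsLeftRegular M.det)
    (h : M * X = M.det • 1) : M.adjugate = X := by
  ext i j
  refine hM ?_
  have h1 : M.det • M.adjugate = M.det • X := by
    calc M.det • M.adjugate = M.adjugate * (M.det • 1) := by
          rw [Matrix.mul_smul, Matrix.mul_one]
      _ = M.det • X := by rw [← h, ← Matrix.mul_assoc, adjugate_mul, Matrix.smul_mul, Matrix.one_mul]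
  exact congr_fun₂ h1 i j

lemma mapMatrix_eval_charmatrix (M : Matrix n n B) :
    (Polynomial.evalRingHom 0).mapMatrix (charmatrix (-M)) = M := by
  ext i j
  by_cases hij : i = j
  · subst hij; simp
  · simp [charmatrix_apply_ne _ _ _ hij]

lemma mapMatrix_smul {B' : Type*} [CommRing B'] (f : B →+* B') (r : B) (M : Matrix n n B) :
    f.mapMatrix (r • M) = f r • f.mapMatrix M := by
  ext i j
  simp

/-- The determinant may be a zero divisor, so a block M is deformed to X + M, which is `charmatrix
(-M)`. Its determinant is monic and can be cancelled; then X is set to 0. -/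
lemma adjugate_fromBlocks_diagonal (P : Matrix ρ ρ B) (D : Matrix κ κ B) :
    (fromBlocks P 0 0 D).adjugate = fromBlocks (D.det • P.adjugate) 0 0 (P.det • D.adjugate) := by
  let ev : Polynomial B →+* B := Polynomial.evalRingHom 0
  have key : (fromBlocks (charmatrix (-P)) 0 0 (charmatrix (-D))).adjugate =
      fromBlocks ((charmatrix (-D)).det • (charmatrix (-P)).adjugate) 0 0
        ((charmatrix (-P)).det • (charmatrix (-D)).adjugate) := by
    refine adjugate_eq_of_mul_eq ?_ ?_
    · rw [det_fromBlocks_zero₂₁]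
      exact ((charpoly_monic (-P)).mul (charpoly_monic (-D))).isRegular.left
    · rw [fromBlocks_multiply, det_fromBlocks_zero₂₁, ← fromBlocks_one, fromBlocks_smul]
      simp [mul_adjugate, smul_smul, mul_comm]
  have h2 := congrArg ev.mapMatrix key
  have hb : ∀ (A : Matrix ρ ρ (Polynomial B)) (C : Matrix κ κ (Polynomial B)),
      ev.mapMatrix (fromBlocks A 0 0 C) = fromBlocks (ev.mapMatrix A) 0 0 (ev.mapMatrix C) := by
    intro A C
    simp [fromBlocks_map]
  rw [RingHom.map_adjugate, hb, hb, mapMatrix_smul, mapMatrix_smul, RingHom.map_adjugate,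
    RingHom.map_adjugate, RingHom.map_det, RingHom.map_det, mapMatrix_eval_charmatrix,
    mapMatrix_eval_charmatrix] at h2
  exact h2

/-- Lower unipotent block matrices. -/
def lowerUnip (X : Matrix κ ρ B) : Matrix (ρ ⊕ κ) (ρ ⊕ κ) B := fromBlocks 1 0 X 1

/-- Upper unipotent block matrices. -/
def upperUnip (Y : Matrix ρ κ B) : Matrix (ρ ⊕ κ) (ρ ⊕ κ) B := fromBlocks 1 Y 0 1

lemma lowerUnip_mul_neg (X : Matrix κ ρ B) : lowerUnip X * lowerUnip (-X) = 1 := by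
  simp [lowerUnip, fromBlocks_multiply]

lemma lowerUnip_neg_mul (X : Matrix κ ρ B) : lowerUnip (-X) * lowerUnip X = 1 := by
  simp [lowerUnip, fromBlocks_multiply]

lemma upperUnip_neg_mul (Y : Matrix ρ κ B) : upperUnip (-Y) * upperUnip Y = 1 := by
  simp [upperUnip, fromBlocks_multiply]

lemma det_lowerUnip (X : Matrix κ ρ B) : (lowerUnip X).det = 1 := by simp [lowerUnip]

lemma det_upperUnip (Y : Matrix ρ κ B) : (upperUnip Y).det = 1 := by simp [upperUnip]

section Blocks

variable {P Pi : Matrix ρ ρ B} {Q : Matrix ρ κ B} {R : Matrix κ ρ B} {S : Matrix κ κ B}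
  (hPi : P * Pi = 1) {Om W : Matrix (ρ ⊕ κ) (ρ ⊕ κ) B} {t : ρ ⊕ κ → B}

include hPi in
lemma lowerUnip_mul_fromBlocks_mul_upperUnip :
    lowerUnip (-(R * Pi)) * fromBlocks P Q R S * upperUnip (-(Pi * Q)) =
      fromBlocks P 0 0 (S - R * Pi * Q) := by
  have h1 : Pi * P = 1 := mul_eq_one_comm.1 hPi
  simp only [lowerUnip, upperUnip, fromBlocks_multiply]
  congr 1
  · simp
  · simp [← Matrix.mul_assoc, hPi]
  · simp [Matrix.mul_assoc, h1]
  · simp [Matrix.mul_assoc, h1]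
    abel

/-- The lower right block of the matrix of `ω` in coordinates for which `λ` is block diagonal. -/
def reducedForm (Om : Matrix (ρ ⊕ κ) (ρ ⊕ κ) B) (Pi : Matrix ρ ρ B) (Q : Matrix ρ κ B) :
    Matrix κ κ B :=
  Om.toBlocks₂₂ - Om.toBlocks₂₁ * Pi * Q

lemma toBlocks₂₂_lowerUnip_transpose_mul (X : Matrix κ ρ B) :
    ((lowerUnip X)ᵀ * Om * upperUnip (-(Pi * Q))).toBlocks₂₂ = reducedForm Om Pi Q := by
  conv_lhs => rw [← fromBlocks_toBlocks Om]
  simp only [lowerUnip, upperUnip, fromBlocks_multiply, fromBlocks_transpose, toBlocks_fromBlocks₂₂]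
  simp [reducedForm, ← Matrix.mul_assoc]
  abel

include hPi in
-- Elimination with the invertible block P: the first part of t is determined by the second, which
-- solves the same system for the Schur complement, up to the factor det P.
lemma IsSolution.of_fromBlocks (h : IsSolution (fromBlocks P Q R S) Om t) :
    t ∘ Sum.inl + (R * Pi)ᵀ *ᵥ (t ∘ Sum.inr) = 0 ∧ (S - R * Pi * Q).det = 0 ∧
      (S - R * Pi * Q)ᵀ *ᵥ (t ∘ Sum.inr) = 0 ∧
      vecMulVec (t ∘ Sum.inr) (t ∘ Sum.inr) =
        P.det • (reducedForm Om Pi Q * (S - R * Pi * Q).adjugate) := by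
  have h' := h.transform (lowerUnip_neg_mul (R * Pi)) (det_lowerUnip _)
    (det_upperUnip (-(Pi * Q)))
  rw [lowerUnip_mul_fromBlocks_mul_upperUnip hPi] at h'
  have ht : (lowerUnip (R * Pi))ᵀ *ᵥ t =
      Sum.elim (t ∘ Sum.inl + (R * Pi)ᵀ *ᵥ (t ∘ Sum.inr)) (t ∘ Sum.inr) := by
    simp [lowerUnip, fromBlocks_transpose, fromBlocks_mulVec]
  obtain ⟨h1, h2, h3⟩ := h'
  rw [ht] at h2 h3
  rw [fromBlocks_transpose, fromBlocks_mulVec] at h2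
  have h21 := congrArg (fun v => v ∘ Sum.inl) h2
  have h22 := congrArg (fun v => v ∘ Sum.inr) h2
  simp only [Sum.elim_comp_inl, Sum.elim_comp_inr, transpose_zero, zero_mulVec, add_zero,
    zero_add] at h21 h22
  have hPd : P.det * Pi.det = 1 := by rw [← det_mul, hPi, det_one]
  refine ⟨?_, ?_, h22, ?_⟩
  · have h4 := congrArg (fun v => Piᵀ *ᵥ v) h21
    rwa [mulVec_mulVec, ← transpose_mul, hPi, transpose_one, one_mulVec,
      show (0 : ρ ⊕ κ → B) ∘ Sum.inl = 0 from rfl, mulVec_zero] at h4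
  · rw [det_fromBlocks_zero₂₁] at h1
    calc _ = Pi.det * (P.det * (S - R * Pi * Q).det) := by
          rw [← mul_assoc, mul_comm Pi.det, hPd, one_mul]
      _ = 0 := by rw [h1, mul_zero]
  · have h4 := congrArg toBlocks₂₂ h3
    rw [adjugate_fromBlocks_diagonal] at h4
    conv_rhs at h4 => rw [← fromBlocks_toBlocks ((lowerUnip (R * Pi))ᵀ * Om * upperUnip (-(Pi * Q)))]
    rw [fromBlocks_multiply, toBlocks_fromBlocks₂₂, toBlocks₂₂_lowerUnip_transpose_mul] at h4
    simp only [Matrix.mul_zero, zero_add, Matrix.mul_smul] at h4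
    rw [← h4]
    rfl

lemma relation_transform {lam Om W : Matrix n n B} (h : lamᵀ * Om - Omᵀ * lam = lamᵀ * W * lam)
    {U Ui : Matrix n n B} (hU : Ui * U = 1) (U' : Matrix n n B) :
    (U * lam * U')ᵀ * (Uiᵀ * Om * U') - (Uiᵀ * Om * U')ᵀ * (U * lam * U') =
      (U * lam * U')ᵀ * (Uiᵀ * W * Ui) * (U * lam * U') := by
  have h1 : Uᵀ * Uiᵀ = 1 := by rw [← transpose_mul, hU, transpose_one]
  have e1 : ∀ X : Matrix n n B, Uᵀ * (Uiᵀ * X) = X := fun X => by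
    rw [← Matrix.mul_assoc, h1, Matrix.one_mul]
  have e2 : ∀ X : Matrix n n B, Ui * (U * X) = X := fun X => by
    rw [← Matrix.mul_assoc, hU, Matrix.one_mul]
  have h2 := congrArg (fun M => U'ᵀ * M * U') h
  simp only [Matrix.mul_sub, Matrix.sub_mul, Matrix.mul_assoc] at h2
  simp only [transpose_mul, transpose_transpose, Matrix.mul_assoc, e1, e2, h2]

variable (hrel : (fromBlocks P Q R S)ᵀ * Om - Omᵀ * fromBlocks P Q R S =
  (fromBlocks P Q R S)ᵀ * W * fromBlocks P Q R S)

include hPi hrel in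
-- The identity expressing the Lagrangian condition survives elimination, with a new antisymmetric
-- part in place of W when W is antisymmetric.
lemma reduced_relation :
    (S - R * Pi * Q)ᵀ * reducedForm Om Pi Q - (reducedForm Om Pi Q)ᵀ * (S - R * Pi * Q) =
      (S - R * Pi * Q)ᵀ * ((lowerUnip (R * Pi))ᵀ * W * lowerUnip (R * Pi)).toBlocks₂₂ *
        (S - R * Pi * Q) := by
  have h := relation_transform hrel (lowerUnip_mul_neg (R * Pi)) (upperUnip (-(Pi * Q)))
  rw [lowerUnip_mul_fromBlocks_mul_upperUnip hPi] at h
  have h4 := congrArg toBlocks₂₂ h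
  rw [← toBlocks₂₂_lowerUnip_transpose_mul (R * Pi)]
  generalize (lowerUnip (R * Pi))ᵀ * Om * upperUnip (-(Pi * Q)) = O' at h4 ⊢
  generalize (lowerUnip (R * Pi))ᵀ * W * lowerUnip (R * Pi) = W' at h4 ⊢
  rw [← fromBlocks_toBlocks O', ← fromBlocks_toBlocks W'] at h4
  simpa [fromBlocks_multiply, fromBlocks_transpose, sub_eq_add_neg, fromBlocks_neg, fromBlocks_add]
    using h4

include hPi hrel in
lemma isSolution_fromBlocks {t₂ : κ → B} (hdet : (S - R * Pi * Q).det = 0)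
    (hker : (S - R * Pi * Q)ᵀ *ᵥ t₂ = 0)
    (hmul : vecMulVec t₂ t₂ = P.det • (reducedForm Om Pi Q * (S - R * Pi * Q).adjugate)) :
    IsSolution (fromBlocks P Q R S) Om (Sum.elim (-((R * Pi)ᵀ *ᵥ t₂)) t₂) := by
  have h := relation_transform hrel (lowerUnip_mul_neg (R * Pi)) (upperUnip (-(Pi * Q)))
  rw [lowerUnip_mul_fromBlocks_mul_upperUnip hPi] at h
  set O' := (lowerUnip (R * Pi))ᵀ * Om * upperUnip (-(Pi * Q)) with hO'
  set D := S - R * Pi * Q with hD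
  -- The relation writes Pᵀ O'₁₂ as a left multiple of D, and D adj D = det D = 0. Without it the
  -- off-diagonal block of the multiplication rule could fail.
  have h12 : O'.toBlocks₁₂ * D.adjugate = 0 := by
    have h4 := congrArg toBlocks₁₂ h
    generalize (lowerUnip (R * Pi))ᵀ * W * lowerUnip (R * Pi) = W' at h4
    rw [← fromBlocks_toBlocks O', ← fromBlocks_toBlocks W'] at h4
    have h5 : Pᵀ * O'.toBlocks₁₂ - (O'.toBlocks₂₁)ᵀ * D = Pᵀ * W'.toBlocks₁₂ * D := by
      simpa [fromBlocks_multiply, fromBlocks_transpose, sub_eq_add_neg, fromBlocks_neg, fromBlocks_add]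
        using h4
    have h6 : Pᵀ * (O'.toBlocks₁₂ * D.adjugate) = 0 := by
      rw [← Matrix.mul_assoc, eq_add_of_sub_eq h5, ← Matrix.add_mul, Matrix.mul_assoc, mul_adjugate,
        hdet, zero_smul, Matrix.mul_zero]
    have h7 : Piᵀ * Pᵀ = 1 := by rw [← transpose_mul, hPi, transpose_one]
    rw [← Matrix.one_mul (O'.toBlocks₁₂ * _), ← h7, Matrix.mul_assoc, h6, Matrix.mul_zero]
  have hsol : IsSolution (fromBlocks P 0 0 D) O' (Sum.elim 0 t₂) := by
    refine ⟨by rw [det_fromBlocks_zero₂₁, hdet, mul_zero], ?_, ?_⟩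
    · rw [fromBlocks_transpose, fromBlocks_mulVec]
      ext i
      cases i <;> simp [hker]
    · rw [adjugate_fromBlocks_diagonal]
      conv_rhs => rw [← fromBlocks_toBlocks O']
      rw [fromBlocks_multiply, hdet, zero_smul, Matrix.mul_zero, Matrix.mul_zero, Matrix.mul_zero,
        Matrix.mul_zero, Matrix.mul_smul, Matrix.mul_smul, h12, hO',
        toBlocks₂₂_lowerUnip_transpose_mul, ← hmul]
      ext i j
      cases i <;> cases j <;> simp [vecMulVec_apply]
  have h' := hsol.transform (lowerUnip_mul_neg (R * Pi)) (det_lowerUnip _)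
    (det_upperUnip (Pi * Q))
  convert h' using 1
  · rw [← lowerUnip_mul_fromBlocks_mul_upperUnip hPi]
    simp only [← Matrix.mul_assoc]
    rw [lowerUnip_mul_neg, Matrix.one_mul, Matrix.mul_assoc, upperUnip_neg_mul, Matrix.mul_one]
  · rw [hO']
    simp only [← Matrix.mul_assoc]
    rw [← transpose_mul, lowerUnip_mul_neg, transpose_one, Matrix.one_mul, Matrix.mul_assoc,
      upperUnip_neg_mul, Matrix.mul_one]
  · rw [lowerUnip, fromBlocks_transpose, fromBlocks_mulVec]
    ext i
    cases i <;> simp [neg_mulVec]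

end Blocks

end System

/-! ### First-order expansions along a square-zero ideal -/

section Jet

open Matrix

set_option linter.unusedSectionVars false

variable {σ l m n : Type*} [Fintype σ] [Fintype l] [Fintype m] [Fintype n] {B : Type*} [CommRing B]

/-- `F'` are the partial derivatives of `F` at `x` along the square zero ideal `J`. -/
def HasJetDeriv (J : Ideal B) (x : σ → B) (F : (σ → B) → Matrix m n B)
    (F' : σ → Matrix m n B) : Prop :=
  ∀ j : σ → B, (∀ i, j i ∈ J) → F (x + j) = F x + ∑ i, j i • F' i

namespace HasJetDeriv

variable {J : Ideal B} {x : σ → B}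

lemma sub {F G : (σ → B) → Matrix m n B} {F' G' : σ → Matrix m n B} (hF : HasJetDeriv J x F F')
    (hG : HasJetDeriv J x G G') :
    HasJetDeriv J x (fun y => F y - G y) (fun i => F' i - G' i) := by
  intro j hj
  simp only [hF j hj, hG j hj, smul_sub, Finset.sum_sub_distrib]
  abel

lemma add {F G : (σ → B) → Matrix m n B} {F' G' : σ → Matrix m n B} (hF : HasJetDeriv J x F F')
    (hG : HasJetDeriv J x G G') :
    HasJetDeriv J x (fun y => F y + G y) (fun i => F' i + G' i) := by
  intro j hj
  simp only [hF j hj, hG j hj, smul_add, Finset.sum_add_distrib]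
  abel

lemma transpose {F : (σ → B) → Matrix m n B} {F' : σ → Matrix m n B} (hF : HasJetDeriv J x F F') :
    HasJetDeriv J x (fun y => (F y)ᵀ) (fun i => (F' i)ᵀ) := by
  intro j hj
  simp only [hF j hj, transpose_add, transpose_sum, transpose_smul]

lemma submatrix {m' n' : Type*} {F : (σ → B) → Matrix m n B} {F' : σ → Matrix m n B}
    (hF : HasJetDeriv J x F F') (f : m' → m) (g : n' → n) :
    HasJetDeriv J x (fun y => (F y).submatrix f g) (fun i => (F' i).submatrix f g) := by
  intro j hj
  ext a b
  simp [hF j hj, Matrix.sum_apply]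

lemma sum_smul_mul_sum_smul (hJ : ∀ a ∈ J, ∀ b ∈ J, a * b = 0) {j : σ → B} (hj : ∀ i, j i ∈ J)
    (F : σ → Matrix l m B) (G : σ → Matrix m n B) :
    (∑ i, j i • F i) * ∑ i, j i • G i = 0 := by
  rw [Matrix.sum_mul]
  refine Finset.sum_eq_zero fun i _ => ?_
  rw [Matrix.mul_sum]
  refine Finset.sum_eq_zero fun i' _ => ?_
  rw [Matrix.smul_mul, Matrix.mul_smul, smul_smul, hJ _ (hj i) _ (hj i'), zero_smul]

lemma mul (hJ : ∀ a ∈ J, ∀ b ∈ J, a * b = 0) {F : (σ → B) → Matrix l m B}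
    {G : (σ → B) → Matrix m n B} {F' : σ → Matrix l m B} {G' : σ → Matrix m n B}
    (hF : HasJetDeriv J x F F') (hG : HasJetDeriv J x G G') :
    HasJetDeriv J x (fun y => F y * G y) (fun i => F' i * G x + F x * G' i) := by
  intro j hj
  simp only [hF j hj, hG j hj, smul_add, Finset.sum_add_distrib, Matrix.add_mul, Matrix.mul_add,
    sum_smul_mul_sum_smul hJ hj, add_zero]
  simp only [Matrix.sum_mul, Matrix.mul_sum, Matrix.smul_mul, Matrix.mul_smul]
  abel

lemma inv [DecidableEq n] (hJ : ∀ a ∈ J, ∀ b ∈ J, a * b = 0) {F : (σ → B) → Matrix n n B}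
    {F' : σ → Matrix n n B} (hF : HasJetDeriv J x F F') (hu : IsUnit (F x).det) :
    HasJetDeriv J x (fun y => (F y)⁻¹) (fun i => -((F x)⁻¹ * F' i * (F x)⁻¹)) := by
  intro j hj
  have h0 : F x * (F x)⁻¹ = 1 := mul_nonsing_inv _ hu
  refine inv_eq_right_inv ?_
  have h1 : ∑ i, j i • (-((F x)⁻¹ * F' i * (F x)⁻¹)) =
      -((F x)⁻¹ * (∑ i, j i • F' i) * (F x)⁻¹) := by
    simp [Matrix.mul_sum, Matrix.sum_mul]
  have h2 : (∑ i, j i • F' i) * ((F x)⁻¹ * (∑ i, j i • F' i) * (F x)⁻¹) = 0 := by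
    have h3 := sum_smul_mul_sum_smul hJ hj (fun i => F' i * (F x)⁻¹) (fun i => F' i * (F x)⁻¹)
    simp only [← Matrix.smul_mul, ← Matrix.sum_mul] at h3
    rw [Matrix.mul_assoc (F x)⁻¹, ← Matrix.mul_assoc]
    exact h3
  rw [hF j hj, h1]
  simp only [← Matrix.mul_assoc] at h2
  simp only [Matrix.add_mul, Matrix.mul_add, Matrix.mul_neg, h2, ← Matrix.mul_assoc, h0,
    Matrix.one_mul]
  simp

lemma sub_mem {F : (σ → B) → Matrix m n B} {F' : σ → Matrix m n B} (hF : HasJetDeriv J x F F')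
    {j : σ → B} (hj : ∀ i, j i ∈ J) (a : m) (b : n) : F (x + j) a b - F x a b ∈ J := by
  rw [hF j hj, Matrix.add_apply, add_sub_cancel_left, Matrix.sum_apply]
  exact J.sum_mem fun i _ => J.mul_mem_right _ (hj i)

lemma map_mk {F : (σ → B) → Matrix m n B} {F' : σ → Matrix m n B} (hF : HasJetDeriv J x F F')
    {j : σ → B} (hj : ∀ i, j i ∈ J) :
    (F (x + j)).map (Ideal.Quotient.mk J) = (F x).map (Ideal.Quotient.mk J) := by
  ext a b
  exact (Ideal.Quotient.mk_eq_mk_iff_sub_mem _ _).2 (hF.sub_mem hj a b)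

end HasJetDeriv

/-- A linear system with independent rows in the residue field can be solved in any ideal. -/
lemma exists_mulVec_eq_of_independent [DecidableEq m] [Algebra ℂ B] (π : B →ₐ[ℂ] ℂ)
    (hπ : ∀ b, π b ≠ 0 → IsUnit b) (M : Matrix m σ B)
    (hM : ∀ y : m → ℂ, (∀ i, ∑ a, y a * π (M a i) = 0) → y = 0) (J : Ideal B) (z : m → B)
    (hz : ∀ a, z a ∈ J) : ∃ j : σ → B, (∀ i, j i ∈ J) ∧ M *ᵥ j = z := by
  classical
  have hinj : Function.Injective (M.map π).vecMul := by
    intro y y' h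
    rw [← sub_eq_zero]
    refine hM _ fun i => ?_
    have := congrFun h i
    simp only [vecMul, dotProduct, Matrix.map_apply] at this
    simp [sub_mul, this]
  obtain ⟨T, hT⟩ : ∃ T : Matrix σ m ℂ, M.map π * T = 1 :=
    mulVec_surjective_iff_exists_right_inverse.1 (by
      have hr : (M.map π).rank = Fintype.card m := (vecMul_injective_iff.1 hinj).rank_matrix
      have := Submodule.eq_top_of_finrank_eq (K := ℂ) (V := m → ℂ)
        (S := LinearMap.range (M.map π).mulVecLin) (by rw [Module.finrank_fintype_fun_eq_card]; exact hr)
      exact LinearMap.range_eq_top.1 this)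
  -- A right inverse over ℂ is lifted by constants; M T' is the identity at the residue point, hence
  -- invertible over the local ring.
  let T' : Matrix σ m B := T.map (algebraMap ℂ B)
  have hT' : (M * T').map π = 1 := by
    rw [← hT]
    ext a b
    simp [T', Matrix.mul_apply]
  have hu : IsUnit (M * T').det := by
    refine hπ _ ?_
    have h1 : π (M * T').det = ((M * T').map π).det := by
      rw [← AlgHom.mapMatrix_apply, AlgHom.map_det]
    rw [h1, hT', det_one]
    exact one_ne_zero
  refine ⟨(T' * (M * T')⁻¹) *ᵥ z, fun i => ?_, ?_⟩
  · exact J.sum_mem fun a _ => J.mul_mem_left _ (hz a)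
  · rw [mulVec_mulVec, ← Matrix.mul_assoc, mul_nonsing_inv _ hu, one_mulVec]

end Jet

/-! ### The reduced system in corank one and two -/

section Reduced

open Matrix

set_option linter.unusedSectionVars false

variable {B : Type*} [CommRing B] [Algebra ℂ B] (π : B →ₐ[ℂ] ℂ) (hπ : ∀ b, π b ≠ 0 → IsUnit b)
  {J : Ideal B} (hJ : ∀ a ∈ J, ∀ b ∈ J, a * b = 0)

include hJ in
lemma map_eq_zero_of_mem {a : B} (ha : a ∈ J) : π a = 0 := by
  have h : π a * π a = 0 := by rw [← map_mul, hJ a ha a ha, map_zero]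
  exact mul_self_eq_zero.1 h

include hπ in
/-- A matrix is symmetric when its antisymmetric part is a multiple of the determinant and the
determinant of its symmetric part vanishes. -/
lemma eq_of_add_transpose_eq {D Th W Z : Matrix (Fin 2) (Fin 2) B}
    (hrel : Dᵀ * Th - Thᵀ * D = Dᵀ * W * D) (hW : Wᵀ = -W) (hTh : π Th.det ≠ 0)
    (hD : D.map π = 0) (hZ : Zᵀ = Z) (hZd : Z.det = 0)
    (hsum : Thᵀ * D + (Thᵀ * D)ᵀ = Z + Zᵀ) : Thᵀ * D = Z := by
  have htwo : IsUnit (2 : B) := hπ 2 (by rw [map_ofNat]; exact two_ne_zero)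
  have h2 : ∀ a b : B, 2 * a = 2 * b → a = b := fun a b h => htwo.mul_left_cancel h
  have hw : W 1 0 = -W 0 1 := congr_fun₂ hW 0 1
  have hw0 : W 0 0 = 0 := by
    have h3 : W 0 0 = -W 0 0 := congr_fun₂ hW 0 0
    refine h2 _ _ ?_
    linear_combination h3
  have hw1 : W 1 1 = 0 := by
    have h3 : W 1 1 = -W 1 1 := congr_fun₂ hW 1 1
    refine h2 _ _ ?_
    linear_combination h3
  have hNt : (Thᵀ * D)ᵀ = Dᵀ * Th := by rw [transpose_mul, transpose_transpose]
  have hr : (Dᵀ * Th) 0 1 - (Thᵀ * D) 0 1 = W 0 1 * D.det := by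
    have h3 := congr_fun₂ hrel 0 1
    rw [Matrix.sub_apply] at h3
    rw [h3, det_fin_two]
    simp only [Matrix.mul_apply, Fin.sum_univ_two, transpose_apply, hw, hw0, hw1]
    ring
  have hdet : (Thᵀ * D).det = Th.det * D.det := by rw [det_mul, det_transpose]
  have hNπ : (Thᵀ * D).map π = 0 := by
    have h3 : (Thᵀ * D).map π = Thᵀ.map π * D.map π := by
      ext a b; simp [Matrix.mul_apply]
    rw [h3, hD, Matrix.mul_zero]
  rw [← hNt] at hr
  generalize Thᵀ * D = N at *
  have e00 := congr_fun₂ hsum 0 0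
  have e01 := congr_fun₂ hsum 0 1
  have e11 := congr_fun₂ hsum 1 1
  have z01 : Z 1 0 = Z 0 1 := congr_fun₂ hZ 0 1
  simp only [Matrix.add_apply, transpose_apply, z01] at e00 e01 e11
  rw [transpose_apply] at hr
  rw [det_fin_two] at hdet hZd
  rw [z01] at hZd
  have f00 : N 0 0 = Z 0 0 := h2 _ _ (by linear_combination e00)
  have f11 : N 1 1 = Z 1 1 := h2 _ _ (by linear_combination e11)
  have hu : IsUnit (4 * Th.det + W 0 1 * (N 0 1 - N 1 0)) := by
    refine hπ _ ?_
    have h01 : π (N 0 1) = 0 := congr_fun₂ hNπ 0 1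
    have h10 : π (N 1 0) = 0 := congr_fun₂ hNπ 1 0
    simp only [map_add, map_mul, map_sub, h01, h10, map_ofNat, sub_zero, mul_zero, add_zero]
    exact mul_ne_zero (by norm_num) hTh
  -- Put δ = N₀₁ − N₁₀ and w = W₀₁. Since det Z = 0, det N = δ²/4, while −δ = w det D and det N =
  -- det Θ det D. So δ(4 det Θ + wδ) = 0, and the second factor is a unit.
  have hdelta : N 0 1 - N 1 0 = 0 := by
    refine hu.mul_left_cancel ?_
    rw [mul_zero]
    rw [f00, f11] at hdet
    linear_combination (-4 * Th.det) * hr + 4 * W 0 1 * hdet - 4 * W 0 1 * hZd +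
      W 0 1 * (N 0 1 + N 1 0 + 2 * Z 0 1) * e01
  have f01 : N 0 1 = Z 0 1 := h2 _ _ (by linear_combination e01 + hdelta)
  have f10 : N 1 0 = Z 1 0 := by rw [z01, ← f01]; linear_combination -hdelta
  ext a b
  fin_cases a <;> fin_cases b
  exacts [f00, f01, f10, f11]

lemma det_vecMulVec_fin_two (s : Fin 2 → B) : (vecMulVec s s).det = 0 := by
  rw [det_fin_two]
  simp only [vecMulVec_apply]
  ring

lemma adjugate_vecMulVec_mulVec (s : Fin 2 → B) : (vecMulVec s s).adjugate *ᵥ s = 0 := by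
  ext i
  fin_cases i <;> simp [adjugate_fin_two, mulVec, dotProduct, Fin.sum_univ_two, vecMulVec_apply] <;>
    ring

lemma adjugate_adjugate_fin_two (M : Matrix (Fin 2) (Fin 2) B) : M.adjugate.adjugate = M := by
  ext i j
  fin_cases i <;> fin_cases j <;> simp [adjugate_fin_two]

lemma adjugate_smul_fin_two (c : B) (M : Matrix (Fin 2) (Fin 2) B) :
    (c • M).adjugate = c • M.adjugate := by
  simp [adjugate_smul]

/-- `ε N`, where `N = Θᵀ D`, is determined by `s = Θ⁻¹ t`. -/
lemma adjugate_vecMulVec_eq {D Th : Matrix (Fin 2) (Fin 2) B} {θ p : B} (hθ : Th.det * θ = 1)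
    {s t : Fin 2 → B} (hs : Th *ᵥ s = t)
    (ht : vecMulVec t t = p • (Th * D.adjugate)) :
    (vecMulVec s s).adjugate = (p * θ) • (Thᵀ * D) := by
  have hθ' : Th.adjugate *ᵥ t = Th.det • s := by
    rw [← hs, mulVec_mulVec, adjugate_mul, smul_mulVec, one_mulVec]
  have h1 : Th.adjugate * vecMulVec t t * Th.adjugateᵀ =
      (Th.det * Th.det) • vecMulVec s s := by
    rw [mul_vecMulVec, vecMulVec_mul, vecMul_transpose, hθ', smul_vecMulVec, vecMulVec_smul,
      smul_smul]
  rw [ht, Matrix.mul_smul, Matrix.smul_mul, ← Matrix.mul_assoc, adjugate_mul, Matrix.smul_mul,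
    Matrix.one_mul, Matrix.smul_mul, adjugate_transpose, ← adjugate_mul_distrib] at h1
  have h2 : vecMulVec s s = (p * θ) • (Thᵀ * D).adjugate := by
    have h3 := congrArg (fun M => (θ * θ) • M) h1
    simp only [smul_smul] at h3
    have e1 : θ * θ * (Th.det * Th.det) = 1 := by linear_combination (Th.det * θ + 1) * hθ
    rw [e1, one_smul] at h3
    rw [← h3]
    congr 1
    linear_combination (p * θ) * hθ
  rw [h2, adjugate_smul_fin_two, adjugate_adjugate_fin_two]

/-- Converse to `adjugate_vecMulVec_eq`: a multiple of adj(s sᵀ) as N solves all the equations,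
provided s is rescaled by a square root of the appropriate unit. -/
lemma equations_of_eq {D Th : Matrix (Fin 2) (Fin 2) B} {θ p ei η: B} (hθ : Th.det * θ = 1)
    {s s' : Fin 2 → B} (hN : Thᵀ * D = ei • (vecMulVec s s).adjugate)
    (hs' : s' = (1 + η) • s) (hη : (1 + η) * (1 + η) = p * θ * ei) :
    D.det = 0 ∧ Dᵀ *ᵥ (Th *ᵥ s') = 0 ∧
      vecMulVec (Th *ᵥ s') (Th *ᵥ s') = p • (Th * D.adjugate) := by
  have hd : Th.det * D.det = 0 := by
    rw [← det_transpose Th, ← det_mul, hN, det_smul, ← adjugate_adjugate_fin_two (vecMulVec s s)]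
    rw [adjugate_adjugate_fin_two, det_adjugate, det_vecMulVec_fin_two]
    simp
  refine ⟨?_, ?_, ?_⟩
  · calc D.det = θ * (Th.det * D.det) := by linear_combination -D.det * hθ
      _ = 0 := by rw [hd, mul_zero]
  · have h1 : Dᵀ * Th = ei • (vecMulVec s s).adjugate := by
      have := congrArg transpose hN
      rwa [transpose_mul, transpose_transpose, transpose_smul, adjugate_transpose,
        transpose_vecMulVec] at this
    rw [mulVec_mulVec, h1, hs', mulVec_smul, smul_mulVec, adjugate_vecMulVec_mulVec, smul_zero,
      smul_zero]
  · have h1 : D.adjugate * Th.adjugateᵀ = ei • vecMulVec s s := by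
      rw [adjugate_transpose, ← adjugate_mul_distrib, hN, adjugate_smul_fin_two,
        adjugate_adjugate_fin_two]
    have h2 : Th.det • D.adjugate = ei • (vecMulVec s s * Thᵀ) := by
      have h3 := congrArg (fun M => M * Thᵀ) h1
      simp only [Matrix.mul_assoc, Matrix.smul_mul, ← transpose_mul, mul_adjugate] at h3
      rw [← h3]
      simp
    have h4 : D.adjugate = (θ * ei) • (vecMulVec s s * Thᵀ) := by
      rw [← smul_smul, ← h2, smul_smul, mul_comm θ, hθ, one_smul]
    rw [h4, hs', mulVec_smul, smul_vecMulVec, vecMulVec_smul, smul_smul, hη, Matrix.mul_smul,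
      smul_smul, ← Matrix.mul_assoc, mul_vecMulVec, vecMulVec_mul, vecMul_transpose, mul_assoc]

variable {σ : Type*} [Fintype σ] {x : σ → B}

lemma map_ne_zero_of_isUnit {b : B} (hb : IsUnit b) : π b ≠ 0 := (hb.map π).ne_zero

include hJ in
lemma map_eq_of_sub_mem {a b : B} (h : a - b ∈ J) : π a = π b := by
  rw [← sub_eq_zero, ← map_sub, map_eq_zero_of_mem π hJ h]

include hπ hJ in
-- The vector s = Θ⁻¹t is kept free, and the base point is moved so that N = ΘᵀD becomes the
-- symmetric matrix Z it prescribes. The three entries of N + Nᵀ have independent differentials, and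
-- `eq_of_add_transpose_eq` removes the antisymmetric part. Since Θ and p move as well, s is then
-- rescaled.
lemma exists_equations_two {D Th W : (σ → B) → Matrix (Fin 2) (Fin 2) B}
    {p : (σ → B) → B} {D' Th' : σ → Matrix (Fin 2) (Fin 2) B}
    (hD : HasJetDeriv J x D D') (hTh : HasJetDeriv J x Th Th') (hD0 : (D x).map π = 0)
    (hTh0 : IsUnit (Th x).det) (hp : IsUnit (p x))
    (hpJ : ∀ j : σ → B, (∀ i, j i ∈ J) → p (x + j) - p x ∈ J)
    (hrel : ∀ j : σ → B, (∀ i, j i ∈ J) →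
      (D (x + j))ᵀ * Th (x + j) - (Th (x + j))ᵀ * D (x + j) =
        (D (x + j))ᵀ * W (x + j) * D (x + j))
    (hW : ∀ y, (W y)ᵀ = -W y)
    (hind : ∀ Y : Matrix (Fin 2) (Fin 2) ℂ, Yᵀ = Y →
      (∀ i, ∑ a, ∑ b, Y a b * π (((Th x)ᵀ * D' i) a b) = 0) → Y = 0)
    {t : Fin 2 → B}
    (ht : (vecMulVec t t).map (Ideal.Quotient.mk J) =
      (p x • (Th x * (D x).adjugate)).map (Ideal.Quotient.mk J)) :
    ∃ j : σ → B, (∀ i, j i ∈ J) ∧ ∃ t' : Fin 2 → B, (∀ a, t' a - t a ∈ J) ∧ (D (x + j)).det = 0 ∧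
      (D (x + j))ᵀ *ᵥ t' = 0 ∧
      vecMulVec t' t' = p (x + j) • (Th (x + j) * (D (x + j)).adjugate) := by
  have hN := hTh.transpose.mul hJ hD
  have hNs := hN.add hN.transpose
  obtain ⟨θ, hθ⟩ := isUnit_iff_exists_inv.1 hTh0
  have hε : IsUnit (p x * θ) := hp.mul (IsUnit.of_mul_eq_one _ (by rw [mul_comm]; exact hθ))
  obtain ⟨ei, hei⟩ := isUnit_iff_exists_inv.1 hε
  set s : Fin 2 → B := (Th x)⁻¹ *ᵥ t with hs
  have hst : Th x *ᵥ s = t := by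
    rw [hs, mulVec_mulVec, mul_nonsing_inv _ hTh0, one_mulVec]
  set Z : Matrix (Fin 2) (Fin 2) B := ei • (vecMulVec s s).adjugate with hZ
  have hZt : Zᵀ = Z := by rw [hZ, transpose_smul, adjugate_transpose, transpose_vecMulVec]
  have hZd : Z.det = 0 := by
    rw [hZ, det_smul, det_adjugate, det_vecMulVec_fin_two]
    simp
  let q := Ideal.Quotient.mk J
  have hmod : ((Th x)ᵀ * D x).map q = Z.map q := by
    have h1 := adjugate_vecMulVec_eq (B := B ⧸ J) (D := (D x).map q) (Th := (Th x).map q) (θ := q θ)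
      (p := q (p x)) (s := q ∘ s) (t := q ∘ t)
      (by rw [← RingHom.mapMatrix_apply, ← RingHom.map_det, ← map_mul, hθ, map_one])
      (by rw [← hst]; ext i; rw [Function.comp_apply, RingHom.map_mulVec])
      (by
        have h2 : vecMulVec (q ∘ t) (q ∘ t) = (vecMulVec t t).map q := by
          ext a b; simp [vecMulVec_apply]
        rw [h2, ht, ← RingHom.mapMatrix_apply, mapMatrix_smul, map_mul, RingHom.map_adjugate]
        rfl)
    have h2 : vecMulVec (q ∘ s) (q ∘ s) = (vecMulVec s s).map q := by
      ext a b; simp [vecMulVec_apply]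
    rw [← RingHom.mapMatrix_apply, hZ, ← RingHom.mapMatrix_apply, mapMatrix_smul,
      RingHom.map_adjugate, RingHom.mapMatrix_apply q (vecMulVec s s), ← h2, h1, smul_smul, ← map_mul,
      ← map_mul, mul_comm ei, hei, map_one, one_smul, map_mul, RingHom.mapMatrix_apply,
      RingHom.mapMatrix_apply, transpose_map]
  have hmem : ∀ a b, Z a b - ((Th x)ᵀ * D x) a b ∈ J := fun a b =>
    (Ideal.Quotient.mk_eq_mk_iff_sub_mem _ _).1 (congr_fun₂ hmod a b).symm
  -- The upper triangular positions of a symmetric 2×2 matrix.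
  let idx : Fin 3 → Fin 2 × Fin 2 := ![(0, 0), (0, 1), (1, 1)]
  set NS : (σ → B) → Matrix (Fin 2) (Fin 2) B := fun y => (Th y)ᵀ * D y + ((Th y)ᵀ * D y)ᵀ with hNS
  set NS' : σ → Matrix (Fin 2) (Fin 2) B := fun i =>
    ((Th' i)ᵀ * D x + (Th x)ᵀ * D' i) + ((Th' i)ᵀ * D x + (Th x)ᵀ * D' i)ᵀ with hNS'
  have hD0' : ∀ a b, π (D x a b) = 0 := fun a b => congr_fun₂ hD0 a b
  have hres : ∀ i a b, π (NS' i a b) =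
      π (((Th x)ᵀ * D' i) a b) + π (((Th x)ᵀ * D' i) b a) := by
    intro i a b
    simp only [hNS', Matrix.mul_apply, hD0', Matrix.add_apply, transpose_apply, map_add, map_mul,
      map_sum, mul_zero, Finset.sum_const_zero, zero_add]
  obtain ⟨j, hj, hjz⟩ := exists_mulVec_eq_of_independent π hπ
    (Matrix.of fun (a : Fin 3) (i : σ) => NS' i (idx a).1 (idx a).2) (by
      intro y hy
      -- The derivative of N + Nᵀ counts diagonal entries twice, whence the factors 2.
      have hY := hind !![2 * y 0, y 1; y 1, 2 * y 2] (by ext a b; fin_cases a <;> fin_cases b <;> rfl)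
        (fun i => by
          have h3 := hy i
          simp only [Fin.sum_univ_three, of_apply, idx, cons_val_zero, cons_val_one, cons_val_two,
            hres, tail_cons, head_cons] at h3
          simp only [Fin.sum_univ_two, of_apply, cons_val', cons_val_zero, cons_val_one]
          linear_combination h3)
      have h0 : 2 * y 0 = 0 := congr_fun₂ hY 0 0
      have h1 : y 1 = 0 := congr_fun₂ hY 0 1
      have h2 : 2 * y 2 = 0 := congr_fun₂ hY 1 1
      ext a
      fin_cases a
      · simpa using h0
      · exact h1
      · simpa using h2) J
    (fun a => (Z + Zᵀ) (idx a).1 (idx a).2 - NS x (idx a).1 (idx a).2) (fun a => by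
      have h1 := J.add_mem (hmem (idx a).1 (idx a).2) (hmem (idx a).2 (idx a).1)
      convert h1 using 1
      simp only [hNS, Matrix.add_apply, transpose_apply]
      ring)
  have hsum3 : ∀ a, NS (x + j) (idx a).1 (idx a).2 = (Z + Zᵀ) (idx a).1 (idx a).2 := by
    intro a
    have h1 := congrFun hjz a
    have h2 : NS (x + j) = NS x + ∑ i, j i • NS' i := hNs j hj
    rw [h2, Matrix.add_apply, Matrix.sum_apply, ← eq_sub_iff_add_eq', ← h1]
    simp [mulVec, dotProduct, mul_comm]
  have hsum : NS (x + j) = Z + Zᵀ := by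
    ext a b
    fin_cases a <;> fin_cases b
    · exact hsum3 0
    · exact hsum3 1
    · have h1 := hsum3 1
      have h2 : (NS (x + j))ᵀ = NS (x + j) := by
        simp only [hNS, transpose_add, transpose_transpose, add_comm]
      have h3 : (Z + Zᵀ)ᵀ = Z + Zᵀ := by simp only [transpose_add, transpose_transpose, add_comm]
      rw [← h2, ← h3]
      exact h1
    · exact hsum3 2
  have hDx : (D (x + j)).map π = 0 := by
    ext a b
    rw [Matrix.map_apply, map_eq_of_sub_mem π hJ (hD.sub_mem hj a b), hD0' a b]
    rfl
  have hThdet : (Th (x + j)).det - (Th x).det ∈ J := by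
    rw [← Ideal.Quotient.mk_eq_mk_iff_sub_mem, RingHom.map_det, RingHom.map_det,
      RingHom.mapMatrix_apply, RingHom.mapMatrix_apply, hTh.map_mk hj]
  have hThπ : π (Th (x + j)).det ≠ 0 := by
    rw [map_eq_of_sub_mem π hJ hThdet]
    exact map_ne_zero_of_isUnit π hTh0
  have hNZ := eq_of_add_transpose_eq π hπ (hrel j hj) (hW _) hThπ hDx hZt hZd hsum
  obtain ⟨θ', hθ'⟩ := isUnit_iff_exists_inv.1 (hπ _ hThπ)
  have hθθ : θ' - θ ∈ J := by
    have h1 : θ' - θ = -(θ' * θ) * ((Th (x + j)).det - (Th x).det) := by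
      linear_combination θ * hθ' - θ' * hθ
    rw [h1]
    exact J.mul_mem_left _ hThdet
  set η : B := p (x + j) * θ' * ei - 1 with hη
  have hηJ : η ∈ J := by
    have h1 : η = (p (x + j) - p x) * (θ' * ei) + (θ' - θ) * (p x * ei) := by
      rw [hη]
      linear_combination hei
    rw [h1]
    exact J.add_mem (J.mul_mem_right _ (hpJ j hj)) (J.mul_mem_right _ hθθ)
  -- As η² = 0, the square root of 1 + η is 1 + η/2.
  set η2 : B := algebraMap ℂ B (1 / 2) * η with hη2
  have hhalf : algebraMap ℂ B (1 / 2) * 2 = 1 := by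
    rw [← map_ofNat (algebraMap ℂ B) 2, ← map_mul]
    norm_num
  have hη2J : η2 ∈ J := J.mul_mem_left _ hηJ
  have hsq : (1 + η2) * (1 + η2) = p (x + j) * θ' * ei := by
    have h1 : η2 * η2 = 0 := hJ _ hη2J _ hη2J
    have h2 : 2 * η2 = η := by rw [hη2]; linear_combination η * hhalf
    linear_combination h1 + h2 + hη
  obtain ⟨h1, h2, h3⟩ := equations_of_eq hθ' hNZ (s' := (1 + η2) • s) rfl hsq
  refine ⟨j, hj, _, fun a => ?_, h1, h2, h3⟩
  rw [← Ideal.Quotient.mk_eq_mk_iff_sub_mem]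
  have hq : q ∘ ((1 + η2) • s) = q ∘ s := by
    ext b
    have : q η2 = 0 := Ideal.Quotient.eq_zero_iff_mem.2 hη2J
    simp [this]
  change q _ = q _
  rw [RingHom.map_mulVec, hTh.map_mk hj, hq, ← RingHom.map_mulVec, hst]

include hπ hJ in
-- D is a single function with nonzero differential, so the point can be moved onto D = 0. What
-- remains is t² = pΘ with unit right-hand side, solved by one Newton step. The adjugate of a 1×1
-- matrix is 1.
lemma exists_equations_one {D Th : (σ → B) → Matrix (Fin 1) (Fin 1) B}
    {p : (σ → B) → B} {D' Th' : σ → Matrix (Fin 1) (Fin 1) B}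
    (hD : HasJetDeriv J x D D') (hTh : HasJetDeriv J x Th Th')
    (hTh0 : IsUnit (Th x).det) (hp : IsUnit (p x))
    (hpJ : ∀ j : σ → B, (∀ i, j i ∈ J) → p (x + j) - p x ∈ J)
    (hind : ∀ Y : Matrix (Fin 1) (Fin 1) ℂ, Yᵀ = Y →
      (∀ i, ∑ a, ∑ b, Y a b * π (((Th x)ᵀ * D' i) a b) = 0) → Y = 0)
    {t : Fin 1 → B} (hdet : (D x).det ∈ J)
    (ht : (vecMulVec t t).map (Ideal.Quotient.mk J) =
      (p x • (Th x * (D x).adjugate)).map (Ideal.Quotient.mk J)) :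
    ∃ j : σ → B, (∀ i, j i ∈ J) ∧ ∃ t' : Fin 1 → B, (∀ a, t' a - t a ∈ J) ∧ (D (x + j)).det = 0 ∧
      (D (x + j))ᵀ *ᵥ t' = 0 ∧
      vecMulVec t' t' = p (x + j) • (Th (x + j) * (D (x + j)).adjugate) := by
  have hu : π (Th x 0 0) ≠ 0 := map_ne_zero_of_isUnit π (by simpa using hTh0)
  obtain ⟨j, hj, hjz⟩ := exists_mulVec_eq_of_independent π hπ
    (Matrix.of fun (a : Fin 1) (i : σ) => D' i 0 0) (by
      intro y hy
      have hY := hind (Matrix.of fun _ _ => y 0) rfl (fun i => by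
        have h1 := hy i
        simp only [Fin.sum_univ_one, of_apply] at h1
        simp only [Fin.sum_univ_one, of_apply, Matrix.mul_apply, transpose_apply, map_mul]
        linear_combination π (Th x 0 0) * h1)
      ext a
      rw [Subsingleton.elim a 0]
      exact congr_fun₂ hY 0 0) J (fun _ => -D x 0 0) (fun _ => J.neg_mem (by simpa using hdet))
  have hD0 : D (x + j) = 0 := by
    ext a b
    have h1 := congrFun hjz 0
    have h2 : ∑ i, D' i 0 0 * j i = -D x 0 0 := h1
    rw [Subsingleton.elim a 0, Subsingleton.elim b 0, hD j hj, Matrix.add_apply, Matrix.sum_apply]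
    simp only [Matrix.smul_apply, smul_eq_mul, mul_comm (j _), h2, add_neg_cancel, Matrix.zero_apply]
  set c : B := p (x + j) * Th (x + j) 0 0 with hc
  have hcJ : t 0 * t 0 - c ∈ J := by
    have h1 : t 0 * t 0 - p x * Th x 0 0 ∈ J := by
      rw [← Ideal.Quotient.mk_eq_mk_iff_sub_mem]
      have h2 := congr_fun₂ ht 0 0
      simpa [vecMulVec_apply, Matrix.mul_apply, adjugate_subsingleton] using h2
    have h2 : t 0 * t 0 - c = (t 0 * t 0 - p x * Th x 0 0) - (p (x + j) - p x) * Th (x + j) 0 0 -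
        p x * (Th (x + j) 0 0 - Th x 0 0) := by rw [hc]; ring
    rw [h2]
    exact J.sub_mem (J.sub_mem h1 (J.mul_mem_right _ (hpJ j hj)))
      (J.mul_mem_left _ (hTh.sub_mem hj 0 0))
  have hcπ : π c ≠ 0 := by
    rw [hc, map_mul, map_eq_of_sub_mem π hJ (hpJ j hj), map_eq_of_sub_mem π hJ (hTh.sub_mem hj 0 0)]
    exact mul_ne_zero (map_ne_zero_of_isUnit π hp) hu
  have htu : IsUnit (2 * t 0) := by
    refine hπ _ fun h => hcπ ?_
    rw [← map_eq_of_sub_mem π hJ hcJ, map_mul]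
    rw [map_mul, map_ofNat] at h
    simpa using h
  obtain ⟨r, hr⟩ := isUnit_iff_exists_inv.1 htu
  set m : B := (t 0 * t 0 - c) * r with hm
  have hmJ : m ∈ J := J.mul_mem_right _ hcJ
  refine ⟨j, hj, fun _ => t 0 - m, fun a => ?_, ?_, ?_, ?_⟩
  · rw [Subsingleton.elim a 0]
    simpa using J.neg_mem hmJ
  · rw [hD0]; simp
  · rw [hD0]; simp
  · ext a b
    rw [Subsingleton.elim a 0, Subsingleton.elim b 0]
    simp only [vecMulVec_apply, adjugate_subsingleton, Matrix.mul_one, Matrix.smul_apply, smul_eq_mul]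
    rw [← hc]
    have h1 : m * m = 0 := hJ _ hmJ _ hmJ
    linear_combination h1 - (t 0 * t 0 - c) * hr - 2 * t 0 * hm

end Reduced

/-! ### Linear systems of matrices and regular points -/

section Pencil

open Matrix

set_option linter.unusedSectionVars false

variable {n ρ : Type*} [Fintype n] [DecidableEq n] [Fintype ρ] [DecidableEq ρ]

/-- The matrix `L₀ + x₁ L₁ + ⋯ + x₅ L₅`. -/
def affineMatrix {B : Type*} [CommRing B] [Algebra ℂ B] (L : Fin 6 → Matrix n n ℂ) (x : Fin 5 → B) :
    Matrix n n B :=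
  ∑ i, (Fin.cons 1 x : Fin 6 → B) i • (L i).map (algebraMap ℂ B)

/-- The identity `λᵀ Ω - Ωᵀ λ = λᵀ W λ` for all members of a linear system of matrices. -/
structure IsPencil (L O : Fin 6 → Matrix n n ℂ) (W : Matrix n n ℂ) : Prop where
  transpose_eq : Wᵀ = -W
  add_eq_zero : ∀ i j, ((L i)ᵀ * O j - (O i)ᵀ * L j - (L i)ᵀ * W * L j) +
    ((L j)ᵀ * O i - (O j)ᵀ * L i - (L j)ᵀ * W * L i) = 0

/-- The conditions on a point that make the double cover smooth over it. -/
structure IsRegularPoint (L O : Fin 6 → Matrix n n ℂ) (x : Fin 5 → ℂ) : Prop where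
  injective : ∀ ξ : n → ℂ, affineMatrix L x *ᵥ ξ = 0 → affineMatrix O x *ᵥ ξ = 0 → ξ = 0
  finrank_ker_le : Module.finrank ℂ (LinearMap.ker (affineMatrix L x).mulVecLin) ≤ 2
  independent : ∀ {k : ℕ} (ξ : Fin k → n → ℂ), LinearIndependent ℂ ξ →
    (∀ a, affineMatrix L x *ᵥ ξ a = 0) → ∀ Y : Matrix (Fin k) (Fin k) ℂ, Yᵀ = Y →
      (∀ m : Fin 5, ∑ a, ∑ b, Y a b * ((affineMatrix O x *ᵥ ξ a) ⬝ᵥ (L m.succ *ᵥ ξ b)) = 0) →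
        Y = 0

section Algebra

variable {B : Type*} [CommRing B] [Algebra ℂ B]

lemma affineMatrix_map {B' : Type*} [CommRing B'] [Algebra ℂ B'] (f : B →ₐ[ℂ] B')
    (L : Fin 6 → Matrix n n ℂ) (x : Fin 5 → B) :
    (affineMatrix L x).map f = affineMatrix L (f ∘ x) := by
  ext a b
  simp only [affineMatrix, Matrix.map_apply, Matrix.sum_apply, Matrix.smul_apply, smul_eq_mul,
    map_sum, map_mul, AlgHom.commutes]
  refine Finset.sum_congr rfl fun i _ => ?_
  congr 1
  refine Fin.cases ?_ (fun m => ?_) i <;> simp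

lemma hasJetDeriv_affineMatrix (J : Ideal B) (L : Fin 6 → Matrix n n ℂ) (x : Fin 5 → B) :
    HasJetDeriv J x (affineMatrix L) (fun m => (L m.succ).map (algebraMap ℂ B)) := by
  intro j _
  simp only [affineMatrix, Fin.sum_univ_succ (n := 5), Fin.cons_zero, Fin.cons_succ, Pi.add_apply,
    add_smul, Finset.sum_add_distrib]
  abel

/-- The defect is Σ yᵢyⱼ K i j with K i j antisymmetric in i and j. -/
lemma IsPencil.relation {L O : Fin 6 → Matrix n n ℂ} {W : Matrix n n ℂ} (h : IsPencil L O W)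
    (x : Fin 5 → B) :
    (affineMatrix L x)ᵀ * affineMatrix O x - (affineMatrix O x)ᵀ * affineMatrix L x =
      (affineMatrix L x)ᵀ * W.map (algebraMap ℂ B) * affineMatrix L x := by
  let K : Fin 6 → Fin 6 → Matrix n n ℂ := fun i j =>
    (L i)ᵀ * O j - (O i)ᵀ * L j - (L i)ᵀ * W * L j
  let y : Fin 6 → B := Fin.cons 1 x
  have hL : affineMatrix L x = ∑ i, y i • (L i).map (algebraMap ℂ B) := rfl
  have hO : affineMatrix O x = ∑ i, y i • (O i).map (algebraMap ℂ B) := rfl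
  have h1 : (affineMatrix L x)ᵀ * affineMatrix O x - (affineMatrix O x)ᵀ * affineMatrix L x -
      (affineMatrix L x)ᵀ * W.map (algebraMap ℂ B) * affineMatrix L x =
        ∑ i, ∑ j, (y i * y j) • (K i j).map (algebraMap ℂ B) := by
    have e1 : ∀ X Y : Fin 6 → Matrix n n ℂ, (∑ i, y i • (X i).map (algebraMap ℂ B))ᵀ *
        ∑ i, y i • (Y i).map (algebraMap ℂ B) =
          ∑ i, ∑ j, (y i * y j) • ((X i)ᵀ * Y j).map (algebraMap ℂ B) := by
      intro X Y
      rw [transpose_sum, Matrix.sum_mul]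
      refine Finset.sum_congr rfl fun i _ => ?_
      rw [Matrix.mul_sum]
      refine Finset.sum_congr rfl fun j _ => ?_
      rw [transpose_smul, Matrix.smul_mul, Matrix.mul_smul, smul_smul, Matrix.map_mul,
        transpose_map]
    have e2 : W.map (algebraMap ℂ B) * affineMatrix L x =
        ∑ i, y i • (W * L i).map (algebraMap ℂ B) := by
      rw [hL, Matrix.mul_sum]
      refine Finset.sum_congr rfl fun i _ => ?_
      rw [Matrix.mul_smul, Matrix.map_mul]
    rw [Matrix.mul_assoc, e2, hL, hO, e1, e1, e1, ← Finset.sum_sub_distrib, ← Finset.sum_sub_distrib]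
    refine Finset.sum_congr rfl fun i _ => ?_
    rw [← Finset.sum_sub_distrib, ← Finset.sum_sub_distrib]
    refine Finset.sum_congr rfl fun j _ => ?_
    rw [← smul_sub, ← smul_sub]
    congr 1
    ext a b
    simp only [K, Matrix.map_apply, Matrix.sub_apply, map_sub, Matrix.mul_assoc]
  have h2 : ∑ i, ∑ j, (y i * y j) • (K i j).map (algebraMap ℂ B) = 0 := by
    have h3 : ∑ i, ∑ j, (y i * y j) • (K i j).map (algebraMap ℂ B) =
        ∑ i, ∑ j, (y i * y j) • (K j i).map (algebraMap ℂ B) := by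
      rw [Finset.sum_comm]
      simp only [mul_comm]
    have h4 : ∀ i j, K i j = -K j i := fun i j => eq_neg_of_add_eq_zero_left (h.add_eq_zero i j)
    have h5 : ∑ i, ∑ j, (y i * y j) • (K i j).map (algebraMap ℂ B) =
        -∑ i, ∑ j, (y i * y j) • (K i j).map (algebraMap ℂ B) := by
      conv_rhs => rw [h3]
      rw [← Finset.sum_neg_distrib]
      refine Finset.sum_congr rfl fun i _ => ?_
      rw [← Finset.sum_neg_distrib]
      refine Finset.sum_congr rfl fun j _ => ?_
      rw [h4 i j, ← smul_neg]
      congr 1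
      ext a b
      simp
    have h6 : (2 : ℂ) • ∑ i, ∑ j, (y i * y j) • (K i j).map (algebraMap ℂ B) = 0 := by
      rw [two_smul]
      nth_rewrite 1 [h5]
      exact neg_add_cancel _
    exact (smul_eq_zero_iff_right (two_ne_zero' ℂ)).1 h6
  rw [h2, sub_eq_zero] at h1
  exact h1

end Algebra

lemma affineMatrix_mul_mul {B : Type*} [CommRing B] [Algebra ℂ B] (L : Fin 6 → Matrix n n ℂ)
    (U U' : Matrix n n ℂ) (x : Fin 5 → B) :
    affineMatrix (fun i => U * L i * U') x =
      U.map (algebraMap ℂ B) * affineMatrix L x * U'.map (algebraMap ℂ B) := by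
  simp only [affineMatrix, Matrix.mul_sum, Matrix.sum_mul, Matrix.map_mul, Matrix.mul_smul,
    Matrix.smul_mul]

lemma affineMatrix_submatrix {B : Type*} [CommRing B] [Algebra ℂ B] (L : Fin 6 → Matrix n n ℂ)
    (e : ρ ≃ n) (x : Fin 5 → B) :
    affineMatrix (fun i => (L i).submatrix e e) x = (affineMatrix L x).submatrix e e := by
  ext a b
  simp [affineMatrix, Matrix.sum_apply]

lemma IsPencil.transform {L O : Fin 6 → Matrix n n ℂ} {W : Matrix n n ℂ} (h : IsPencil L O W)
    {U Ui : Matrix n n ℂ} (hU : Ui * U = 1) (U' : Matrix n n ℂ) :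
    IsPencil (fun i => U * L i * U') (fun i => Uiᵀ * O i * U') (Uiᵀ * W * Ui) where
  transpose_eq := by
    rw [transpose_mul, transpose_mul, transpose_transpose, h.transpose_eq]
    simp [Matrix.mul_assoc]
  add_eq_zero := by
    intro i j
    have h1 : Uᵀ * Uiᵀ = 1 := by rw [← transpose_mul, hU, transpose_one]
    have e1 : ∀ X : Matrix n n ℂ, Uᵀ * (Uiᵀ * X) = X := fun X => by
      rw [← Matrix.mul_assoc, h1, Matrix.one_mul]
    have e2 : ∀ X : Matrix n n ℂ, Ui * (U * X) = X := fun X => by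
      rw [← Matrix.mul_assoc, hU, Matrix.one_mul]
    have h2 := congrArg (fun M => U'ᵀ * M * U') (h.add_eq_zero i j)
    simp only [Matrix.mul_sub, Matrix.sub_mul, Matrix.mul_add, Matrix.add_mul, Matrix.mul_assoc,
      Matrix.mul_zero, Matrix.zero_mul] at h2
    simp only [transpose_mul, transpose_transpose, Matrix.mul_assoc, e1, e2, h2]

lemma IsPencil.submatrix {L O : Fin 6 → Matrix n n ℂ} {W : Matrix n n ℂ} (h : IsPencil L O W)
    (e : ρ ≃ n) :
    IsPencil (fun i => (L i).submatrix e e) (fun i => (O i).submatrix e e) (W.submatrix e e) where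
  transpose_eq := by rw [transpose_submatrix, h.transpose_eq]; rfl
  add_eq_zero := by
    intro i j
    have h1 := congrArg (fun M => M.submatrix e e) (h.add_eq_zero i j)
    simp only [transpose_submatrix, submatrix_mul_equiv]
    exact h1

lemma affineMatrix_mul_mul_complex (L : Fin 6 → Matrix n n ℂ)
    (U U' : Matrix n n ℂ) (x : Fin 5 → ℂ) :
    affineMatrix (fun i => U * L i * U') x = U * affineMatrix L x * U' :=
  affineMatrix_mul_mul L U U' x

lemma IsRegularPoint.transform {L O : Fin 6 → Matrix n n ℂ} {x : Fin 5 → ℂ}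
    (h : IsRegularPoint L O x) {U Ui U' Ui' : Matrix n n ℂ} (hU : Ui * U = 1) (hU' : Ui' * U' = 1) :
    IsRegularPoint (fun i => U * L i * U') (fun i => Uiᵀ * O i * U') x := by
  have hUt : Uᵀ * Uiᵀ = 1 := by rw [← transpose_mul, hU, transpose_one]
  have hinj : ∀ ξ : n → ℂ, U' *ᵥ ξ = 0 → ξ = 0 := fun ξ hξ => by
    rw [← one_mulVec ξ, ← hU', ← mulVec_mulVec, hξ, mulVec_zero]
  have hker : ∀ ξ : n → ℂ, affineMatrix (fun i => U * L i * U') x *ᵥ ξ = 0 →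
      affineMatrix L x *ᵥ (U' *ᵥ ξ) = 0 := fun ξ hξ => by
    rw [affineMatrix_mul_mul_complex, ← mulVec_mulVec, ← mulVec_mulVec] at hξ
    rw [← one_mulVec (affineMatrix L x *ᵥ _), ← hU, ← mulVec_mulVec, hξ, mulVec_zero]
  refine ⟨fun ξ h1 h2 => hinj ξ (h.injective _ (hker ξ h1) ?_), ?_, fun {k} ξ hξ hk Y hY hs => ?_⟩
  · rw [affineMatrix_mul_mul_complex, ← mulVec_mulVec, ← mulVec_mulVec] at h2
    rw [← one_mulVec (affineMatrix O x *ᵥ _), ← hUt, ← mulVec_mulVec, h2, mulVec_zero]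
  · refine le_trans ?_ h.finrank_ker_le
    let φ : LinearMap.ker (affineMatrix (fun i => U * L i * U') x).mulVecLin →ₗ[ℂ]
        LinearMap.ker (affineMatrix L x).mulVecLin :=
      LinearMap.restrict U'.mulVecLin fun ξ hξ => hker ξ hξ
    refine LinearMap.finrank_le_finrank_of_injective (f := φ) ?_
    rw [injective_iff_map_eq_zero]
    intro ξ hξ
    exact Subtype.ext (hinj _ (congrArg Subtype.val hξ))
  · refine h.independent (fun a => U' *ᵥ ξ a) ?_ (fun a => hker _ (hk a)) Y hY fun m => ?_
    · exact hξ.map' U'.mulVecLin (by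
        rw [LinearMap.ker_eq_bot, injective_iff_map_eq_zero]
        exact hinj)
    · rw [← hs m]
      refine Finset.sum_congr rfl fun a _ => Finset.sum_congr rfl fun b _ => ?_
      congr 1
      rw [affineMatrix_mul_mul_complex, ← mulVec_mulVec, ← mulVec_mulVec, ← mulVec_mulVec,
        ← mulVec_mulVec, mulVec_transpose, ← dotProduct_mulVec,
        mulVec_mulVec (M := Ui), hU, one_mulVec, mulVec_mulVec]

lemma IsRegularPoint.submatrix {L O : Fin 6 → Matrix n n ℂ} {x : Fin 5 → ℂ}
    (h : IsRegularPoint L O x) (e : ρ ≃ n) :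
    IsRegularPoint (fun i => (L i).submatrix e e) (fun i => (O i).submatrix e e) x := by
  have hmv : ∀ (M : Matrix n n ℂ) (ξ : ρ → ℂ), M.submatrix e e *ᵥ ξ = (M *ᵥ (ξ ∘ e.symm)) ∘ e :=
    fun M ξ => submatrix_mulVec_equiv M ξ e e
  have hcomp : ∀ ξ : n → ℂ, ξ ∘ e = 0 → ξ = 0 := fun ξ hξ => by
    ext i
    have := congrFun hξ (e.symm i)
    simpa using this
  have hcomp' : ∀ ξ : ρ → ℂ, ξ ∘ e.symm = 0 → ξ = 0 := fun ξ hξ => by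
    ext i
    have := congrFun hξ (e i)
    simpa using this
  have hker : ∀ ξ : ρ → ℂ, affineMatrix (fun i => (L i).submatrix e e) x *ᵥ ξ = 0 →
      affineMatrix L x *ᵥ (ξ ∘ e.symm) = 0 := fun ξ hξ => by
    rw [affineMatrix_submatrix, hmv] at hξ
    exact hcomp _ hξ
  refine ⟨fun ξ h1 h2 => hcomp' ξ (h.injective _ (hker ξ h1) ?_), ?_, fun {k} ξ hξ hk Y hY hs => ?_⟩
  · rw [affineMatrix_submatrix, hmv] at h2
    exact hcomp _ h2
  · refine le_trans ?_ h.finrank_ker_le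
    let φ : LinearMap.ker (affineMatrix (fun i => (L i).submatrix e e) x).mulVecLin →ₗ[ℂ]
        LinearMap.ker (affineMatrix L x).mulVecLin :=
      LinearMap.restrict (LinearMap.funLeft ℂ ℂ e.symm) fun ξ hξ => hker ξ hξ
    refine LinearMap.finrank_le_finrank_of_injective (f := φ) ?_
    rw [injective_iff_map_eq_zero]
    intro ξ hξ
    exact Subtype.ext (hcomp' _ (congrArg Subtype.val hξ))
  · refine h.independent (fun a => ξ a ∘ e.symm) ?_ (fun a => hker _ (hk a)) Y hY fun m => ?_
    · exact hξ.map' (LinearMap.funLeft ℂ ℂ e.symm) (by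
        rw [LinearMap.ker_eq_bot, injective_iff_map_eq_zero]
        exact hcomp')
    · rw [← hs m]
      refine Finset.sum_congr rfl fun a _ => Finset.sum_congr rfl fun b _ => ?_
      congr 1
      rw [affineMatrix_submatrix, hmv, hmv, comp_equiv_dotProduct_comp_equiv]

section Lift

variable {B : Type*} [CommRing B] [Algebra ℂ B] (π : B →ₐ[ℂ] ℂ) (hπ : ∀ b, π b ≠ 0 → IsUnit b)
  {J : Ideal B} (hJ : ∀ a ∈ J, ∀ b ∈ J, a * b = 0)

lemma det_sub_mem {M M' : Matrix n n B}
    (h : M.map (Ideal.Quotient.mk J) = M'.map (Ideal.Quotient.mk J)) : M.det - M'.det ∈ J := by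
  rw [← Ideal.Quotient.mk_eq_mk_iff_sub_mem, RingHom.map_det, RingHom.map_det,
    RingHom.mapMatrix_apply, RingHom.mapMatrix_apply, h]

include hπ in
lemma isUnit_det_of_map {M : Matrix n n B} (h : (M.map π).det ≠ 0) : IsUnit M.det := by
  refine hπ _ ?_
  rwa [AlgHom.map_det, AlgHom.mapMatrix_apply]

lemma map_inv_mul_self {B' : Type*} [CommRing B'] (f : B →+* B') {P : Matrix ρ ρ B}
    (hP : IsUnit P.det) : P.map f * P⁻¹.map f = 1 := by
  rw [← Matrix.map_mul, mul_nonsing_inv _ hP, Matrix.map_one _ f.map_zero f.map_one]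

lemma map_reducedForm {B' : Type*} [CommRing B'] (f : B →+* B') {κ : Type*} [Fintype κ]
    (Om : Matrix (ρ ⊕ κ) (ρ ⊕ κ) B) (Pi : Matrix ρ ρ B) (Q : Matrix ρ κ B) :
    (reducedForm Om Pi Q).map f = reducedForm (Om.map f) (Pi.map f) (Q.map f) := by
  rw [reducedForm, Matrix.map_sub _ f.map_sub, Matrix.map_mul, Matrix.map_mul]
  rfl

include hπ hJ in
lemma exists_equations {k : ℕ} (hk : k ≤ 2) {σ : Type*} [Fintype σ] {x : σ → B}
    {D Th W : (σ → B) → Matrix (Fin k) (Fin k) B}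
    {p : (σ → B) → B} {D' Th' : σ → Matrix (Fin k) (Fin k) B}
    (hD : HasJetDeriv J x D D') (hTh : HasJetDeriv J x Th Th') (hD0 : (D x).map π = 0)
    (hTh0 : IsUnit (Th x).det) (hp : IsUnit (p x))
    (hpJ : ∀ j : σ → B, (∀ i, j i ∈ J) → p (x + j) - p x ∈ J)
    (hrel : ∀ j : σ → B, (∀ i, j i ∈ J) →
      (D (x + j))ᵀ * Th (x + j) - (Th (x + j))ᵀ * D (x + j) =
        (D (x + j))ᵀ * W (x + j) * D (x + j))
    (hW : ∀ y, (W y)ᵀ = -W y)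
    (hind : ∀ Y : Matrix (Fin k) (Fin k) ℂ, Yᵀ = Y →
      (∀ i, ∑ a, ∑ b, Y a b * π (((Th x)ᵀ * D' i) a b) = 0) → Y = 0)
    {t : Fin k → B} (hdet : (D x).det ∈ J)
    (ht : (vecMulVec t t).map (Ideal.Quotient.mk J) =
      (p x • (Th x * (D x).adjugate)).map (Ideal.Quotient.mk J)) :
    ∃ j : σ → B, (∀ i, j i ∈ J) ∧ ∃ t' : Fin k → B, (∀ a, t' a - t a ∈ J) ∧ (D (x + j)).det = 0 ∧
      (D (x + j))ᵀ *ᵥ t' = 0 ∧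
      vecMulVec t' t' = p (x + j) • (Th (x + j) * (D (x + j)).adjugate) := by
  interval_cases k
  · rw [det_isEmpty] at hdet
    have h1 := map_eq_zero_of_mem π hJ hdet
    simp at h1
  · exact exists_equations_one π hπ hJ hD hTh hTh0 hp hpJ hind hdet ht
  · exact exists_equations_two π hπ hJ hD hTh hD0 hTh0 hp hpJ hrel hW hind ht

include hπ hJ in
/-- Points of the double cover can be lifted along square zero extensions, in coordinates for which
the matrix of `λ` at the residue point is block diagonal. -/
lemma exists_isSolution_of_fromBlocks {k : ℕ} {L O : Fin 6 → Matrix (ρ ⊕ Fin k) (ρ ⊕ Fin k) ℂ}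
    {W : Matrix (ρ ⊕ Fin k) (ρ ⊕ Fin k) ℂ} (hLO : IsPencil L O W) {x : Fin 5 → B}
    (hreg : IsRegularPoint L O (π ∘ x)) {P₀ : Matrix ρ ρ ℂ} (hP₀ : P₀.det ≠ 0)
    (hx : affineMatrix L (π ∘ x) = fromBlocks P₀ 0 0 0) {t : ρ ⊕ Fin k → B}
    (hsol : IsSolution ((affineMatrix L x).map (Ideal.Quotient.mk J))
      ((affineMatrix O x).map (Ideal.Quotient.mk J)) (Ideal.Quotient.mk J ∘ t)) :
    ∃ (x' : Fin 5 → B) (t' : ρ ⊕ Fin k → B), (∀ m, x' m - x m ∈ J) ∧ (∀ a, t' a - t a ∈ J) ∧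
      IsSolution (affineMatrix L x') (affineMatrix O x') t' := by
  let P : (Fin 5 → B) → Matrix ρ ρ B := fun y => (affineMatrix L y).toBlocks₁₁
  let Q : (Fin 5 → B) → Matrix ρ (Fin k) B := fun y => (affineMatrix L y).toBlocks₁₂
  let R : (Fin 5 → B) → Matrix (Fin k) ρ B := fun y => (affineMatrix L y).toBlocks₂₁
  let S : (Fin 5 → B) → Matrix (Fin k) (Fin k) B := fun y => (affineMatrix L y).toBlocks₂₂
  let D : (Fin 5 → B) → Matrix (Fin k) (Fin k) B := fun y => S y - R y * (P y)⁻¹ * Q y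
  let Th : (Fin 5 → B) → Matrix (Fin k) (Fin k) B := fun y =>
    reducedForm (affineMatrix O y) (P y)⁻¹ (Q y)
  let W' : (Fin 5 → B) → Matrix (Fin k) (Fin k) B := fun y =>
    ((lowerUnip (R y * (P y)⁻¹))ᵀ * W.map (algebraMap ℂ B) * lowerUnip (R y * (P y)⁻¹)).toBlocks₂₂
  have hblocks : ∀ y, affineMatrix L y = fromBlocks (P y) (Q y) (R y) (S y) := fun y =>
    (fromBlocks_toBlocks _).symm
  have hmapL : (affineMatrix L x).map π = fromBlocks P₀ 0 0 0 := by rw [affineMatrix_map, hx]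
  have hPπ : (P x).map π = P₀ := congrArg toBlocks₁₁ hmapL
  have hQπ : (Q x).map π = 0 := congrArg toBlocks₁₂ hmapL
  have hRπ : (R x).map π = 0 := congrArg toBlocks₂₁ hmapL
  have hSπ : (S x).map π = 0 := congrArg toBlocks₂₂ hmapL
  have hPu : IsUnit (P x).det := isUnit_det_of_map π hπ (by rwa [hPπ])
  have jL := hasJetDeriv_affineMatrix J L x
  have jO := hasJetDeriv_affineMatrix J O x
  have jP : HasJetDeriv J x P _ := jL.submatrix Sum.inl Sum.inl
  have jQ : HasJetDeriv J x Q _ := jL.submatrix Sum.inl Sum.inr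
  have jR : HasJetDeriv J x R _ := jL.submatrix Sum.inr Sum.inl
  have jS : HasJetDeriv J x S _ := jL.submatrix Sum.inr Sum.inr
  have jPi := jP.inv hJ hPu
  -- The off-diagonal blocks Q and R vanish at the residue point, so there the derivative of the
  -- Schur complement is that of S alone.
  obtain ⟨D', jD, hD'⟩ : ∃ D', HasJetDeriv J x D D' ∧
      ∀ i a b, π (D' i a b) = L i.succ (Sum.inr a) (Sum.inr b) := by
    refine ⟨_, jS.sub ((jR.mul hJ jPi).mul hJ jQ), fun i a b => ?_⟩
    have hQ0 : ∀ a b, π (Q x a b) = 0 := fun a b => congr_fun₂ hQπ a b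
    have hR0 : ∀ a b, π (R x a b) = 0 := fun a b => congr_fun₂ hRπ a b
    simp [Matrix.mul_apply, hQ0, hR0]
  obtain ⟨Th', jTh⟩ : ∃ Th', HasJetDeriv J x Th Th' := ⟨_, HasJetDeriv.sub
    (jO.submatrix Sum.inr Sum.inr) (((jO.submatrix Sum.inr Sum.inl).mul hJ jPi).mul hJ jQ)⟩
  have hPu' : ∀ j : Fin 5 → B, (∀ i, j i ∈ J) → IsUnit (P (x + j)).det := fun j hj => by
    refine hπ _ ?_
    rw [map_eq_of_sub_mem π hJ (det_sub_mem (jP.map_mk hj))]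
    exact map_ne_zero_of_isUnit π hPu
  have hW' : ∀ y, (W' y)ᵀ = -W' y := by
    intro y
    have h1 : (W.map (algebraMap ℂ B))ᵀ = -W.map (algebraMap ℂ B) := by
      rw [← transpose_map, hLO.transpose_eq]
      ext a b
      simp
    have h2 : ∀ X : Matrix (ρ ⊕ Fin k) (ρ ⊕ Fin k) B,
        (Xᵀ * W.map (algebraMap ℂ B) * X)ᵀ = -(Xᵀ * W.map (algebraMap ℂ B) * X) := by
      intro X
      rw [transpose_mul, transpose_mul, transpose_transpose, h1]
      simp [Matrix.mul_assoc]
    exact congrArg toBlocks₂₂ (h2 _)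
  have hrel : ∀ j : Fin 5 → B, (∀ i, j i ∈ J) →
      (D (x + j))ᵀ * Th (x + j) - (Th (x + j))ᵀ * D (x + j) =
        (D (x + j))ᵀ * W' (x + j) * D (x + j) := by
    intro j hj
    have h1 := hLO.relation (x + j)
    rw [hblocks] at h1
    exact reduced_relation (mul_nonsing_inv _ (hPu' j hj)) h1
  have hO₁₂ : (affineMatrix O (π ∘ x)).toBlocks₁₂ = 0 := by
    have h1 := hLO.relation (π ∘ x)
    rw [hx, ← fromBlocks_toBlocks (affineMatrix O (π ∘ x)),
      ← fromBlocks_toBlocks (W.map (algebraMap ℂ ℂ))] at h1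
    have h2 := congrArg toBlocks₁₂ h1
    have h3 : P₀ᵀ * (affineMatrix O (π ∘ x)).toBlocks₁₂ = 0 := by
      simpa [fromBlocks_multiply, fromBlocks_transpose, sub_eq_add_neg, fromBlocks_neg,
        fromBlocks_add] using h2
    have h4 : IsUnit P₀ᵀ.det := by rw [det_transpose]; exact isUnit_iff_ne_zero.2 hP₀
    rw [← Matrix.one_mul (affineMatrix O (π ∘ x)).toBlocks₁₂, ← nonsing_inv_mul _ h4,
      Matrix.mul_assoc, h3, Matrix.mul_zero]
  have hLinr : ∀ ξ : Fin k → ℂ, affineMatrix L (π ∘ x) *ᵥ Sum.elim 0 ξ = 0 := fun ξ => by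
    rw [hx, fromBlocks_mulVec]
    simp
  have hOinr : ∀ ξ : Fin k → ℂ, affineMatrix O (π ∘ x) *ᵥ Sum.elim 0 ξ =
      Sum.elim (0 : ρ → ℂ) ((affineMatrix O (π ∘ x)).toBlocks₂₂ *ᵥ ξ) := fun ξ => by
    conv_lhs => rw [← fromBlocks_toBlocks (affineMatrix O (π ∘ x))]
    rw [fromBlocks_mulVec, hO₁₂]
    simp
  have hThπ : (Th x).map π = (affineMatrix O (π ∘ x)).toBlocks₂₂ := by
    have h1 := map_reducedForm π.toRingHom (affineMatrix O x) (P x)⁻¹ (Q x)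
    have h2 : (Q x).map π.toRingHom = 0 := hQπ
    rw [h2] at h1
    conv_rhs at h1 => rw [reducedForm, Matrix.mul_zero, sub_zero]
    rw [← affineMatrix_map]
    exact h1
  -- A kernel vector of Θ at the residue point would be killed by both λ and Ω, against `injective`.
  have hThu : IsUnit (Th x).det := by
    refine isUnit_det_of_map π hπ ?_
    rw [hThπ]
    refine fun h0 => ?_
    obtain ⟨ξ, hξ, h1⟩ := exists_mulVec_eq_zero_iff.2 h0
    have h2 := hreg.injective (Sum.elim 0 ξ) (hLinr ξ) (by rw [hOinr, h1]; simp)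
    exact hξ (congrArg (fun v => v ∘ Sum.inr) h2)
  have hDπ : (D x).map π = 0 := by
    have h1 : (D x).map π = (S x).map π - ((R x).map π * (P x)⁻¹.map π) * (Q x).map π := by
      ext a b; simp [D, Matrix.mul_apply]
    rw [h1, hSπ, hQπ, Matrix.mul_zero, sub_zero]
  let ξ : Fin k → (ρ ⊕ Fin k) → ℂ := fun a => Sum.elim 0 (Pi.single a 1)
  have hξ : LinearIndependent ℂ ξ := by
    refine LinearIndependent.of_comp (LinearMap.funLeft ℂ ℂ Sum.inr) ?_
    exact Pi.linearIndependent_single_one (Fin k) ℂ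
  have hk : k ≤ 2 := by
    let ξ' : Fin k → LinearMap.ker (affineMatrix L (π ∘ x)).mulVecLin := fun a => ⟨ξ a, hLinr _⟩
    have h1 : LinearIndependent ℂ ξ' := LinearIndependent.of_comp (Submodule.subtype _) hξ
    have h2 := h1.fintype_card_le_finrank
    rw [Fintype.card_fin] at h2
    exact h2.trans hreg.finrank_ker_le
  have hind : ∀ Y : Matrix (Fin k) (Fin k) ℂ, Yᵀ = Y →
      (∀ i, ∑ a, ∑ b, Y a b * π (((Th x)ᵀ * D' i) a b) = 0) → Y = 0 := by
    intro Y hY hs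
    refine hreg.independent ξ hξ (fun a => hLinr _) Y hY fun m => ?_
    rw [← hs m]
    refine Finset.sum_congr rfl fun a _ => Finset.sum_congr rfl fun b _ => ?_
    congr 1
    have h1 : ∀ c, π (Th x c a) = (affineMatrix O (π ∘ x)).toBlocks₂₂ c a :=
      fun c => congr_fun₂ hThπ c a
    rw [hOinr, Matrix.mul_apply, map_sum]
    simp only [map_mul, transpose_apply, h1, hD']
    rw [dotProduct, Fintype.sum_sum_type]
    simp [ξ, mulVec, dotProduct, Pi.single_apply]
  let q := Ideal.Quotient.mk J
  have hLq : (affineMatrix L x).map q =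
      fromBlocks ((P x).map q) ((Q x).map q) ((R x).map q) ((S x).map q) := by
    rw [hblocks, fromBlocks_map]
  rw [hLq] at hsol
  obtain ⟨h1, h2, -, h4⟩ := hsol.of_fromBlocks (map_inv_mul_self q hPu)
  have hDq : (S x).map q - (R x).map q * (P x)⁻¹.map q * (Q x).map q = (D x).map q := by
    rw [Matrix.map_sub _ q.map_sub, Matrix.map_mul, Matrix.map_mul]
  rw [hDq] at h2 h4
  have hdet : (D x).det ∈ J := by
    rw [← Ideal.Quotient.eq_zero_iff_mem, RingHom.map_det]
    exact h2
  have ht : (vecMulVec (t ∘ Sum.inr) (t ∘ Sum.inr)).map q =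
      ((P x).det • (Th x * (D x).adjugate)).map q := by
    rw [← map_reducedForm] at h4
    rw [← q.mapMatrix_apply ((P x).det • _), mapMatrix_smul, map_mul, RingHom.map_adjugate,
      RingHom.map_det]
    refine Eq.trans ?_ h4
    ext a b
    simp [vecMulVec_apply, q]
  obtain ⟨j, hj, t₂, ht₂, e1, e2, e3⟩ := exists_equations π hπ hJ hk
    (p := fun y => (P y).det) (t := t ∘ Sum.inr) jD jTh hDπ hThu hPu
    (fun j hj => det_sub_mem (jP.map_mk hj)) hrel hW' hind hdet ht
  refine ⟨x + j, Sum.elim (-((R (x + j) * (P (x + j))⁻¹)ᵀ *ᵥ t₂)) t₂, fun m => ?_, fun a => ?_, ?_⟩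
  · simpa using hj m
  · rcases a with a | a
    · rw [← Ideal.Quotient.mk_eq_mk_iff_sub_mem]
      have jRPi := jR.mul hJ jPi
      have h5 : q ∘ t₂ = (q ∘ t) ∘ Sum.inr := by
        ext b
        exact (Ideal.Quotient.mk_eq_mk_iff_sub_mem _ _).2 (ht₂ b)
      have h6 := congrFun (eq_neg_of_add_eq_zero_left h1) a
      rw [← Matrix.map_mul] at h6
      have h7 := jRPi.map_mk hj
      change q _ = _
      refine Eq.trans ?_ h6.symm
      rw [Sum.elim_inl, Pi.neg_apply, map_neg, RingHom.map_mulVec, h5, transpose_map]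
      change -(_ *ᵥ _) a = -(_ *ᵥ _) a
      rw [show (R (x + j) * (P (x + j))⁻¹).map q = (R x * (P x)⁻¹).map q from h7]
    · exact ht₂ a
  · have h5 := hLO.relation (x + j)
    rw [hblocks] at h5 ⊢
    exact isSolution_fromBlocks (mul_nonsing_inv _ (hPu' j hj)) h5 e1 e2 e3

end Lift

end Pencil

/-! ### Lifting in arbitrary coordinates -/

section GeneralLift

open Matrix

variable {n : Type*} [Fintype n] [DecidableEq n] {B : Type*} [CommRing B] [Algebra ℂ B]
  (π : B →ₐ[ℂ] ℂ) (hπ : ∀ b, π b ≠ 0 → IsUnit b) {J : Ideal B} (hJ : ∀ a ∈ J, ∀ b ∈ J, a * b = 0)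

lemma map_algebraMap_mul_eq_one {U Ui : Matrix n n ℂ} (h : U * Ui = 1) :
    U.map (algebraMap ℂ B) * Ui.map (algebraMap ℂ B) = 1 := by
  rw [← Matrix.map_mul, h, Matrix.map_one _ (map_zero _) (map_one _)]

lemma det_map_algebraMap_eq_one {U : Matrix n n ℂ} (h : U.det = 1) :
    (U.map (algebraMap ℂ B)).det = 1 := by
  rw [← RingHom.mapMatrix_apply, ← RingHom.map_det, h, map_one]

include hπ hJ in
/-- Points of the double cover can be lifted along square zero extensions. -/
theorem exists_isSolution {L O : Fin 6 → Matrix n n ℂ} {W : Matrix n n ℂ} (hLO : IsPencil L O W)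
    {x : Fin 5 → B} (hreg : IsRegularPoint L O (π ∘ x)) {t : n → B}
    (hsol : IsSolution ((affineMatrix L x).map (Ideal.Quotient.mk J))
      ((affineMatrix O x).map (Ideal.Quotient.mk J)) (Ideal.Quotient.mk J ∘ t)) :
    ∃ (x' : Fin 5 → B) (t' : n → B), (∀ m, x' m - x m ∈ J) ∧ (∀ a, t' a - t a ∈ J) ∧
      IsSolution (affineMatrix L x') (affineMatrix O x') t' := by
  classical
  -- Elimination by transvections diagonalises λ at the residue point with determinant-one matrices,
  -- as `IsSolution.transform` requires.
  obtain ⟨l, l', d, hd⟩ := Pivot.exists_list_transvec_mul_mul_list_transvec_eq_diagonal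
    (affineMatrix L (π ∘ x))
  set U := (l.map TransvectionStruct.toMatrix).prod with hUdef
  set U' := (l'.map TransvectionStruct.toMatrix).prod with hUdef'
  have hUd : U.det = 1 := TransvectionStruct.det_toMatrix_prod l
  have hUd' : U'.det = 1 := TransvectionStruct.det_toMatrix_prod l'
  clear_value U U'
  have hU : U * U⁻¹ = 1 := mul_nonsing_inv _ (by rw [hUd]; exact isUnit_one)
  have hU' : U' * U'⁻¹ = 1 := mul_nonsing_inv _ (by rw [hUd']; exact isUnit_one)
  have hUid : U⁻¹.det = 1 := by
    have h1 := congrArg det hU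
    rwa [det_mul, hUd, one_mul, det_one] at h1
  have hUid' : U'⁻¹.det = 1 := by
    have h1 := congrArg det hU'
    rwa [det_mul, hUd', one_mul, det_one] at h1
  generalize U⁻¹ = Ui at *
  generalize U'⁻¹ = Ui' at *
  have hiU : Ui * U = 1 := mul_eq_one_comm.1 hU
  have hiU' : Ui' * U' = 1 := mul_eq_one_comm.1 hU'
  -- Nonzero diagonal entries form the invertible block; the zero ones form the block of size equal
  -- to the corank.
  let e : {i // d i ≠ 0} ⊕ Fin (Fintype.card {i // ¬ d i ≠ 0}) ≃ n :=
    ((Equiv.refl _).sumCongr (Fintype.equivFin _).symm).trans (Equiv.sumCompl fun i => d i ≠ 0)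
  have hpen := (hLO.transform hiU U').submatrix e
  have hreg' := (hreg.transform hiU hiU').submatrix e
  let bm : Matrix n n ℂ → Matrix n n B := fun M => M.map (algebraMap ℂ B)
  let q := Ideal.Quotient.mk J
  have hmul : ∀ {M N : Matrix n n ℂ}, M * N = 1 → bm M * bm N = 1 := map_algebraMap_mul_eq_one
  have hmulq : ∀ {M N : Matrix n n ℂ}, M * N = 1 → (bm M).map q * (bm N).map q = 1 := fun h => by
    rw [← Matrix.map_mul, hmul h, Matrix.map_one _ (map_zero _) (map_one _)]
  have hdet : ∀ {M : Matrix n n ℂ}, M.det = 1 → (bm M).det = 1 := det_map_algebraMap_eq_one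
  have hdetq : ∀ {M : Matrix n n ℂ}, M.det = 1 → ((bm M).map q).det = 1 := fun h => by
    rw [← RingHom.mapMatrix_apply, ← RingHom.map_det, hdet h, map_one]
  have hL : ∀ y : Fin 5 → B, affineMatrix (fun i => (U * L i * U').submatrix e e) y =
      (bm U * affineMatrix L y * bm U').submatrix e e := fun y => by
    rw [affineMatrix_submatrix (fun i => U * L i * U'), affineMatrix_mul_mul]
  have hO : ∀ y : Fin 5 → B, affineMatrix (fun i => (Uiᵀ * O i * U').submatrix e e) y =
      ((bm Ui)ᵀ * affineMatrix O y * bm U').submatrix e e := fun y => by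
    rw [affineMatrix_submatrix (fun i => Uiᵀ * O i * U'), affineMatrix_mul_mul, transpose_map]
  have hblock : affineMatrix (fun i => (U * L i * U').submatrix e e) (π ∘ x) =
      fromBlocks (diagonal fun i : {i // d i ≠ 0} => d i) 0 0 0 := by
    rw [affineMatrix_submatrix (fun i => U * L i * U'), affineMatrix_mul_mul_complex, hd]
    ext a b
    rcases a with a | a <;> rcases b with b | b
    · simp [e, diagonal_apply, Subtype.ext_iff]
    · have h1 : (a : n) ≠ ((Fintype.equivFin {i // ¬ d i ≠ 0}).symm b : n) := fun h =>
        ((Fintype.equivFin {i // ¬ d i ≠ 0}).symm b).2 (h ▸ a.2)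
      simp [e, h1]
    · have h1 : ((Fintype.equivFin {i // ¬ d i ≠ 0}).symm a : n) ≠ (b : n) := fun h =>
        ((Fintype.equivFin {i // ¬ d i ≠ 0}).symm a).2 (h ▸ b.2)
      simp [e, h1]
    · have h1 : d ((Fintype.equivFin {i // ¬ d i ≠ 0}).symm a) = 0 :=
        not_not.1 ((Fintype.equivFin {i // ¬ d i ≠ 0}).symm a).2
      simp only [submatrix_apply, fromBlocks_apply₂₂, Matrix.zero_apply, diagonal_apply]
      split_ifs
      · exact h1
      · rfl
  have hdne : (diagonal fun i : {i // d i ≠ 0} => d i).det ≠ 0 := by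
    rw [det_diagonal]
    exact Finset.prod_ne_zero_iff.2 fun i _ => i.2
  have hsol₁ := (hsol.transform (hmulq hU) (hdetq hUd) (hdetq hUd')).submatrix e
  obtain ⟨x', t', hx', ht', hs⟩ := exists_isSolution_of_fromBlocks π hπ hJ hpen hreg' hdne hblock
    (t := ((bm Ui)ᵀ *ᵥ t) ∘ e) (by
      rw [hL, hO]
      convert hsol₁ using 1
      · rw [← Matrix.map_mul, ← Matrix.map_mul]; rfl
      · rw [← transpose_map (M := bm Ui), ← Matrix.map_mul, ← Matrix.map_mul]; rfl
      · ext a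
        rw [Function.comp_apply, Function.comp_apply, RingHom.map_mulVec, transpose_map]
        rfl)
  rw [hL, hO] at hs
  have hs₁ := (hs.submatrix e.symm).transform (hmul hiU) (hdet hUid) (hdet hUid')
  refine ⟨x', (bm U)ᵀ *ᵥ (t' ∘ e.symm), hx', fun a => ?_, ?_⟩
  · rw [← Ideal.Quotient.mk_eq_mk_iff_sub_mem, RingHom.map_mulVec]
    have h1 : q ∘ t' ∘ e.symm = q ∘ ((bm Ui)ᵀ *ᵥ t) := by
      ext b
      have h2 := (Ideal.Quotient.mk_eq_mk_iff_sub_mem _ _).2 (ht' (e.symm b))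
      simpa using h2
    change (_ *ᵥ (q ∘ t' ∘ e.symm)) a = _
    rw [h1, ← RingHom.map_mulVec, mulVec_mulVec, ← transpose_mul, hmul hiU, transpose_one,
      one_mulVec]
  · convert hs₁ using 1
    · simp only [submatrix_submatrix, Equiv.self_comp_symm, submatrix_id_id]
      simp only [← Matrix.mul_assoc, hmul hiU, Matrix.one_mul]
      rw [Matrix.mul_assoc, hmul hU', Matrix.mul_one]
    · have h1 : (bm U)ᵀ * (bm Ui)ᵀ = 1 := by rw [← transpose_mul, hmul hiU, transpose_one]
      simp only [submatrix_submatrix, Equiv.self_comp_symm, submatrix_id_id]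
      simp only [← Matrix.mul_assoc, h1, Matrix.one_mul]
      rw [Matrix.mul_assoc, hmul hU', Matrix.mul_one]

end GeneralLift

/-! ### Points of the coordinate algebra of X_A -/

section Chart

open Matrix

variable {V : Type*} [AddCommGroup V] [Module ℂ V] (A : Submodule ℂ (ExteriorAlgebra ℂ V))
  (e : Module.Basis (Fin 6) ℂ V) (c : Module.Basis PairIdx ℂ (WedgeQuot A))

/-- The coefficients of the matrix of `λ_A`. -/
def lambdaCoeff (i : Fin 6) : Matrix PairIdx PairIdx ℂ :=
  Matrix.of fun k j => c.repr (Submodule.Quotient.mk (tripleWedge e i j)) k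

/-- The coefficients of the matrix of pairings with the basis of `F`. -/
def omegaCoeff (i : Fin 6) : Matrix PairIdx PairIdx ℂ :=
  Matrix.of fun k j => volForm e ((quotLift A c k : ExteriorAlgebra ℂ V)
      * (tripleWedge e i j : ExteriorAlgebra ℂ V))

variable {B : Type*} [CommRing B] [Algebra ℂ B]
  (f : MvPolynomial PairIdx (MvPolynomial (Fin 5) ℂ) →ₐ[ℂ] B)

lemma map_C_affine (L : Fin 6 → Matrix PairIdx PairIdx ℂ) (k j : PairIdx) :
    f (MvPolynomial.C (∑ i : Fin 6, chartCoord i * MvPolynomial.C (L i k j))) =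
      affineMatrix L (fun m => f (MvPolynomial.C (MvPolynomial.X m))) k j := by
  have h : ∀ r : ℂ, f (MvPolynomial.C (MvPolynomial.C r)) = algebraMap ℂ B r := fun r =>
    f.commutes r
  simp only [affineMatrix, Matrix.sum_apply, Matrix.smul_apply, Matrix.map_apply, map_sum, map_mul,
    h, smul_eq_mul]
  refine Finset.sum_congr rfl fun i _ => ?_
  congr 1
  refine Fin.cases ?_ (fun m => ?_) i <;> simp [chartCoord]

lemma map_lambdaMatrix :
    (lambdaMatrix A e c).map (f.toRingHom.comp MvPolynomial.C) =
      affineMatrix (lambdaCoeff A e c) (fun m => f (MvPolynomial.C (MvPolynomial.X m))) := by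
  ext k j
  exact map_C_affine f (lambdaCoeff A e c) k j

lemma map_omegaMatrix :
    (omegaMatrix A e c).map (f.toRingHom.comp MvPolynomial.C) =
      affineMatrix (omegaCoeff A e c) (fun m => f (MvPolynomial.C (MvPolynomial.X m))) := by
  ext k j
  exact map_C_affine f (omegaCoeff A e c) k j

/-- Identifies B-points of the chart algebra with solutions of the matrix system. -/
lemma chartIdeal_le_ker_iff :
    (∀ p ∈ chartIdeal A e c, f p = 0) ↔
      IsSolution (affineMatrix (lambdaCoeff A e c) (fun m => f (MvPolynomial.C (MvPolynomial.X m))))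
        (affineMatrix (omegaCoeff A e c) (fun m => f (MvPolynomial.C (MvPolynomial.X m))))
        (fun k => f (MvPolynomial.X k)) := by
  rw [← map_lambdaMatrix, ← map_omegaMatrix]
  let g : MvPolynomial (Fin 5) ℂ →+* B := f.toRingHom.comp MvPolynomial.C
  have hg : ∀ r, f (MvPolynomial.C r) = g r := fun r => rfl
  have h0 : (∀ p ∈ chartIdeal A e c, f p = 0) ↔ chartIdeal A e c ≤ RingHom.ker f := Iff.rfl
  have hadj : ∀ k l, g ((omegaMatrix A e c * (lambdaMatrix A e c).adjugate) k l) =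
      ((omegaMatrix A e c).map g * ((lambdaMatrix A e c).map g).adjugate) k l := by
    intro k l
    have h1 := congr_fun₂ (RingHom.map_adjugate g (lambdaMatrix A e c)) 
    simp only [Matrix.mul_apply, map_sum, map_mul]
    refine Finset.sum_congr rfl fun m _ => ?_
    congr 1
    exact h1 m l
  have hdet : g (lambdaMatrix A e c).det = ((lambdaMatrix A e c).map g).det :=
    RingHom.map_det g _
  rw [h0, chartIdeal, Ideal.span_le, Set.union_subset_iff, Set.union_subset_iff,
    Set.singleton_subset_iff, Set.range_subset_iff, Set.range_subset_iff]
  simp only [SetLike.mem_coe, RingHom.mem_ker, map_sum, map_mul, map_sub, hg, hadj, hdet]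
  constructor
  · rintro ⟨⟨h1, h2⟩, h3⟩
    exact ⟨h1, funext h2, by ext k l; exact sub_eq_zero.1 (h3 (k, l))⟩
  · rintro ⟨h1, h2, h3⟩
    exact ⟨⟨h1, fun j => congrFun h2 j⟩, fun kl => sub_eq_zero.2 (congr_fun₂ h3 kl.1 kl.2)⟩

/-- The homomorphism of `ℂ`-algebras with prescribed values on the variables. -/
def evalHom (x : Fin 5 → B) (t : PairIdx → B) :
    MvPolynomial PairIdx (MvPolynomial (Fin 5) ℂ) →ₐ[ℂ] B :=
  { MvPolynomial.eval₂Hom (MvPolynomial.aeval x : MvPolynomial (Fin 5) ℂ →ₐ[ℂ] B).toRingHom t with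
    commutes' := fun r => by
      change MvPolynomial.eval₂Hom _ t (MvPolynomial.C (MvPolynomial.C r)) = _
      simp }

lemma evalHom_C_X (x : Fin 5 → B) (t : PairIdx → B) (m : Fin 5) :
    evalHom x t (MvPolynomial.C (MvPolynomial.X m)) = x m := by
  change MvPolynomial.eval₂Hom _ t (MvPolynomial.C (MvPolynomial.X m)) = _
  simp

lemma evalHom_X (x : Fin 5 → B) (t : PairIdx → B) (k : PairIdx) :
    evalHom x t (MvPolynomial.X k) = t k := by
  change MvPolynomial.eval₂Hom _ t (MvPolynomial.X k) = _
  simp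

lemma algHom_sub_mem {J : Ideal B} {f f' : MvPolynomial PairIdx (MvPolynomial (Fin 5) ℂ) →ₐ[ℂ] B}
    (hx : ∀ m, f' (MvPolynomial.C (MvPolynomial.X m)) - f (MvPolynomial.C (MvPolynomial.X m)) ∈ J)
    (ht : ∀ k, f' (MvPolynomial.X k) - f (MvPolynomial.X k) ∈ J)
    (p : MvPolynomial PairIdx (MvPolynomial (Fin 5) ℂ)) : f' p - f p ∈ J := by
  let q := Ideal.Quotient.mk J
  have h : q.comp f'.toRingHom = q.comp f.toRingHom := by
    refine MvPolynomial.ringHom_ext' (MvPolynomial.ringHom_ext' ?_ fun m => ?_) fun k => ?_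
    · ext r
      have h1 : f' (MvPolynomial.C (MvPolynomial.C r)) = f (MvPolynomial.C (MvPolynomial.C r)) :=
        (f'.commutes r).trans (f.commutes r).symm
      exact congrArg q h1
    · exact (Ideal.Quotient.mk_eq_mk_iff_sub_mem _ _).2 (hx m)
    · exact (Ideal.Quotient.mk_eq_mk_iff_sub_mem _ _).2 (ht k)
  exact (Ideal.Quotient.mk_eq_mk_iff_sub_mem _ _).1 (congrArg (fun g => g p) h)

theorem chartAlgebra_smooth {W : Matrix PairIdx PairIdx ℂ}
    (hpen : IsPencil (lambdaCoeff A e c) (omegaCoeff A e c) W)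
    (hreg : ∀ x, IsRegularPoint (lambdaCoeff A e c) (omegaCoeff A e c) x) :
    Algebra.Smooth ℂ (ChartAlgebra A e c) := by
  refine smooth_quotient_of_lifting ?_ fun {B} _ _ π hπ J hJ f hf => ?_
  · exact Submodule.fg_span (((Set.finite_singleton _).union (Set.finite_range _)).union
      (Set.finite_range _))
  · have h1 := (chartIdeal_le_ker_iff A e c ((Ideal.Quotient.mkₐ ℂ J).comp f)).1 fun p hp =>
      Ideal.Quotient.eq_zero_iff_mem.2 (hf p hp)
    obtain ⟨x', t', hx', ht', hs⟩ := exists_isSolution π hπ hJ hpen (hreg _)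
      (x := fun m => f (MvPolynomial.C (MvPolynomial.X m))) (t := fun k => f (MvPolynomial.X k)) (by
        have h2 := affineMatrix_map (Ideal.Quotient.mkₐ ℂ J) (lambdaCoeff A e c)
          (fun m => f (MvPolynomial.C (MvPolynomial.X m)))
        have h3 := affineMatrix_map (Ideal.Quotient.mkₐ ℂ J) (omegaCoeff A e c)
          (fun m => f (MvPolynomial.C (MvPolynomial.X m)))
        rw [Ideal.Quotient.mkₐ_eq_mk] at h2 h3
        rw [h2, h3]
        exact h1)
    refine ⟨evalHom x' t', algHom_sub_mem (fun m => ?_) fun k => ?_,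
      (chartIdeal_le_ker_iff A e c _).2 ?_⟩
    · rw [evalHom_C_X]; exact hx' m
    · rw [evalHom_X]; exact ht' k
    · simp only [evalHom_C_X, evalHom_X]
      exact hs

end Chart

/-! ### Coordinates on F_v and on ⋀³V/A -/

section Geometry

open Matrix

variable {V : Type*} [AddCommGroup V] [Module ℂ V]

lemma mul_swap_of_mem_three {x y : ExteriorAlgebra ℂ V} (hx : x ∈ ⋀[ℂ]^3 V) (hy : y ∈ ⋀[ℂ]^3 V) :
    x * y = -(y * x) := by
  rw [← wedgePow_top] at hx hy
  refine wedgePow_succ_induction (C := fun x => x * y = -(y * x)) (fun a b ha hb => ?_)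
    (fun v _ z hz => ?_) hx
  · rw [add_mul, ha, hb, mul_add]
    abel
  · rw [mul_assoc, commute_of_mem_wedgePow_two hz, ← mul_assoc, ι_mul_comm_of_mem v hy]
    norm_num [mul_assoc]

section Basis

variable (e : Module.Basis (Fin 6) ℂ V)

lemma eq_zero_of_volForm_eq_zero {z : ExteriorAlgebra ℂ V} (hz : z ∈ ⋀[ℂ]^6 V)
    (h : volForm e z = 0) : z = 0 := by
  rw [← wedgePow_top] at hz
  obtain ⟨s, rfl⟩ := exists_eq_smul_of_mem_wedgePow (e.map Submodule.topEquiv.symm) hz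
  have h1 : volForm e (ιMulti ℂ 6 fun i => ((e.map Submodule.topEquiv.symm) i : V)) = 1 := by
    rw [volForm, ExteriorAlgebra.liftAlternating_apply_ιMulti, Pi.single_eq_same]
    exact e.det_self
  rw [map_smul, h1, smul_eq_mul, mul_one] at h
  rw [h, zero_smul]

lemma coe_tripleWedge (i : Fin 6) (j : PairIdx) :
    (tripleWedge e i j : ExteriorAlgebra ℂ V) =
      ι ℂ (e i) * (ι ℂ (e j.1.1.succ) * ι ℂ (e j.1.2.succ)) := by
  rw [tripleWedge, exteriorPower.ιMulti_apply_coe, ExteriorAlgebra.ιMulti_apply]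
  simp [List.ofFn_succ]

/-- The bivector in `e₁, …, e₅` with given coordinates. -/
def bivectorOfCoord : (PairIdx → ℂ) →ₗ[ℂ] ExteriorAlgebra ℂ V :=
  Fintype.linearCombination ℂ fun j : PairIdx => ι ℂ (e j.1.1.succ) * ι ℂ (e j.1.2.succ)

lemma bivectorOfCoord_apply (ξ : PairIdx → ℂ) : bivectorOfCoord e ξ =
    ∑ j, ξ j • (ι ℂ (e j.1.1.succ) * ι ℂ (e j.1.2.succ)) :=
  Fintype.linearCombination_apply _ _ _

/-- The span of `e₁, …, e₅`. -/
def tailSpan : Submodule ℂ V := Submodule.span ℂ (Set.range fun m : Fin 5 => e m.succ)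

lemma mem_tailSpan (m : Fin 5) : e m.succ ∈ tailSpan e := Submodule.subset_span ⟨m, rfl⟩

lemma finrank_tailSpan : Module.finrank ℂ (tailSpan e) = 5 := by
  have h : LinearIndependent ℂ fun m : Fin 5 => e m.succ :=
    e.linearIndependent.comp _ (Fin.succ_injective 5)
  rw [tailSpan, finrank_span_eq_card h, Fintype.card_fin]

instance : FiniteDimensional ℂ (tailSpan e) :=
  Module.finite_of_finrank_pos (by rw [finrank_tailSpan]; norm_num)

lemma bivectorOfCoord_mem (ξ : PairIdx → ℂ) : bivectorOfCoord e ξ ∈ wedgePow (tailSpan e) 2 := by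
  rw [bivectorOfCoord_apply]
  exact Submodule.sum_mem _ fun j _ => Submodule.smul_mem _ _
    (ι_mul_ι_mem_wedgePow (mem_tailSpan e _) (mem_tailSpan e _))

lemma wedgeContract_bivectorOfCoord (ξ : PairIdx → ℂ) (j : PairIdx) :
    wedgeContract (e.coord j.1.2.succ) (wedgeContract (e.coord j.1.1.succ) (bivectorOfCoord e ξ)) =
      algebraMap ℂ (ExteriorAlgebra ℂ V) (ξ j) := by
  rw [bivectorOfCoord_apply, map_sum, map_sum, Finset.sum_eq_single j]
  · have h1 := j.2
    simp [wedgeContract_ι_mul, wedgeContract_ι, h1.ne, Algebra.algebraMap_eq_smul_one]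
  · intro i _ hij
    have h1 := j.2
    have h2 := i.2
    have h3 : ¬ (i.1.1 = j.1.1 ∧ i.1.2 = j.1.2) := fun h => hij (Subtype.ext (Prod.ext h.1 h.2))
    simp only [map_smul, wedgeContract_ι_mul, wedgeContract_ι, map_sub, wedgeContract_algebraMap,
      Module.Basis.coord_apply, Module.Basis.repr_self, Finsupp.single_apply, Fin.succ_inj, mul_zero,
      sub_zero]
    by_cases ha : i.1.1 = j.1.1
    · have hb : i.1.2 ≠ j.1.2 := fun h => h3 ⟨ha, h⟩
      have hc : i.1.2 ≠ j.1.1 := by rw [← ha]; exact h2.ne'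
      simp [ha, hb, hc]
    · by_cases hc : i.1.2 = j.1.1
      · have hd : i.1.1 ≠ j.1.2 := fun h => by
          rw [h, hc] at h2
          exact lt_asymm h1 h2
        simp [ha, hc, hd, h1.ne]
      · simp [ha, hc]
  · simp

/-- The tautological vector at a point of the chart. -/
def chartVector (x : Fin 5 → ℂ) : V := ∑ i, (Fin.cons 1 x : Fin 6 → ℂ) i • e i

lemma coord_zero_chartVector (x : Fin 5 → ℂ) : e.coord 0 (chartVector e x) = 1 := by
  simp [chartVector, Finsupp.single_apply]

lemma coord_zero_tailSpan {w : V} (hw : w ∈ tailSpan e) : e.coord 0 w = 0 := by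
  have h : tailSpan e ≤ LinearMap.ker (e.coord 0) := by
    rw [tailSpan, Submodule.span_le]
    rintro _ ⟨m, rfl⟩
    simp [LinearMap.mem_ker]
  exact h hw

lemma exists_eq_chartVector_add (x : Fin 5 → ℂ) (w : V) :
    ∃ (r : ℂ) (y : Fin 5 → ℂ), w = r • chartVector e x + ∑ m, y m • e m.succ := by
  refine ⟨e.coord 0 w, fun m => e.coord m.succ w - e.coord 0 w * x m, ?_⟩
  conv_lhs => rw [← e.sum_repr w]
  simp only [chartVector, Fin.sum_univ_succ (n := 5), Fin.cons_zero, Fin.cons_succ, one_smul,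
    smul_add, Finset.smul_sum, smul_smul, sub_smul, Finset.sum_sub_distrib,
    Module.Basis.coord_apply]
  abel

/-- The e₀-coordinate of v is 1, and contraction with it kills the exterior algebra of e₁, …, e₅. So
v∧· is injective there, and bivectors in e₁, …, e₅ are coordinates on F_v. -/
lemma eq_zero_of_chartVector_mul_eq_zero (x : Fin 5 → ℂ) {n : ℕ} {z : ExteriorAlgebra ℂ V}
    (hz : z ∈ wedgePow (tailSpan e) n) (h : ι ℂ (chartVector e x) * z = 0) : z = 0 := by
  have h1 := eq_ι_mul_wedgeContract (coord_zero_chartVector e x) h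
  rwa [wedgeContract_eq_zero (fun w hw => coord_zero_tailSpan e hw) hz, mul_zero] at h1

lemma eq_zero_of_chartVector_mul_bivector {x : Fin 5 → ℂ} {ξ : PairIdx → ℂ}
    (h : ι ℂ (chartVector e x) * bivectorOfCoord e ξ = 0) : ξ = 0 := by
  have h1 := eq_zero_of_chartVector_mul_eq_zero e x (bivectorOfCoord_mem e ξ) h
  ext j
  have h2 := wedgeContract_bivectorOfCoord e ξ j
  rw [h1, map_zero, map_zero] at h2
  exact (ExteriorAlgebra.algebraMap_eq_zero_iff V _).1 h2.symm

/-- Evaluation of a matrix with coefficients in the dual of `⋀³ V` on the tautological vector. -/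
lemma affineMatrix_mulVec (g : PairIdx → ↥(⋀[ℂ]^3 V) →ₗ[ℂ] ℂ) {x : Fin 5 → ℂ} {ξ : PairIdx → ℂ}
    {z : ↥(⋀[ℂ]^3 V)}
    (hz : (z : ExteriorAlgebra ℂ V) = ι ℂ (chartVector e x) * bivectorOfCoord e ξ) (k : PairIdx) :
    (affineMatrix (fun i => Matrix.of fun k j => g k (tripleWedge e i j)) x *ᵥ ξ) k = g k z := by
  have h1 : z = ∑ j, ∑ i, (ξ j * (Fin.cons 1 x : Fin 6 → ℂ) i) • tripleWedge e i j := by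
    refine Subtype.ext ?_
    rw [hz, bivectorOfCoord_apply, chartVector, map_sum, Finset.mul_sum]
    simp only [AddSubmonoidClass.coe_finsetSum, Submodule.coe_smul, coe_tripleWedge]
    refine Finset.sum_congr rfl fun j _ => ?_
    rw [Finset.sum_mul]
    refine Finset.sum_congr rfl fun i _ => ?_
    rw [map_smul, smul_mul_smul_comm, mul_comm]
  rw [h1, map_sum]
  simp only [mulVec, dotProduct]
  refine Finset.sum_congr rfl fun j _ => ?_
  rw [map_sum, affineMatrix, Matrix.sum_apply, Finset.sum_mul]
  refine Finset.sum_congr rfl fun i _ => ?_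
  rw [map_smul]
  simp only [Matrix.smul_apply, Matrix.map_apply, Matrix.of_apply, smul_eq_mul]
  change _ * g k _ * _ = _
  ring

lemma of_mulVec (g : PairIdx → ↥(⋀[ℂ]^3 V) →ₗ[ℂ] ℂ) {i : Fin 6} {ξ : PairIdx → ℂ}
    {z : ↥(⋀[ℂ]^3 V)}
    (hz : (z : ExteriorAlgebra ℂ V) = ι ℂ (e i) * bivectorOfCoord e ξ) (k : PairIdx) :
    ((Matrix.of fun k j => g k (tripleWedge e i j)) *ᵥ ξ) k = g k z := by
  have h1 : z = ∑ j, ξ j • tripleWedge e i j := by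
    refine Subtype.ext ?_
    rw [hz, bivectorOfCoord_apply, Finset.mul_sum]
    simp only [AddSubmonoidClass.coe_finsetSum, Submodule.coe_smul, coe_tripleWedge]
    refine Finset.sum_congr rfl fun j _ => ?_
    rw [mul_smul_comm]
  rw [h1, map_sum]
  simp only [mulVec, dotProduct]
  refine Finset.sum_congr rfl fun j _ => ?_
  rw [map_smul, smul_eq_mul, mul_comm, Matrix.of_apply]

end Basis

section Quot

variable {A : Submodule ℂ (ExteriorAlgebra ℂ V)} (c : Module.Basis PairIdx ℂ (WedgeQuot A))

lemma sub_sum_quotLift_mem (z : ↥(⋀[ℂ]^3 V)) :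
    (z : ExteriorAlgebra ℂ V) - ∑ k, c.repr (Submodule.Quotient.mk z) k •
      (quotLift A c k : ExteriorAlgebra ℂ V) ∈ A := by
  have h1 : ∀ k, Submodule.Quotient.mk (p := A.submoduleOf (⋀[ℂ]^3 V)) (quotLift A c k) = c k :=
    fun k => Function.surjInv_eq _ _
  have h2 : Submodule.Quotient.mk (p := A.submoduleOf (⋀[ℂ]^3 V))
      (z - ∑ k, c.repr (Submodule.Quotient.mk z) k • quotLift A c k) = 0 := by
    rw [Submodule.Quotient.mk_sub, sub_eq_zero]
    have h3 : Submodule.Quotient.mk (p := A.submoduleOf (⋀[ℂ]^3 V))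
        (∑ k, c.repr (Submodule.Quotient.mk z) k • quotLift A c k) =
          ∑ k, c.repr (Submodule.Quotient.mk z) k • c k := by
      rw [← Submodule.mkQ_apply, map_sum]
      simp only [map_smul, Submodule.mkQ_apply, h1]
    rw [h3, c.sum_repr]
  have h4 := Submodule.mem_comap.1 ((Submodule.Quotient.mk_eq_zero _).1 h2)
  simpa using h4

lemma mem_of_forall_repr_eq_zero {z : ↥(⋀[ℂ]^3 V)}
    (h : ∀ k, c.repr (Submodule.Quotient.mk z) k = 0) : (z : ExteriorAlgebra ℂ V) ∈ A := by
  simpa [h] using sub_sum_quotLift_mem c z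

end Quot

end Geometry

/-! ### Regularity of every point when A lies in LG⁰ -/

section Final

open Matrix

variable {V : Type*} [AddCommGroup V] [Module ℂ V] {A : Submodule ℂ (ExteriorAlgebra ℂ V)}
  (e : Module.Basis (Fin 6) ℂ V) (c : Module.Basis PairIdx ℂ (WedgeQuot A))

/-- The matrix of the symplectic form on the representatives of the basis of `⋀³ V / A`. -/
def quotForm : Matrix PairIdx PairIdx ℂ :=
  Matrix.of fun k l => volForm e ((quotLift A c k : ExteriorAlgebra ℂ V) * quotLift A c l)

/-- The projection of `⋀³ V` to the span of the representatives of the basis of `⋀³ V / A`. -/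
def quotProj (z : ↥(⋀[ℂ]^3 V)) : ↥(⋀[ℂ]^3 V) :=
  ∑ k, c.repr (Submodule.Quotient.mk z) k • quotLift A c k

lemma sub_quotProj_mem (z : ↥(⋀[ℂ]^3 V)) :
    (z : ExteriorAlgebra ℂ V) - (quotProj c z : ExteriorAlgebra ℂ V) ∈ A := by
  simpa [quotProj] using sub_sum_quotLift_mem c z

lemma volForm_quotProj_mul (z : ↥(⋀[ℂ]^3 V)) (y : ExteriorAlgebra ℂ V) :
    volForm e ((quotProj c z : ExteriorAlgebra ℂ V) * y) = ∑ k,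
      c.repr (Submodule.Quotient.mk z) k * volForm e ((quotLift A c k : ExteriorAlgebra ℂ V) * y) := by
  simp [quotProj, Finset.sum_mul]

lemma volForm_mul_swap (x y : ↥(⋀[ℂ]^3 V)) :
    volForm e ((x : ExteriorAlgebra ℂ V) * y) = -volForm e ((y : ExteriorAlgebra ℂ V) * x) := by
  rw [mul_swap_of_mem_three x.2 y.2, map_neg]

/-- Expand ω(z − pz, w − pw) = 0, where p is the projection: both arguments lie in the isotropic
space A. -/
lemma volForm_quotProj_identity (hA : IsLagrangian A) (z w : ↥(⋀[ℂ]^3 V)) :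
    volForm e ((quotProj c z : ExteriorAlgebra ℂ V) * w) -
      volForm e ((quotProj c w : ExteriorAlgebra ℂ V) * z) -
        volForm e ((quotProj c z : ExteriorAlgebra ℂ V) * quotProj c w) =
      volForm e ((z : ExteriorAlgebra ℂ V) * w) := by
  have h1 := ((hA.2 _ (hA.1 (sub_quotProj_mem c z))).1 (sub_quotProj_mem c z)) _
    (sub_quotProj_mem c w)
  have h2 := congrArg (volForm e) h1
  simp only [sub_mul, mul_sub, map_sub, map_zero] at h2
  rw [volForm_mul_swap e (quotProj c w) z]
  linear_combination -h2

/-- By the projection identity each entry is ω(eᵢ∧α, eⱼ∧β) with α, β bivectors, that is eᵢ∧eⱼ∧α∧β,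
which is antisymmetric in i and j. -/
theorem isPencil (hA : IsLagrangian A) :
    IsPencil (lambdaCoeff A e c) (omegaCoeff A e c) (quotForm e c) where
  transpose_eq := by
    ext k l
    exact volForm_mul_swap e _ _
  add_eq_zero := by
    have key : ∀ i j a b, ((lambdaCoeff A e c i)ᵀ * omegaCoeff A e c j -
        (omegaCoeff A e c i)ᵀ * lambdaCoeff A e c j -
          (lambdaCoeff A e c i)ᵀ * quotForm e c * lambdaCoeff A e c j) a b =
        volForm e ((tripleWedge e i a : ExteriorAlgebra ℂ V) * tripleWedge e j b) := by
      intro i j a b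
      rw [← volForm_quotProj_identity e c hA, volForm_quotProj_mul, volForm_quotProj_mul,
        volForm_quotProj_mul, Matrix.sub_apply, Matrix.sub_apply, Matrix.mul_assoc]
      simp only [Matrix.mul_apply]
      congr 1
      · congr 1
        refine Finset.sum_congr rfl fun k _ => ?_
        exact mul_comm _ _
      · refine Finset.sum_congr rfl fun k _ => ?_
        congr 1
        simp only [quotProj, AddSubmonoidClass.coe_finsetSum, Submodule.coe_smul, Finset.mul_sum,
          mul_smul_comm, map_sum, map_smul, smul_eq_mul]
        refine Finset.sum_congr rfl fun l _ => ?_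
        exact mul_comm _ _
    intro i j
    ext a b
    rw [Matrix.add_apply, key, key, ← map_add, coe_tripleWedge, coe_tripleWedge, coe_tripleWedge,
      coe_tripleWedge]
    have h1 : ∀ (p q r s : V) (v w : V), ι ℂ v * (ι ℂ p * ι ℂ q) * (ι ℂ w * (ι ℂ r * ι ℂ s)) =
        ι ℂ v * (ι ℂ w * ((ι ℂ p * ι ℂ q) * (ι ℂ r * ι ℂ s))) := by
      intro p q r s v w
      have h2 := commute_of_mem_wedgePow_two (ι_mul_ι_mem_wedgePow (Submodule.mem_top (x := p))
        (Submodule.mem_top (x := q))) (ι ℂ w)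
      rw [mul_assoc, ← mul_assoc (ι ℂ p * ι ℂ q), h2, mul_assoc]
    rw [h1, h1, ι_mul_swap_mul, neg_add_cancel, map_zero]
    rfl

/-- A binary quadratic form over ℂ, αX² + 2βXY + γY², is a product (pX + qY)(rX + sY). -/
lemma exists_binary_factorization (α β γ : ℂ) :
    ∃ p q r s : ℂ, p * r = α ∧ p * s + q * r = 2 * β ∧ q * s = γ := by
  by_cases hα : α = 0
  · exact ⟨0, 1, 2 * β, γ, by rw [hα, zero_mul], by ring, by ring⟩
  · obtain ⟨δ, hδ⟩ := IsAlgClosed.exists_eq_mul_self (β * β - α * γ)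
    refine ⟨1, (β + δ) / α, α, β - δ, by ring, ?_, ?_⟩
    · field_simp
      ring
    · field_simp
      linear_combination hδ

/-- Symmetric bilinear expressions in at most two bivectors in a five-dimensional space are
independent when no combination of the bivectors is decomposable. -/
lemma eq_zero_of_sum_mul_eq_zero {P : Submodule ℂ V} [FiniteDimensional ℂ P]
    (hP : Module.finrank ℂ P = 5) {k : ℕ} (hk : k ≤ 2) {τ : Fin k → ExteriorAlgebra ℂ V}
    (hτ : ∀ a, τ a ∈ wedgePow P 2) (hind : LinearIndependent ℂ τ)
    (hdec : ∀ z ∈ Submodule.span ℂ (Set.range τ), z * z = 0 → z = 0)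
    {Y : Matrix (Fin k) (Fin k) ℂ} (hY : Yᵀ = Y)
    (h : ∑ a, ∑ b, Y a b • (τ a * τ b) = 0) : Y = 0 := by
  have hmem : ∀ a, τ a ∈ Submodule.span ℂ (Set.range τ) := fun a => Submodule.subset_span ⟨a, rfl⟩
  interval_cases k
  · ext a
    exact a.elim0
  · simp only [Fin.sum_univ_one] at h
    ext a b
    rw [Subsingleton.elim a 0, Subsingleton.elim b 0]
    by_contra h0
    have h1 := (smul_eq_zero.1 h).resolve_left h0
    exact hind.ne_zero 0 (hdec _ (hmem 0) h1)
  · have hY' : Y 1 0 = Y 0 1 := congr_fun₂ hY 0 1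
    obtain ⟨p, q, r, s, h1, h2, h3⟩ := exists_binary_factorization (Y 0 0) (Y 0 1) (Y 1 1)
    have hcomb : ∀ u v : ℂ, u • τ 0 + v • τ 1 ∈ Submodule.span ℂ (Set.range τ) := fun u v =>
      Submodule.add_mem _ (Submodule.smul_mem _ _ (hmem 0)) (Submodule.smul_mem _ _ (hmem 1))
    have hcomb' : ∀ u v : ℂ, u • τ 0 + v • τ 1 ∈ wedgePow P 2 := fun u v =>
      Submodule.add_mem _ (Submodule.smul_mem _ _ (hτ 0)) (Submodule.smul_mem _ _ (hτ 1))
    have hind' : ∀ u v : ℂ, u • τ 0 + v • τ 1 = 0 → u = 0 ∧ v = 0 := by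
      intro u v huv
      have h4 := Fintype.linearIndependent_iff.1 hind ![u, v] (by simpa [Fin.sum_univ_two] using huv)
      exact ⟨h4 0, h4 1⟩
    have hprod : (p • τ 0 + q • τ 1) * (r • τ 0 + s • τ 1) = 0 := by
      rw [← h]
      have h4 := commute_of_mem_wedgePow_two (hτ 1) (τ 0)
      simp only [Fin.sum_univ_two, add_mul, mul_add, smul_mul_smul_comm, hY', h4]
      have h5 : Y 0 1 = (p * s + q * r) / 2 := by rw [h2]; ring
      rw [h5, ← h1, ← h3]
      module
    have h6 : (p = 0 ∧ q = 0) ∨ (r = 0 ∧ s = 0) := by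
      refine (exists_decomposable_of_mul_eq_zero hP (hcomb' p q) (hcomb' r s) hprod
        fun u v huv => hdec _ ?_ huv).imp (hind' _ _) (hind' _ _)
      exact Submodule.add_mem _ (Submodule.smul_mem _ _ (hcomb p q))
        (Submodule.smul_mem _ _ (hcomb r s))
    have h00 : Y 0 0 = 0 := by rw [← h1]; rcases h6 with ⟨h6, h7⟩ | ⟨h6, h7⟩ <;> simp [h6]
    have h11 : Y 1 1 = 0 := by rw [← h3]; rcases h6 with ⟨h6, h7⟩ | ⟨h6, h7⟩ <;> simp [h7]
    have h01 : Y 0 1 = 0 := by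
      have h8 : 2 * Y 0 1 = 0 := by
        rw [← h2]; rcases h6 with ⟨h6, h7⟩ | ⟨h6, h7⟩ <;> simp [h6, h7]
      simpa using h8
    ext a b
    fin_cases a <;> fin_cases b
    exacts [h00, h01, hY'.trans h01, h11]

section Point

variable (x : Fin 5 → ℂ)

/-- The element `v ∧ τ` of `⋀³ V` for the tautological vector `v`. -/
def fiberVector (ξ : PairIdx → ℂ) : ↥(⋀[ℂ]^3 V) :=
  ⟨ι ℂ (chartVector e x) * bivectorOfCoord e ξ, by
    rw [← wedgePow_top]
    exact ι_mul_mem_wedgePow Submodule.mem_top (wedgePow_mono le_top 2 (bivectorOfCoord_mem e ξ))⟩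

lemma lambda_mulVec (ξ : PairIdx → ℂ) (k : PairIdx) :
    (affineMatrix (lambdaCoeff A e c) x *ᵥ ξ) k =
      c.repr (Submodule.Quotient.mk (fiberVector e x ξ)) k :=
  affineMatrix_mulVec e (fun k => (c.coord k) ∘ₗ (A.submoduleOf (⋀[ℂ]^3 V)).mkQ) rfl k

/-- The pairing with a representative of a basis vector of `⋀³ V / A`. -/
def quotPairing (k : PairIdx) : ↥(⋀[ℂ]^3 V) →ₗ[ℂ] ℂ :=
  (volForm e) ∘ₗ (LinearMap.mulLeft ℂ (quotLift A c k : ExteriorAlgebra ℂ V)) ∘ₗ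
    (⋀[ℂ]^3 V).subtype

lemma quotPairing_apply (k : PairIdx) (z : ↥(⋀[ℂ]^3 V)) : quotPairing e c k z =
    volForm e ((quotLift A c k : ExteriorAlgebra ℂ V) * (z : ExteriorAlgebra ℂ V)) := rfl

lemma omega_mulVec (ξ : PairIdx → ℂ) (k : PairIdx) :
    (affineMatrix (omegaCoeff A e c) x *ᵥ ξ) k =
      volForm e ((quotLift A c k : ExteriorAlgebra ℂ V) * fiberVector e x ξ) :=
  (affineMatrix_mulVec e (quotPairing e c) (z := fiberVector e x ξ) rfl k).trans
    (quotPairing_apply e c k _)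

lemma fiberVector_mem {ξ : PairIdx → ℂ} (h : affineMatrix (lambdaCoeff A e c) x *ᵥ ξ = 0) :
    (fiberVector e x ξ : ExteriorAlgebra ℂ V) ∈ A :=
  mem_of_forall_repr_eq_zero c fun k => by rw [← lambda_mulVec, h]; rfl

/-- The derivative of λ in the direction eᵢ, paired with a kernel vector. Since v∧τ lies in A, its
pairing with eᵢ∧τ' depends only on the class modulo A, so representatives may be dropped. -/
lemma dotProduct_eq_volForm (hA : IsLagrangian A) {ξ ξ' : PairIdx → ℂ}
    (h : affineMatrix (lambdaCoeff A e c) x *ᵥ ξ = 0) (i : Fin 6) :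
    (affineMatrix (omegaCoeff A e c) x *ᵥ ξ) ⬝ᵥ (lambdaCoeff A e c i *ᵥ ξ') =
      volForm e (ι ℂ (e i) * (ι ℂ (chartVector e x) * (bivectorOfCoord e ξ * bivectorOfCoord e ξ'))) := by
  let z : ↥(⋀[ℂ]^3 V) := ⟨ι ℂ (e i) * bivectorOfCoord e ξ', by
    rw [← wedgePow_top]
    exact ι_mul_mem_wedgePow Submodule.mem_top (wedgePow_mono le_top 2 (bivectorOfCoord_mem e ξ'))⟩
  have h1 : ∀ k, (lambdaCoeff A e c i *ᵥ ξ') k = c.repr (Submodule.Quotient.mk z) k := fun k =>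
    of_mulVec e (fun k => (c.coord k) ∘ₗ (A.submoduleOf (⋀[ℂ]^3 V)).mkQ) rfl k
  have h2 : (affineMatrix (omegaCoeff A e c) x *ᵥ ξ) ⬝ᵥ (lambdaCoeff A e c i *ᵥ ξ') =
      volForm e ((quotProj c z : ExteriorAlgebra ℂ V) * fiberVector e x ξ) := by
    rw [volForm_quotProj_mul]
    refine Finset.sum_congr rfl fun k _ => ?_
    rw [h1, omega_mulVec, mul_comm]
  have h3 := ((hA.2 _ (hA.1 (sub_quotProj_mem c z))).1 (sub_quotProj_mem c z)) _
    (fiberVector_mem e c x h)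
  rw [sub_mul, sub_eq_zero] at h3
  rw [h2, ← h3]
  congr 1
  change ι ℂ (e i) * bivectorOfCoord e ξ' * (ι ℂ (chartVector e x) * bivectorOfCoord e ξ) = _
  have h4 := commute_of_mem_wedgePow_two (bivectorOfCoord_mem e ξ')
  rw [mul_assoc, h4, mul_assoc, ← h4 (bivectorOfCoord e ξ), h4]

/-- The kernel of λ embeds in F_v ∩ A, which bounds it. An element of it also killed by Ω is
orthogonal to A and to the representatives of ⋀³V/A, hence zero. Independence is
`eq_zero_of_sum_mul_eq_zero`, since a bivector τ with τ∧τ = 0 would make v∧τ ∈ A decomposable. -/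
theorem isRegularPoint (hA : A ∈ LGZero V) :
    IsRegularPoint (lambdaCoeff A e c) (omegaCoeff A e c) x := by
  obtain ⟨hL, hdec, hfib⟩ := hA
  have hV : Module.finrank ℂ V = 6 := by simpa using Module.finrank_eq_card_basis e
  have hfd : FiniteDimensional ℂ V := e.finiteDimensional_of_finite
  have hfdt : Module.finrank ℂ (⊤ : Submodule ℂ V) = 6 := by rw [finrank_top ℂ V, hV]
  have hker : Module.finrank ℂ (LinearMap.ker (affineMatrix (lambdaCoeff A e c) x).mulVecLin) ≤ 2 := by
    refine le_trans ?_ (hfib (chartVector e x))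
    have : FiniteDimensional ℂ ↥(wedgeFiber (chartVector e x) ⊓ A) := by
      have h1 : wedgeFiber (chartVector e x) ⊓ A ≤ wedgePow (⊤ : Submodule ℂ V) 3 := by
        rw [wedgePow_top]
        exact inf_le_right.trans hL.1
      exact Submodule.finiteDimensional_of_le h1
    refine finrank_le_of_forall_eq_zero
      ((LinearMap.mulLeft ℂ (ι ℂ (chartVector e x))) ∘ₗ bivectorOfCoord e) (fun ξ hξ => ⟨?_, ?_⟩)
      fun ξ _ h => eq_zero_of_chartVector_mul_bivector e h
    · change ι ℂ (chartVector e x) * bivectorOfCoord e ξ ∈ wedgeFiber (chartVector e x)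
      refine Submodule.mul_mem_mul (Submodule.mem_span_singleton_self (ι ℂ (chartVector e x))) ?_
      rw [← wedgePow_top]
      exact wedgePow_mono le_top 2 (bivectorOfCoord_mem e ξ)
    · exact fiberVector_mem e c x hξ
  refine ⟨fun ξ h1 h2 => ?_, hker, fun {k} ξ hξ hk Y hY hs => ?_⟩
  · refine eq_zero_of_chartVector_mul_bivector e (x := x) ?_
    have hmem := fiberVector_mem e c x h1
    refine eq_zero_of_forall_mul_eq_zero (P := ⊤) (n := 3) (k := 3) (by rw [hfdt])
      (by rw [wedgePow_top]; exact (fiberVector e x ξ).2) fun y hy => ?_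
    rw [wedgePow_top] at hy
    have h3 := ((hL.2 _ (hL.1 (sub_quotProj_mem c ⟨y, hy⟩))).1 (sub_quotProj_mem c ⟨y, hy⟩)) _ hmem
    rw [sub_mul, sub_eq_zero] at h3
    refine eq_zero_of_volForm_eq_zero e ?_ ?_
    · rw [← wedgePow_top] at hy ⊢
      exact mul_mem_wedgePow hy (by rw [wedgePow_top]; exact (fiberVector e x ξ).2)
    · refine (congrArg (volForm e) h3).trans ?_
      rw [volForm_quotProj_mul]
      refine Finset.sum_eq_zero fun k _ => ?_
      rw [← omega_mulVec, h2]
      simp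
  · have hk2 : k ≤ 2 := by
      let ξ' : Fin k → LinearMap.ker (affineMatrix (lambdaCoeff A e c) x).mulVecLin :=
        fun a => ⟨ξ a, hk a⟩
      have h1 : LinearIndependent ℂ ξ' := LinearIndependent.of_comp (Submodule.subtype _) hξ
      have h2 := h1.fintype_card_le_finrank
      rw [Fintype.card_fin] at h2
      exact h2.trans hker
    have hinj : LinearMap.ker (bivectorOfCoord e) = ⊥ := by
      rw [LinearMap.ker_eq_bot, injective_iff_map_eq_zero]
      intro ξ h0
      exact eq_zero_of_chartVector_mul_bivector e (x := x) (by rw [h0, mul_zero])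
    refine eq_zero_of_sum_mul_eq_zero (finrank_tailSpan e) hk2
      (τ := fun a => bivectorOfCoord e (ξ a)) (fun a => bivectorOfCoord_mem e _)
      (hξ.map' _ hinj) (fun z hz hzz => ?_) hY ?_
    · have h1 : ∀ z ∈ Submodule.span ℂ (Set.range fun a => bivectorOfCoord e (ξ a)),
          z ∈ wedgePow (tailSpan e) 2 ∧ ι ℂ (chartVector e x) * z ∈ A := by
        intro z hz
        have h2 : Submodule.span ℂ (Set.range fun a => bivectorOfCoord e (ξ a)) ≤
            wedgePow (tailSpan e) 2 ⊓
              A.comap (LinearMap.mulLeft ℂ (ι ℂ (chartVector e x))) := by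
          rw [Submodule.span_le]
          rintro _ ⟨a, rfl⟩
          exact ⟨bivectorOfCoord_mem e _, fiberVector_mem e c x (hk a)⟩
        exact h2 hz
      obtain ⟨h2, h3⟩ := h1 z hz
      obtain ⟨v, -, w, -, h4⟩ := exists_ι_mul_ι_eq_of_mul_self_eq_zero h2 hzz
      refine eq_zero_of_chartVector_mul_eq_zero e x h2 ?_
      rw [h4, ← mul_assoc] at h3 ⊢
      exact hdec _ _ _ h3
    · have hS : ∑ a, ∑ b, Y a b • (bivectorOfCoord e (ξ a) * bivectorOfCoord e (ξ b)) ∈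
          wedgePow (tailSpan e) 4 :=
        Submodule.sum_mem _ fun a _ => Submodule.sum_mem _ fun b _ => Submodule.smul_mem _ _
          (mul_mem_wedgePow (bivectorOfCoord_mem e _) (bivectorOfCoord_mem e _))
      refine eq_zero_of_chartVector_mul_eq_zero e x hS ?_
      set S := ∑ a, ∑ b, Y a b • (bivectorOfCoord e (ξ a) * bivectorOfCoord e (ξ b)) with hSdef
      have hvS : ι ℂ (chartVector e x) * S ∈ wedgePow (⊤ : Submodule ℂ V) 5 :=
        ι_mul_mem_wedgePow Submodule.mem_top (wedgePow_mono le_top 4 hS)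
      -- It suffices to multiply by every w: the multiple of v in w contributes nothing, and the
      -- directions e₁, …, e₅ are the five derivatives in the hypothesis.
      refine eq_zero_of_forall_ι_mul_eq_zero hvS ⊤ (by rw [hfdt]; norm_num) fun w _ => ?_
      obtain ⟨r, y, rfl⟩ := exists_eq_chartVector_add e x w
      have hm : ∀ m : Fin 5, ι ℂ (e m.succ) * (ι ℂ (chartVector e x) * S) = 0 := by
        intro m
        refine eq_zero_of_volForm_eq_zero e ?_ ?_
        · rw [← wedgePow_top]
          exact ι_mul_mem_wedgePow Submodule.mem_top hvS
        · rw [← hs m, hSdef]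
          simp only [Finset.mul_sum, map_sum, mul_smul_comm, map_smul, smul_eq_mul]
          refine Finset.sum_congr rfl fun a _ => Finset.sum_congr rfl fun b _ => ?_
          rw [dotProduct_eq_volForm e c x hL (hk a)]
      rw [map_add, map_smul, map_sum, add_mul, smul_mul_assoc, ι_mul_self_mul, smul_zero, zero_add,
        Finset.sum_mul]
      refine Finset.sum_eq_zero fun m _ => ?_
      rw [map_smul, smul_mul_assoc, hm, smul_zero]

end Point

theorem doubleCoverIsSmooth_of_mem_LGZero {A : Submodule ℂ (ExteriorAlgebra ℂ V)}
    (hA : A ∈ LGZero V) : DoubleCoverIsSmooth A := fun e c =>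
  chartAlgebra_smooth A e c (isPencil e c hA.1) fun x => isRegularPoint e c x hA

end Final

end

theorem mainTheorem6 {V : Type*} [AddCommGroup V] [Module ℂ V]
    (hV : Module.finrank ℂ V = 6)
    (σ : V →ₗ[ℂ] V) (hσ : σ ∘ₗ σ = LinearMap.id)
    (hplus : Module.finrank ℂ (plusSpace σ) = 4)
    (A₀ : Submodule ℂ (ExteriorAlgebra ℂ V)) (hA₀ : A₀ ∈ LGStar σ) :
    ∃ U : Set (QuadraticForm ℂ (plusSpace σ)),
      IsZariskiOpen U ∧ U.Nonempty ∧
      ∀ A ∈ LGStar σ, minusPart σ A = minusPart σ A₀ →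
        ∀ q ∈ U, IsQuadricEquation σ A q →
          A ∈ LGZero V ∧ DoubleCoverIsSmooth A := by
  obtain ⟨U, hU, hne, h⟩ := exists_isZariskiOpen_mem_LGZero hσ hplus hA₀
  refine ⟨U, hU, hne, fun A hA hmin q hq hAq => ?_⟩
  have hA0 := h A hA hmin q hq hAq
  exact ⟨hA0, doubleCoverIsSmooth_of_mem_LGZero hA0⟩
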